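/- Let $(M^n,\langle\cdot,\cdot\rangle)$ be a smooth Riemannian manifold with Levi-Civita connection $\overline\nabla$, and let $\Sigma$ be a smooth manifold of dimension $m$ (any dimension and codimension $n-m\ge 0$). Let $F:\Sigma\times[0,T)\to M$ be a smooth mean curvature flow, i.e. $F$ is smooth, each $F_t=F(\cdot,t)$ is an immersion, and $\frac{dF}{dt}=H$. Conventions. In local coordinates $x^1,\dots,x^m$ of $\Sigma$ put $\partial_i=\partial F_t/\partial x^i$, $g_{ij}=\langle\partial_i,\partial_j\rangle$, with inverse $g^{ij}$. The second fundamental form is $A(\partial_i,\partial_j)=(\overline\nabla_{\partial_i}\partial_j)^N$, where $N$ and $T$ denote the normal and the tangential part, and $H=g^{kl}A(\partial_k,\partial_l)$. The induced connection on $\Sigma$ is $(\overline\nabla_{\partial_i}\partial_j)^T$, and the covariant derivative of $A$ is $$(\nabla_{\partial_l}A)(\partial_i,\partial_j)=(\overline\nabla_{\partial_l}(A(\partial_i,\partial_j)))^N-A((\overline\nabla_{\partial_l}\partial_i)^T,\partial_j)-A(\partial_i,(\overline\nabla_{\partial_l}\partial_j)^T).$$ Let $\nabla^2A$ be the second covariant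 derivative (formed with the induced connection and the normal connection) and $\Delta A=g^{kl}\nabla_{\partial_l}\nabla_{\partial_k}A$. On functions $\Delta$ is the Laplace–Beltrami operator of $g_{ij}$. The norms are $|A|^2=g^{ik}g^{jl}\langle A(\partial_i,\partial_j),A(\partial_k,\partial_l)\rangle$ and similarly $|\nabla A|^2$. The curvature of $M$ is $K(X,Y)Z=-\overline\nabla_X\overline\nabla_YZ+\overline\nabla_Y\overline\nabla_XZ+\overline\nabla_{[X,Y]}Z$, $K_{ABCD}=\langle K(e_A,e_B)e_C,e_D\rangle$, so that $K_{ABAB}>0$ in positive sectional curvature. Fix $(p,t)\in\Sigma\times[0,T)$ and local coordinates of $\Sigma$ near $p$ with $g_{ij}(p,t)=\delta_{ij}$. The indices $i,j,k,l,q$ stand for the tangent vectors $\partial_i$ and $\alpha,\beta,\gamma$ for an orthonormal basis $e_\alpha$ of the normal space; repeated indices are summed. Time derivatives are taken at fixed $p$ (one-sided at $t=0$). (1) Let $e_\alpha(s)$, for $s\in[0,T)$ near $t$, be an orthonormal basis of the normal space of $F_s$ at $F(p,s)$, differentiable at $s=t$. Put $h_{\alpha ij}=\langle A(\partial_i,\partial_j),e_\alpha\rangle$,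 $h_\alpha=\sum_kh_{\alpha kk}$, $\Delta h_{\alpha ij}=\langle(\Delta A)(\partial_i,\partial_j),e_\alpha\rangle$, and let $\overline\nabla_He_\alpha$ be the covariant derivative of $e_\alpha$ along $s\mapsto F(p,s)$. Then for all $\alpha,i,j$, at $(p,t)$, $$\begin{aligned} \tfrac{d}{dt}h_{\alpha ij}={}&\Delta h_{\alpha ij}+(\overline\nabla_{\partial_k}K)_{\alpha ijk}+(\overline\nabla_{\partial_j}K)_{\alpha kik} -2K_{lijk}h_{\alpha lk}+2K_{\alpha\beta jk}h_{\beta ik}+2K_{\alpha\beta ik}h_{\beta jk}\\ &-K_{lkik}h_{\alpha lj}-K_{lkjk}h_{\alpha li}+K_{\alpha k\beta k}h_{\beta ij} -h_{\alpha iq}(h_{\gamma qj}h_\gamma-h_{\gamma qk}h_{\gamma jk})\\ &-h_{\alpha qk}(h_{\gamma qj}h_{\gamma ik}-h_{\gamma qk}h_{\gamma ij}) -h_{\beta ik}(h_{\beta lj}h_{\alpha lk}-h_{\beta lk}h_{\alpha lj}) -h_{\alpha jk}h_{\beta ik}h_\beta+h_{\beta ij}\langle e_\beta,\overline\nabla_He_\alpha\rangle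 . \end{aligned}$$ (2) For every orthonormal basis $e_\alpha$ of the normal space of $F_t$ at $F(p,t)$, at $(p,t)$, $$\begin{aligned} \tfrac{d}{dt}|A|^2={}&\Delta|A|^2-2|\nabla A|^2+2[(\overline\nabla_{\partial_k}K)_{\alpha ijk}+(\overline\nabla_{\partial_j}K)_{\alpha kik}]h_{\alpha ij} -4K_{lijk}h_{\alpha lk}h_{\alpha ij}+8K_{\alpha\beta jk}h_{\beta ik}h_{\alpha ij}\\ &-4K_{lkik}h_{\alpha lj}h_{\alpha ij}+2K_{\alpha k\beta k}h_{\beta ij}h_{\alpha ij} +2\sum_{\alpha,\gamma,i,q}\Big(\sum_k(h_{\alpha ik}h_{\gamma qk}-h_{\alpha qk}h_{\gamma ik})\Big)^2 +2\sum_{i,j,q,k}\Big(\sum_\alpha h_{\alpha ij}h_{\alpha qk}\Big)^2 . \end{aligned}$$ -/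

import Mathlib

open Set Filter Topology Manifold
open scoped ContDiff

noncomputable section

namespace MCF

/-- Coordinate space `ℝᵏ`. -/
abbrev Coord (k : ℕ) : Type := EuclideanSpace ℝ (Fin k)

/-- Partial derivative `∂ᵢ u` at `x`. -/
def partialDeriv {k : ℕ} (i : Fin k) (u : Coord k → ℝ) (x : Coord k) : ℝ :=
  fderiv ℝ u x (EuclideanSpace.single i 1)

/-! ### Riemannian geometry of the ambient space in local coordinates

`G y` is the matrix `G_{AB}(y)` of the ambient metric in local coordinates `y¹, …, yⁿ`; a tangent
vector at `y` is given by its components `v : Fin n → ℝ`. -/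

section Ambient

variable {n : ℕ} (G : Coord n → Matrix (Fin n) (Fin n) ℝ)

/-- The scalar product `⟨u, v⟩ = G_{AB} u^A v^B` of tangent vectors at `y`. -/
def inner (y : Coord n) (u v : Fin n → ℝ) : ℝ :=
  ∑ A, ∑ B, G y A B * u A * v B

/-- Christoffel symbols `Γ^A_{BC}` of the Levi-Civita connection. -/
def christoffel (A B C : Fin n) (y : Coord n) : ℝ :=
  (1 / 2) * ∑ D, (G y)⁻¹ A D *
    (partialDeriv B (fun z => G z D C) y + partialDeriv C (fun z => G z D B) y
      - partialDeriv D (fun z => G z B C) y)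

/-- The component along `∂_E` of
`K(∂_A, ∂_B) ∂_C = - ∇_A ∇_B ∂_C + ∇_B ∇_A ∂_C`. -/
def curvatureUp (E A B C : Fin n) (y : Coord n) : ℝ :=
  partialDeriv B (christoffel G E A C) y - partialDeriv A (christoffel G E B C) y
    + ∑ D, (christoffel G E B D y * christoffel G D A C y
        - christoffel G E A D y * christoffel G D B C y)

/-- `K_{ABCD} = ⟨K(∂_A, ∂_B) ∂_C, ∂_D⟩`; with this sign `K_{ABAB} > 0` in positive sectional
curvature. -/
def curvature (A B C D : Fin n) (y : Coord n) : ℝ :=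
  ∑ E, curvatureUp G E A B C y * G y E D

/-- `(∇_E K)_{ABCD}`, components of the covariant derivative of the curvature tensor. -/
def covDerivCurvature (E A B C D : Fin n) (y : Coord n) : ℝ :=
  partialDeriv E (curvature G A B C D) y
    - ∑ P, (christoffel G P E A y * curvature G P B C D y
        + christoffel G P E B y * curvature G A P C D y
        + christoffel G P E C y * curvature G A B P D y
        + christoffel G P E D y * curvature G A B C P y)

/-- `K(u, v, w, z) = ⟨K(u, v) w, z⟩` for tangent vectors at `y`. -/
def curvatureOn (y : Coord n) (u v w z : Fin n → ℝ) : ℝ :=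
  ∑ A, ∑ B, ∑ C, ∑ D, curvature G A B C D y * u A * v B * w C * z D

/-- `(∇_X K)(u, v, w, z)` for tangent vectors at `y`. -/
def covDerivCurvatureOn (y : Coord n) (X u v w z : Fin n → ℝ) : ℝ :=
  ∑ E, ∑ A, ∑ B, ∑ C, ∑ D,
    covDerivCurvature G E A B C D y * X E * u A * v B * w C * z D

end Ambient

/-! ### Geometry of an immersion in local coordinates

`f` is an immersion written in local coordinates `x¹, …, xᵐ` of the source and `y¹, …, yⁿ` of the
target.  A vector field along `f` is given by its components `V : Coord m → Fin n → ℝ`. -/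

section Immersion

variable {m n : ℕ} (G : Coord n → Matrix (Fin n) (Fin n) ℝ) (f : Coord m → Coord n)

/-- The tangent vector `∂ᵢ = ∂f/∂xⁱ`. -/
def tangent (i : Fin m) (x : Coord m) : Fin n → ℝ :=
  fun A => partialDeriv i (fun z => f z A) x

/-- The induced metric `g_{ij} = ⟨∂ᵢ, ∂ⱼ⟩`. -/
def inducedMetric (x : Coord m) : Matrix (Fin m) (Fin m) ℝ :=
  Matrix.of fun i j => inner G (f x) (tangent f i x) (tangent f j x)

/-- The inverse `g^{ij}` of the induced metric. -/
def inducedInv (i j : Fin m) (x : Coord m) : ℝ :=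
  (inducedMetric G f x)⁻¹ i j

/-- The ambient covariant derivative in direction `∂ᵢ` of a vector field along `f`. -/
def covDeriv (i : Fin m) (V : Coord m → Fin n → ℝ) (x : Coord m) : Fin n → ℝ :=
  fun A => partialDeriv i (fun z => V z A) x
    + ∑ B, ∑ C, christoffel G A B C (f x) * tangent f i x B * V x C

/-- The coefficient of `∂ₖ` in the tangential part of `v`. -/
def tangentialCoeff (x : Coord m) (v : Fin n → ℝ) (k : Fin m) : ℝ :=
  ∑ l, inducedInv G f k l x * inner G (f x) v (tangent f l x)

/-- The normal part `v^N` of `v`. -/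
def normalPart (x : Coord m) (v : Fin n → ℝ) : Fin n → ℝ :=
  fun A => v A - ∑ k, tangentialCoeff G f x v k * tangent f k x A

/-- The coefficient of `∂ₖ` in the induced connection `∇_{∂ᵢ} ∂ⱼ`, the tangential part of the
ambient derivative. -/
def inducedConn (k i j : Fin m) (x : Coord m) : ℝ :=
  tangentialCoeff G f x (covDeriv G f i (tangent f j) x) k

/-- The second fundamental form `A(∂ᵢ, ∂ⱼ)`, the normal part of the ambient derivative of `∂ⱼ` in
direction `∂ᵢ`. -/
def secondFF (i j : Fin m) (x : Coord m) : Fin n → ℝ :=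
  normalPart G f x (covDeriv G f i (tangent f j) x)

/-- The mean curvature vector `H = g^{kl} A(∂ₖ, ∂ₗ)`. -/
def meanCurvature (x : Coord m) : Fin n → ℝ :=
  fun A => ∑ k, ∑ l, inducedInv G f k l x * secondFF G f k l x A

/-- The covariant derivative `(∇_{∂ₖ} A)(∂ᵢ, ∂ⱼ)`, a normal vector. -/
def covDerivSFF (k i j : Fin m) (x : Coord m) : Fin n → ℝ :=
  fun B => normalPart G f x (covDeriv G f k (secondFF G f i j) x) B
    - ∑ q, inducedConn G f q k i x * secondFF G f q j x B
    - ∑ q, inducedConn G f q k j x * secondFF G f i q x B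

/-- The second covariant derivative `(∇_{∂ₗ} ∇_{∂ₖ} A)(∂ᵢ, ∂ⱼ)` (a tensor in all four arguments),
a normal vector. -/
def covDeriv2SFF (l k i j : Fin m) (x : Coord m) : Fin n → ℝ :=
  fun B => normalPart G f x (covDeriv G f l (covDerivSFF G f k i j) x) B
    - ∑ q, inducedConn G f q l k x * covDerivSFF G f q i j x B
    - ∑ q, inducedConn G f q l i x * covDerivSFF G f k q j x B
    - ∑ q, inducedConn G f q l j x * covDerivSFF G f k i q x B

/-- The Laplacian `(ΔA)(∂ᵢ, ∂ⱼ) = g^{kl} (∇_{∂ₗ} ∇_{∂ₖ} A)(∂ᵢ, ∂ⱼ)`. -/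
def laplacianSFF (i j : Fin m) (x : Coord m) : Fin n → ℝ :=
  fun B => ∑ k, ∑ l, inducedInv G f k l x * covDeriv2SFF G f l k i j x B

/-- `|A|² = g^{ik} g^{jl} ⟨A(∂ᵢ, ∂ⱼ), A(∂ₖ, ∂ₗ)⟩`. -/
def normSqSFF (x : Coord m) : ℝ :=
  ∑ i, ∑ j, ∑ k, ∑ l, inducedInv G f i k x * inducedInv G f j l x *
    inner G (f x) (secondFF G f i j x) (secondFF G f k l x)

/-- `|∇A|²`. -/
def normSqCovDerivSFF (x : Coord m) : ℝ :=
  ∑ a, ∑ i, ∑ j, ∑ b, ∑ k, ∑ l,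
    inducedInv G f a b x * inducedInv G f i k x * inducedInv G f j l x *
      inner G (f x) (covDerivSFF G f a i j x) (covDerivSFF G f b k l x)

/-- The Laplace-Beltrami operator of the induced metric on functions,
`Δu = g^{kl} (∂ₖ ∂ₗ u - Γ^q_{kl} ∂_q u)`. -/
def laplaceBeltrami (u : Coord m → ℝ) (x : Coord m) : ℝ :=
  ∑ k, ∑ l, inducedInv G f k l x *
    (partialDeriv k (partialDeriv l u) x
      - ∑ q, inducedConn G f q k l x * partialDeriv q u x)

/-- `ν` is an orthonormal family of vectors normal to the immersed submanifold at `f x` (hence an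
orthonormal basis of the normal space when `r` is the codimension `n - m`). -/
structure IsNormalFrame {r : ℕ} (x : Coord m) (ν : Fin r → Fin n → ℝ) : Prop where
  orthonormal : ∀ α β, inner G (f x) (ν α) (ν β) = if α = β then 1 else 0
  normal : ∀ α i, inner G (f x) (ν α) (tangent f i x) = 0

/-- Coefficient `h_{αij} = ⟨A(∂ᵢ, ∂ⱼ), e_α⟩`, with `e_α = ν α`. -/
def hCoeff {r : ℕ} (x : Coord m) (ν : Fin r → Fin n → ℝ) (α : Fin r) (i j : Fin m) : ℝ :=
  inner G (f x) (secondFF G f i j x) (ν α)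

/-- Right-hand side of the evolution equation of `h_{αij}` at a point where the coordinate vectors
`∂ᵢ` are orthonormal; `ν` is the normal frame `e_α` and `dν α` is the ambient covariant derivative
`∇_H e_α` at that point. -/
def hEvolution {r : ℕ} (x : Coord m) (ν dν : Fin r → Fin n → ℝ) (α : Fin r) (i j : Fin m) : ℝ :=
  let K := curvatureOn G (f x)
  let DK := covDerivCurvatureOn G (f x)
  let E : Fin m → Fin n → ℝ := fun a => tangent f a x
  let h : Fin r → Fin m → Fin m → ℝ := hCoeff G f x ν
  let tr : Fin r → ℝ := fun β => ∑ k, h β k k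
  inner G (f x) (laplacianSFF G f i j x) (ν α)
    + ∑ k, DK (E k) (ν α) (E i) (E j) (E k)
    + ∑ k, DK (E j) (ν α) (E k) (E i) (E k)
    - 2 * ∑ l, ∑ k, K (E l) (E i) (E j) (E k) * h α l k
    + 2 * ∑ β, ∑ k, K (ν α) (ν β) (E j) (E k) * h β i k
    + 2 * ∑ β, ∑ k, K (ν α) (ν β) (E i) (E k) * h β j k
    - ∑ l, ∑ k, K (E l) (E k) (E i) (E k) * h α l j
    - ∑ l, ∑ k, K (E l) (E k) (E j) (E k) * h α l i
    + ∑ β, ∑ k, K (ν α) (E k) (ν β) (E k) * h β i j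
    - ∑ q, h α i q * ∑ γ, (h γ q j * tr γ - ∑ k, h γ q k * h γ j k)
    - ∑ q, ∑ k, h α q k * ∑ γ, (h γ q j * h γ i k - h γ q k * h γ i j)
    - ∑ β, ∑ k, h β i k * ∑ l, (h β l j * h α l k - h β l k * h α l j)
    - ∑ β, ∑ k, h α j k * h β i k * tr β
    + ∑ β, h β i j * inner G (f x) (ν β) (dν α)

/-- Right-hand side of the evolution equation of `|A|²` at a point where the coordinate vectors
`∂ᵢ` are orthonormal; `ν` is an orthonormal basis of the normal space there. -/
def normSqEvolution {r : ℕ} (x : Coord m) (ν : Fin r → Fin n → ℝ) : ℝ :=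
  let K := curvatureOn G (f x)
  let DK := covDerivCurvatureOn G (f x)
  let E : Fin m → Fin n → ℝ := fun a => tangent f a x
  let h : Fin r → Fin m → Fin m → ℝ := hCoeff G f x ν
  laplaceBeltrami G f (normSqSFF G f) x - 2 * normSqCovDerivSFF G f x
    + 2 * ∑ α, ∑ i, ∑ j, (∑ k, (DK (E k) (ν α) (E i) (E j) (E k)
        + DK (E j) (ν α) (E k) (E i) (E k))) * h α i j
    - 4 * ∑ α, ∑ i, ∑ j, ∑ l, ∑ k, K (E l) (E i) (E j) (E k) * h α l k * h α i j
    + 8 * ∑ α, ∑ i, ∑ j, ∑ β, ∑ k, K (ν α) (ν β) (E j) (E k) * h β i k * h α i j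
    - 4 * ∑ α, ∑ i, ∑ j, ∑ l, ∑ k, K (E l) (E k) (E i) (E k) * h α l j * h α i j
    + 2 * ∑ α, ∑ i, ∑ j, ∑ β, ∑ k, K (ν α) (E k) (ν β) (E k) * h β i j * h α i j
    + 2 * ∑ α, ∑ γ, ∑ i, ∑ q, (∑ k, (h α i k * h γ q k - h α q k * h γ i k)) ^ 2
    + 2 * ∑ i, ∑ j, ∑ q, ∑ k, (∑ α, h α i j * h α q k) ^ 2

end Immersion

/-! ### Mean curvature flow in a Riemannian manifold -/

section Flow

variable {m n : ℕ}
  {S : Type*} [TopologicalSpace S] [ChartedSpace (Coord m) S]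
  {M : Type*} [TopologicalSpace M] [ChartedSpace (Coord n) M] [IsManifold (𝓡 n) ∞ M]

/-- The matrix `G_{AB}` of a Riemannian metric in the chart `ψ`. -/
def metricInChart
    (g : Bundle.ContMDiffRiemannianMetric (𝓡 n) ∞ (Coord n) (fun y : M => TangentSpace (𝓡 n) y))
    (ψ : OpenPartialHomeomorph M (Coord n)) (y : Coord n) : Matrix (Fin n) (Fin n) ℝ :=
  Matrix.of fun A B => g.inner (ψ.symm y)
    (mfderiv (𝓡 n) (𝓡 n) ψ.symm y (EuclideanSpace.single A 1))
    (mfderiv (𝓡 n) (𝓡 n) ψ.symm y (EuclideanSpace.single B 1))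

/-- The map `F_s` written in the charts `φ` of the source and `ψ` of the target. -/
def inCharts (φ : OpenPartialHomeomorph S (Coord m)) (ψ : OpenPartialHomeomorph M (Coord n))
    (F : S → ℝ → M) (s : ℝ) (x : Coord m) : Coord n :=
  ψ (F (φ.symm x) s)

/-- `F : S × [0, T) → M` is a mean curvature flow: a smooth one-parameter family of immersions with
`dF/dt = H`, the last equation being read in local coordinates. -/
structure IsMeanCurvatureFlow
    (g : Bundle.ContMDiffRiemannianMetric (𝓡 n) ∞ (Coord n) (fun y : M => TangentSpace (𝓡 n) y))
    (T : ℝ) (F : S → ℝ → M) : Prop where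
  smooth : ContMDiffOn ((𝓡 m).prod 𝓘(ℝ, ℝ)) (𝓡 n) ∞ (fun q : S × ℝ => F q.1 q.2)
    (univ ×ˢ Ico 0 T)
  immersion : ∀ s ∈ Ico 0 T, ∀ p : S,
    Function.Injective (mfderiv (𝓡 m) (𝓡 n) (fun q : S => F q s) p)
  flow : ∀ φ ∈ IsManifold.maximalAtlas (𝓡 m) ∞ S, ∀ ψ ∈ IsManifold.maximalAtlas (𝓡 n) ∞ M,
    ∀ p ∈ φ.source, ∀ s ∈ Ico 0 T, F p s ∈ ψ.source → ∀ A : Fin n,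
      HasDerivWithinAt (fun s' => ψ (F p s') A)
        (meanCurvature (metricInChart g ψ) (inCharts φ ψ F s) (φ p) A) (Ico 0 T) s

/-- The ambient covariant derivative at time `t` of a vector field `s ↦ V s` along a curve passing
through `y` at time `t` with velocity `H` (the curve being defined for times in `I`). -/
def covDerivTime (G : Coord n → Matrix (Fin n) (Fin n) ℝ) (I : Set ℝ) (y : Coord n)
    (H : Fin n → ℝ) (V : ℝ → Fin n → ℝ) (t : ℝ) : Fin n → ℝ :=
  fun A => derivWithin (fun s => V s A) I t + ∑ B, ∑ C, christoffel G A B C y * H B * V t C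

end Flow

end MCF

end

/-!
In coordinates of `Σ` and `M`, commuting `d/dt` with the derivatives along `Σ` turns `dF/dt = H`
into `∇_t ∂ᵢ = ∇ᵢ H` and `∇_t ∇ᵢ ∂ⱼ = ∇ᵢ ∇ⱼ H - K(H, ∂ᵢ) ∂ⱼ`, so that the normal part of `dA/dt` is
the normal Hessian of `H` up to a curvature term. Simons' identity trades this Hessian for `Δ A`:
`H` is the trace of `A`, and in `∇ⱼ ∇ᵢ A(∂ₖ, ∂ₖ)` the index `k` is moved outwards by the Codazzi
equation, used twice, and by the Ricci identity for the interchange of two covariant derivatives;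
the Gauss equation turns the curvature of `Σ` which appears there into the cubic terms.
For `|A|²`, the cubic terms containing the trace of `A` cancel against
`d/dt g^{ij} = 2 ⟨H, A_{ij}⟩`, and the remaining ones add up to the two sums of squares.
-/

noncomputable section

namespace MCF
/-! ### Partial derivatives -/

section PartialDeriv

variable {k : ℕ} {U : Set (Coord k)} {u v : Coord k → ℝ} {x : Coord k} {i j : Fin k}

lemma partialDeriv_add (hu : DifferentiableAt ℝ u x) (hv : DifferentiableAt ℝ v x) :
    partialDeriv i (fun z => u z + v z) x = partialDeriv i u x + partialDeriv i v x := by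
  simp [partialDeriv, fderiv_fun_add hu hv]

lemma partialDeriv_sub (hu : DifferentiableAt ℝ u x) (hv : DifferentiableAt ℝ v x) :
    partialDeriv i (fun z => u z - v z) x = partialDeriv i u x - partialDeriv i v x := by
  simp [partialDeriv, fderiv_fun_sub hu hv]

lemma partialDeriv_mul (hu : DifferentiableAt ℝ u x) (hv : DifferentiableAt ℝ v x) :
    partialDeriv i (fun z => u z * v z) x
      = partialDeriv i u x * v x + u x * partialDeriv i v x := by
  simp [partialDeriv, fderiv_fun_mul hu hv]; ring

lemma partialDeriv_sum {ι : Type*} {s : Finset ι} {w : ι → Coord k → ℝ}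
    (hw : ∀ a ∈ s, DifferentiableAt ℝ (w a) x) :
    partialDeriv i (fun z => ∑ a ∈ s, w a z) x = ∑ a ∈ s, partialDeriv i (w a) x := by
  simp [partialDeriv, fderiv_fun_sum hw]

lemma partialDeriv_const (c : ℝ) : partialDeriv i (fun _ => c) x = 0 := by
  simp [partialDeriv]

lemma partialDeriv_congr (hU : IsOpen U) (hx : x ∈ U) (h : EqOn u v U) :
    partialDeriv i u x = partialDeriv i v x := by
  simp only [partialDeriv, (h.eventuallyEq_of_mem (hU.mem_nhds hx)).fderiv_eq]

lemma differentiableAt_of_contDiffOn (hU : IsOpen U) (hu : ContDiffOn ℝ ∞ u U) (hx : x ∈ U) :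
    DifferentiableAt ℝ u x :=
  (hu.contDiffAt (hU.mem_nhds hx)).differentiableAt (by simp)

lemma contDiffOn_partialDeriv (hU : IsOpen U) (hu : ContDiffOn ℝ ∞ u U) (i : Fin k) :
    ContDiffOn ℝ ∞ (partialDeriv i u) U :=
  (hu.fderiv_of_isOpen hU (m := ∞) (by simp)).clm_apply contDiffOn_const

lemma partialDeriv_comm (hu : ContDiffAt ℝ 2 u x) :
    partialDeriv i (partialDeriv j u) x = partialDeriv j (partialDeriv i u) x := by
  have hd : DifferentiableAt ℝ (fderiv ℝ u) x :=
    (hu.fderiv_right (m := 1) (by norm_num)).differentiableAt (by simp)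
  have eq_fderiv_fderiv (a b : Fin k) : partialDeriv a (partialDeriv b u) x
      = fderiv ℝ (fderiv ℝ u) x (EuclideanSpace.single a 1) (EuclideanSpace.single b 1) := by
    unfold partialDeriv
    simp [fderiv_clm_apply hd (differentiableAt_const _)]
  rw [eq_fderiv_fderiv, eq_fderiv_fderiv]
  exact hu.isSymmSndFDerivAt (by simp) _ _

lemma partialDeriv_comm_of_contDiffOn (hU : IsOpen U) (hu : ContDiffOn ℝ ∞ u U) (hx : x ∈ U) :
    partialDeriv i (partialDeriv j u) x = partialDeriv j (partialDeriv i u) x :=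
  partialDeriv_comm ((hu.contDiffAt (hU.mem_nhds hx)).of_le
    (by simpa using (WithTop.coe_le_coe.2 le_top : ((2 : ℕ∞) : WithTop ℕ∞) ≤ ∞)))

lemma fderiv_eq_sum_partialDeriv (v : Coord k) :
    fderiv ℝ u x v = ∑ a, partialDeriv a u x * v a := by
  conv_lhs => rw [← (EuclideanSpace.basisFun (Fin k) ℝ).sum_repr v]
  simp [partialDeriv, mul_comm]

end PartialDeriv

/-! ### Smooth families of matrices -/

section MatrixInverse

variable {ι : Type*} [Fintype ι] [DecidableEq ι]

lemma contDiffOn_matrix_det {E : Type*} [NormedAddCommGroup E] [NormedSpace ℝ E] {U : Set E}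
    {k : WithTop ℕ∞} {M : E → Matrix ι ι ℝ} (hM : ∀ a b, ContDiffOn ℝ k (fun x => M x a b) U) :
    ContDiffOn ℝ k (fun x => (M x).det) U := by
  simp only [Matrix.det_apply]
  exact .sum fun σ _ => .const_smul _ (contDiffOn_prod fun a _ => hM _ _)

lemma contDiffOn_matrix_inv_apply {E : Type*} [NormedAddCommGroup E] [NormedSpace ℝ E]
    {U : Set E} {k : WithTop ℕ∞} {M : E → Matrix ι ι ℝ}
    (hM : ∀ a b, ContDiffOn ℝ k (fun x => M x a b) U) (hdet : ∀ x ∈ U, (M x).det ≠ 0) (i j : ι) :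
    ContDiffOn ℝ k (fun x => (M x)⁻¹ i j) U := by
  have hadj : ContDiffOn ℝ k (fun x => (M x).adjugate i j) U := by
    simp only [Matrix.adjugate_apply]
    refine contDiffOn_matrix_det fun a b => ?_
    simp only [Matrix.updateRow_apply]
    split_ifs
    · exact contDiffOn_const
    · exact hM a b
  simp only [Matrix.inv_def, Ring.inverse_eq_inv', Matrix.smul_apply, smul_eq_mul]
  exact ((contDiffOn_matrix_det hM).inv hdet).mul hadj

open scoped Matrix.Norms.Operator in
lemma hasDerivWithinAt_matrix_inv_apply {M : ℝ → Matrix ι ι ℝ} {M' : Matrix ι ι ℝ} {J : Set ℝ}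
    {t : ℝ} (hM : ∀ a b, HasDerivWithinAt (fun s => M s a b) (M' a b) J t)
    (hdet : (M t).det ≠ 0) (i j : ι) :
    HasDerivWithinAt (fun s => (M s)⁻¹ i j) (-((M t)⁻¹ * M' * (M t)⁻¹) i j) J t := by
  have hM' : HasDerivWithinAt M M' J t :=
    hasDerivWithinAt_pi.2 fun a => hasDerivWithinAt_pi.2 (hM a)
  obtain ⟨u, hu⟩ := (Matrix.isUnit_iff_isUnit_det _).2 hdet.isUnit
  have hinv : HasFDerivAt Ring.inverse _ (M t) := hu ▸ hasFDerivAt_ringInverse (𝕜 := ℝ) u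
  have hentry := hasDerivWithinAt_pi.1
    (hasDerivWithinAt_pi.1 (hinv.comp_hasDerivWithinAt t hM') i) j
  simp only [Function.comp_def, ← Matrix.nonsing_inv_eq_ringInverse] at hentry
  exact hentry.congr_deriv (by simp [Matrix.coe_units_inv, hu])

end MatrixInverse

/-! ### The scalar product -/

section Inner

variable {n : ℕ} (G : Coord n → Matrix (Fin n) (Fin n) ℝ) (y : Coord n)

/-- The scalar product at `y` as a bilinear map. -/
def innerₗ : (Fin n → ℝ) →ₗ[ℝ] (Fin n → ℝ) →ₗ[ℝ] ℝ := Matrix.toBilin' (G y)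

lemma inner_eq_innerₗ (u v : Fin n → ℝ) : inner G y u v = innerₗ G y u v := by
  simp only [innerₗ, Matrix.toBilin'_apply, inner]
  exact Finset.sum_congr rfl fun A _ => Finset.sum_congr rfl fun B _ => by ring

variable {G y}

lemma inner_add_left (u u' v : Fin n → ℝ) :
    inner G y (u + u') v = inner G y u v + inner G y u' v := by simp [inner_eq_innerₗ]

lemma inner_sub_left (u u' v : Fin n → ℝ) :
    inner G y (u - u') v = inner G y u v - inner G y u' v := by simp [inner_eq_innerₗ]

lemma inner_neg_left (u v : Fin n → ℝ) : inner G y (-u) v = - inner G y u v := by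
  simp [inner_eq_innerₗ]

lemma inner_smul_left (c : ℝ) (u v : Fin n → ℝ) : inner G y (c • u) v = c * inner G y u v := by
  simp [inner_eq_innerₗ]

lemma inner_sum_left {ι : Type*} (s : Finset ι) (u : ι → Fin n → ℝ) (v : Fin n → ℝ) :
    inner G y (∑ a ∈ s, u a) v = ∑ a ∈ s, inner G y (u a) v := by simp [inner_eq_innerₗ]

lemma inner_add_right (u v v' : Fin n → ℝ) :
    inner G y u (v + v') = inner G y u v + inner G y u v' := by simp [inner_eq_innerₗ]

lemma inner_sub_right (u v v' : Fin n → ℝ) :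
    inner G y u (v - v') = inner G y u v - inner G y u v' := by simp [inner_eq_innerₗ]

lemma inner_smul_right (c : ℝ) (u v : Fin n → ℝ) : inner G y u (c • v) = c * inner G y u v := by
  simp [inner_eq_innerₗ]

lemma inner_sum_right {ι : Type*} (s : Finset ι) (u : Fin n → ℝ) (v : ι → Fin n → ℝ) :
    inner G y u (∑ a ∈ s, v a) = ∑ a ∈ s, inner G y u (v a) := by simp [inner_eq_innerₗ]

end Inner

/-! ### Christoffel symbols and curvature of a smooth metric -/

/-- `G` is a pseudo-Riemannian metric on the open set `W`: smooth, symmetric and nondegenerate. -/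
structure IsMetricOn {n : ℕ} (G : Coord n → Matrix (Fin n) (Fin n) ℝ) (W : Set (Coord n)) :
    Prop where
  isOpen : IsOpen W
  smooth : ∀ A B, ContDiffOn ℝ ∞ (fun y => G y A B) W
  symm : ∀ y ∈ W, ∀ A B, G y A B = G y B A
  det_ne : ∀ y ∈ W, (G y).det ≠ 0

/-- The Christoffel symbols of the first kind `Γ_{A,BC} = G_{AE} Γ^E_{BC}`. -/
def christoffelLower {n : ℕ} (G : Coord n → Matrix (Fin n) (Fin n) ℝ) (A B C : Fin n)
    (y : Coord n) : ℝ :=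
  ∑ E, G y A E * christoffel G E B C y

section Ambient

variable {n : ℕ} {G : Coord n → Matrix (Fin n) (Fin n) ℝ} {W : Set (Coord n)} {y : Coord n}

lemma inner_comm (hG : IsMetricOn G W) (hy : y ∈ W) (u v : Fin n → ℝ) :
    inner G y u v = inner G y v u := by
  unfold inner
  rw [Finset.sum_comm]
  refine Finset.sum_congr rfl fun A _ => Finset.sum_congr rfl fun B _ => ?_
  rw [hG.symm y hy]; ring

lemma contDiffOn_christoffel (hG : IsMetricOn G W) (A B C : Fin n) :
    ContDiffOn ℝ ∞ (christoffel G A B C) W := by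
  have hinv := contDiffOn_matrix_inv_apply hG.smooth hG.det_ne
  have hpartial := fun A B => contDiffOn_partialDeriv hG.isOpen (hG.smooth A B)
  unfold christoffel
  exact contDiffOn_const.mul (ContDiffOn.sum fun D _ =>
    (hinv _ _).mul (((hpartial _ _ _).add (hpartial _ _ _)).sub (hpartial _ _ _)))

lemma christoffel_symm (hG : IsMetricOn G W) (hy : y ∈ W) (A B C : Fin n) :
    christoffel G A B C y = christoffel G A C B y := by
  unfold christoffel
  congr 1
  refine Finset.sum_congr rfl fun D _ => ?_
  rw [partialDeriv_congr (i := D) hG.isOpen hy fun z hz => hG.symm z hz B C]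
  ring

lemma partialDeriv_christoffel_symm (hG : IsMetricOn G W) (hy : y ∈ W) (D A B C : Fin n) :
    partialDeriv D (christoffel G A B C) y = partialDeriv D (christoffel G A C B) y :=
  partialDeriv_congr hG.isOpen hy fun _ hz => christoffel_symm hG hz A B C

lemma christoffelLower_eq (hG : IsMetricOn G W) (hy : y ∈ W) (A B C : Fin n) :
    christoffelLower G A B C y = (1 / 2) *
      (partialDeriv B (fun z => G z A C) y + partialDeriv C (fun z => G z A B) y
        - partialDeriv A (fun z => G z B C) y) := by
  let w : Fin n → ℝ := fun D => partialDeriv B (fun z => G z D C) y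
    + partialDeriv C (fun z => G z D B) y - partialDeriv D (fun z => G z B C) y
  have hcancel : (G y).mulVec ((G y)⁻¹.mulVec w) = w := by
    rw [Matrix.mulVec_mulVec, Matrix.mul_nonsing_inv _ (hG.det_ne y hy).isUnit, Matrix.one_mulVec]
  calc christoffelLower G A B C y = (1 / 2) * (G y).mulVec ((G y)⁻¹.mulVec w) A := by
        simp only [christoffelLower, christoffel, Matrix.mulVec, dotProduct, Finset.mul_sum, w]
        exact Finset.sum_congr rfl fun E _ => Finset.sum_congr rfl fun D _ => by ring
    _ = (1 / 2) * w A := by rw [hcancel]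

lemma partialDeriv_metric (hG : IsMetricOn G W) (hy : y ∈ W) (A B C : Fin n) :
    partialDeriv C (fun z => G z A B) y
      = christoffelLower G B C A y + christoffelLower G A C B y := by
  rw [christoffelLower_eq hG hy, christoffelLower_eq hG hy,
    partialDeriv_congr (i := C) hG.isOpen hy fun z hz => hG.symm z hz B A,
    partialDeriv_congr (i := A) hG.isOpen hy fun z hz => hG.symm z hz B C,
    partialDeriv_congr (i := B) hG.isOpen hy fun z hz => hG.symm z hz A C]
  ring

lemma contDiffOn_christoffelLower (hG : IsMetricOn G W) (A B C : Fin n) :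
    ContDiffOn ℝ ∞ (christoffelLower G A B C) W :=
  ContDiffOn.sum fun E _ => (hG.smooth A E).mul (contDiffOn_christoffel hG E B C)

lemma partialDeriv_christoffelLower (hG : IsMetricOn G W) (hy : y ∈ W) (A B C D : Fin n) :
    partialDeriv D (christoffelLower G A B C) y
      = ∑ E, christoffelLower G E D A y * christoffel G E B C y
        + ∑ E, christoffelLower G A D E y * christoffel G E B C y
        + ∑ E, G y A E * partialDeriv D (christoffel G E B C) y := by
  have hmetric := fun E => differentiableAt_of_contDiffOn hG.isOpen (hG.smooth A E) hy
  have hchristoffel := fun E =>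
    differentiableAt_of_contDiffOn hG.isOpen (contDiffOn_christoffel hG E B C) hy
  unfold christoffelLower
  rw [partialDeriv_sum fun E _ => (hmetric E).fun_mul (hchristoffel E)]
  simp only [fun E => partialDeriv_mul (i := D) (hmetric E) (hchristoffel E),
    partialDeriv_metric hG hy, add_mul, Finset.sum_add_distrib]
  rfl

lemma sum_christoffelLower_mul_christoffel (A B C D : Fin n) :
    ∑ E, christoffelLower G D B E y * christoffel G E A C y
      = ∑ E, G y D E * ∑ P, christoffel G E B P y * christoffel G P A C y := by
  simp only [christoffelLower, Finset.mul_sum, Finset.sum_mul]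
  rw [Finset.sum_comm]
  exact Finset.sum_congr rfl fun E _ => Finset.sum_congr rfl fun P _ => by ring

lemma sum_christoffelLower_mul_christoffel_comm (hG : IsMetricOn G W) (hy : y ∈ W)
    (A B C D : Fin n) :
    ∑ E, christoffelLower G E B D y * christoffel G E A C y
      = ∑ E, christoffelLower G E A C y * christoffel G E B D y := by
  simp only [christoffelLower, Finset.sum_mul]
  rw [Finset.sum_comm]
  refine Finset.sum_congr rfl fun E _ => Finset.sum_congr rfl fun P _ => ?_
  rw [hG.symm y hy P E]; ring

lemma contDiffOn_curvatureUp (hG : IsMetricOn G W) (E A B C : Fin n) :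
    ContDiffOn ℝ ∞ (curvatureUp G E A B C) W := by
  have hchristoffel := contDiffOn_christoffel hG
  have hpartial := fun A B C => contDiffOn_partialDeriv hG.isOpen (hchristoffel A B C)
  unfold curvatureUp
  exact ((hpartial _ _ _ _).sub (hpartial _ _ _ _)).add (ContDiffOn.sum fun D _ =>
    ((hchristoffel _ _ _).mul (hchristoffel _ _ _)).sub
      ((hchristoffel _ _ _).mul (hchristoffel _ _ _)))

lemma contDiffOn_curvature (hG : IsMetricOn G W) (A B C D : Fin n) :
    ContDiffOn ℝ ∞ (curvature G A B C D) W := by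
  unfold curvature
  exact ContDiffOn.sum fun E _ => (contDiffOn_curvatureUp hG _ _ _ _).mul (hG.smooth _ _)

lemma curvature_swap_left (A B C D : Fin n) :
    curvature G A B C D y = - curvature G B A C D y := by
  simp only [curvature, curvatureUp, ← Finset.sum_neg_distrib, ← neg_mul, Finset.sum_sub_distrib]
  exact Finset.sum_congr rfl fun E _ => by ring

lemma curvature_bianchi (hG : IsMetricOn G W) (hy : y ∈ W) (A B C D : Fin n) :
    curvature G A B C D y + curvature G B C A D y + curvature G C A B D y = 0 := by
  have hsymm := christoffel_symm hG hy
  have hpartial := partialDeriv_christoffel_symm hG hy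
  simp only [curvature, ← Finset.sum_add_distrib, ← add_mul]
  refine Finset.sum_eq_zero fun E _ => ?_
  simp only [curvatureUp, Finset.sum_sub_distrib]
  rw [hpartial B E A C, hpartial C E B A, hpartial A E C B]
  simp only [fun D => hsymm D C A, fun D => hsymm D B A, fun D => hsymm D C B]
  ring

lemma curvature_eq_christoffelLower (hG : IsMetricOn G W) (hy : y ∈ W) (A B C D : Fin n) :
    curvature G A B C D y
      = partialDeriv B (christoffelLower G D A C) y - partialDeriv A (christoffelLower G D B C) y
        - ∑ E, christoffelLower G E B D y * christoffel G E A C y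
        + ∑ E, christoffelLower G E A D y * christoffel G E B C y := by
  simp only [partialDeriv_christoffelLower hG hy, sum_christoffelLower_mul_christoffel]
  simp only [curvature, curvatureUp, fun E => hG.symm y hy E D, Finset.sum_sub_distrib, add_mul,
    sub_mul, Finset.sum_add_distrib]
  simp only [mul_comm _ (G y D _)]
  ring

lemma curvature_swap_right (hG : IsMetricOn G W) (hy : y ∈ W) (A B C D : Fin n) :
    curvature G A B C D y = - curvature G A B D C y := by
  have hdiff := fun A B C =>
    differentiableAt_of_contDiffOn hG.isOpen (contDiffOn_christoffelLower hG A B C) hy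
  have hsum (A B : Fin n) : partialDeriv B (christoffelLower G D A C) y
      + partialDeriv B (christoffelLower G C A D) y
      = partialDeriv B (partialDeriv A (fun z => G z C D)) y := by
    rw [← partialDeriv_add (hdiff _ _ _) (hdiff _ _ _)]
    exact partialDeriv_congr hG.isOpen hy fun z hz => (partialDeriv_metric hG hz C D A).symm
  have hcomm := partialDeriv_comm_of_contDiffOn (i := A) (j := B) hG.isOpen (hG.smooth C D) hy
  rw [curvature_eq_christoffelLower hG hy, curvature_eq_christoffelLower hG hy,
    sum_christoffelLower_mul_christoffel_comm hG hy A B C D,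
    sum_christoffelLower_mul_christoffel_comm hG hy A B D C]
  linarith [hsum A B, hsum B A]

lemma curvature_reverse (hG : IsMetricOn G W) (hy : y ∈ W) (A B C D : Fin n) :
    curvature G A B C D y = curvature G D C B A y := by
  have bianchi := curvature_bianchi hG hy
  have left := fun A B C D => curvature_swap_left (G := G) (y := y) A B C D
  have right := curvature_swap_right hG hy
  -- In the sum of these four Bianchi identities eight of the twelve terms cancel in pairs.
  linarith [bianchi B C A D, bianchi C A D B, bianchi A D B C, bianchi D B C A,
    right B C A D, right C A B D, right A D C B, right D B A C,
    left B A D C, right A B C D, left C D B A, right D C A B]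

lemma covDerivCurvature_reverse (hG : IsMetricOn G W) (hy : y ∈ W) (E A B C D : Fin n) :
    covDerivCurvature G E A B C D y = covDerivCurvature G E D C B A y := by
  have hreverse := curvature_reverse hG hy
  unfold covDerivCurvature
  rw [partialDeriv_congr hG.isOpen hy fun z hz => curvature_reverse hG hz A B C D]
  congr 1
  refine Finset.sum_congr rfl fun P _ => ?_
  rw [hreverse P B C D, hreverse A P C D, hreverse A B P D, hreverse A B C P]
  ring

end Ambient
/-! ### Contractions of the Christoffel symbols and of the curvature tensor -/

section Contractions

variable {n : ℕ} (G : Coord n → Matrix (Fin n) (Fin n) ℝ) (y : Coord n)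

/-- The vector `Γ^A_{BC} u^B v^C`, as a bilinear map. -/
def christoffelOn : (Fin n → ℝ) →ₗ[ℝ] (Fin n → ℝ) →ₗ[ℝ] (Fin n → ℝ) :=
  ∑ B, (LinearMap.proj B).smulRight
    (∑ C, (LinearMap.proj C).smulRight fun A => christoffel G A B C y)

/-- The vector `∂_D Γ^A_{BC} a^D u^B v^C`. -/
def christoffelDerivOn (a u v : Fin n → ℝ) : Fin n → ℝ :=
  fun A => ∑ B, ∑ C, (∑ D, partialDeriv D (christoffel G A B C) y * a D) * u B * v C

/-- The vector `K(u, v) w`, as a trilinear map. -/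
def curvatureVec :
    (Fin n → ℝ) →ₗ[ℝ] (Fin n → ℝ) →ₗ[ℝ] (Fin n → ℝ) →ₗ[ℝ] (Fin n → ℝ) :=
  ∑ A, (LinearMap.proj A).smulRight (∑ B, (LinearMap.proj B).smulRight
    (∑ C, (LinearMap.proj C).smulRight fun E => curvatureUp G E A B C y))

/-- The directional derivative `∂_P K_{ABCD} a^P` of the components of the curvature, contracted
with four vectors. -/
def curvatureDerivOn (a u v w z : Fin n → ℝ) : ℝ :=
  ∑ A, ∑ B, ∑ C, ∑ D, (∑ P, partialDeriv P (curvature G A B C D) y * a P)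
    * u A * v B * w C * z D

lemma christoffelOn_apply (u v : Fin n → ℝ) (A : Fin n) :
    christoffelOn G y u v A = ∑ B, ∑ C, christoffel G A B C y * u B * v C := by
  simp only [christoffelOn, LinearMap.sum_apply, LinearMap.smulRight_apply, LinearMap.proj_apply,
    LinearMap.smul_apply, Finset.sum_apply, Pi.smul_apply, smul_eq_mul, Finset.mul_sum]
  exact Finset.sum_congr rfl fun B _ => Finset.sum_congr rfl fun C _ => by ring

lemma curvatureVec_apply (u v w : Fin n → ℝ) (E : Fin n) :
    curvatureVec G y u v w E
      = ∑ A, ∑ B, ∑ C, curvatureUp G E A B C y * u A * v B * w C := by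
  simp only [curvatureVec, LinearMap.sum_apply, LinearMap.smulRight_apply, LinearMap.proj_apply,
    LinearMap.smul_apply, Finset.sum_apply, Pi.smul_apply, smul_eq_mul, Finset.mul_sum]
  exact Finset.sum_congr rfl fun A _ => Finset.sum_congr rfl fun B _ =>
    Finset.sum_congr rfl fun C _ => by ring

lemma inner_curvatureVec (u v w z : Fin n → ℝ) :
    inner G y (curvatureVec G y u v w) z = curvatureOn G y u v w z := by
  simp only [inner, curvatureVec_apply, curvatureOn, curvature, Finset.mul_sum, Finset.sum_mul]
  simp only [← Fintype.sum_prod_type']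
  exact Finset.sum_nbij' (fun (E, D, A, B, C) => (A, B, C, D, E))
    (fun (A, B, C, D, E) => (E, D, A, B, C)) (by simp) (by simp) (by simp) (by simp)
    (fun _ _ => by ring)

lemma curvatureOn_eq_innerₗ (u v w z : Fin n → ℝ) :
    curvatureOn G y u v w z = innerₗ G y (curvatureVec G y u v w) z := by
  rw [← inner_curvatureVec, inner_eq_innerₗ]

section Components

variable {G y}

lemma christoffelDerivOn_apply (a u v : Fin n → ℝ) (E : Fin n) :
    christoffelDerivOn G y a u v E
      = ∑ A, ∑ B, ∑ C, partialDeriv A (christoffel G E B C) y * a A * u B * v C := by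
  simp only [christoffelDerivOn, Finset.sum_mul]
  simp only [← Fintype.sum_prod_type']
  exact Finset.sum_nbij' (fun (B, C, A) => (A, B, C)) (fun (A, B, C) => (B, C, A))
    (by simp) (by simp) (by simp) (by simp) (fun _ _ => by ring)

lemma christoffelOn_christoffelOn_apply (u v w : Fin n → ℝ) (E : Fin n) :
    christoffelOn G y u (christoffelOn G y v w) E = ∑ A, ∑ B, ∑ C,
      (∑ D, christoffel G E A D y * christoffel G D B C y) * u A * v B * w C := by
  simp only [christoffelOn_apply, Finset.mul_sum, Finset.sum_mul]
  simp only [← Fintype.sum_prod_type']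
  exact Finset.sum_nbij' (fun (A, D, B, C) => (A, B, C, D)) (fun (A, B, C, D) => (A, D, B, C))
    (by simp) (by simp) (by simp) (by simp) (fun _ _ => by ring)

lemma sum_trilinear_swap (F : Fin n → Fin n → Fin n → ℝ) (u v w : Fin n → ℝ) :
    ∑ A, ∑ B, ∑ C, F A B C * v A * u B * w C = ∑ A, ∑ B, ∑ C, F B A C * u A * v B * w C := by
  rw [Finset.sum_comm]
  exact Finset.sum_congr rfl fun A _ => Finset.sum_congr rfl fun B _ =>
    Finset.sum_congr rfl fun C _ => by ring

/-- In the sign convention used for `K`, this is `-(dω + ω ∧ ω)` for the connection matrix `ω`. -/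
lemma curvatureVec_eq (u v w : Fin n → ℝ) :
    curvatureVec G y u v w = christoffelDerivOn G y v u w - christoffelDerivOn G y u v w
      + christoffelOn G y v (christoffelOn G y u w)
      - christoffelOn G y u (christoffelOn G y v w) := by
  funext E
  simp only [Pi.add_apply, Pi.sub_apply, christoffelDerivOn_apply,
    christoffelOn_christoffelOn_apply]
  rw [sum_trilinear_swap fun A B C => partialDeriv A (christoffel G E B C) y,
    sum_trilinear_swap fun A B C => ∑ D, christoffel G E A D y * christoffel G D B C y]
  simp only [curvatureVec_apply, curvatureUp, Finset.sum_sub_distrib, add_mul, sub_mul,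
    Finset.sum_add_distrib]
  ring

lemma curvatureDerivOn_eq_sum (a u v w z : Fin n → ℝ) :
    curvatureDerivOn G y a u v w z = ∑ E, ∑ A, ∑ B, ∑ C, ∑ D,
      partialDeriv E (curvature G A B C D) y * a E * u A * v B * w C * z D := by
  simp only [curvatureDerivOn, Finset.sum_mul]
  simp only [← Fintype.sum_prod_type']
  exact Finset.sum_nbij' (fun (A, B, C, D, P) => (P, A, B, C, D))
    (fun (P, A, B, C, D) => (A, B, C, D, P)) (by simp) (by simp) (by simp) (by simp)
    (fun _ _ => by ring)

lemma curvatureOn_christoffelOn₁ (a u v w z : Fin n → ℝ) :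
    curvatureOn G y (christoffelOn G y a u) v w z = ∑ E, ∑ A, ∑ B, ∑ C, ∑ D,
      (∑ P, christoffel G P E A y * curvature G P B C D y)
        * a E * u A * v B * w C * z D := by
  simp only [curvatureOn, christoffelOn_apply, Finset.mul_sum, Finset.sum_mul]
  simp only [← Fintype.sum_prod_type']
  exact Finset.sum_nbij' (fun (P, B, C, D, E, A) => (E, A, B, C, D, P))
    (fun (E, A, B, C, D, P) => (P, B, C, D, E, A)) (by simp) (by simp) (by simp) (by simp)
    (fun _ _ => by ring)

lemma curvatureOn_christoffelOn₂ (a u v w z : Fin n → ℝ) :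
    curvatureOn G y u (christoffelOn G y a v) w z = ∑ E, ∑ A, ∑ B, ∑ C, ∑ D,
      (∑ P, christoffel G P E B y * curvature G A P C D y)
        * a E * u A * v B * w C * z D := by
  simp only [curvatureOn, christoffelOn_apply, Finset.mul_sum, Finset.sum_mul]
  simp only [← Fintype.sum_prod_type']
  exact Finset.sum_nbij' (fun (A, P, C, D, E, B) => (E, A, B, C, D, P))
    (fun (E, A, B, C, D, P) => (A, P, C, D, E, B)) (by simp) (by simp) (by simp) (by simp)
    (fun _ _ => by ring)

lemma curvatureOn_christoffelOn₃ (a u v w z : Fin n → ℝ) :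
    curvatureOn G y u v (christoffelOn G y a w) z = ∑ E, ∑ A, ∑ B, ∑ C, ∑ D,
      (∑ P, christoffel G P E C y * curvature G A B P D y)
        * a E * u A * v B * w C * z D := by
  simp only [curvatureOn, christoffelOn_apply, Finset.mul_sum, Finset.sum_mul]
  simp only [← Fintype.sum_prod_type']
  exact Finset.sum_nbij' (fun (A, B, P, D, E, C) => (E, A, B, C, D, P))
    (fun (E, A, B, C, D, P) => (A, B, P, D, E, C)) (by simp) (by simp) (by simp) (by simp)
    (fun _ _ => by ring)

lemma curvatureOn_christoffelOn₄ (a u v w z : Fin n → ℝ) :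
    curvatureOn G y u v w (christoffelOn G y a z) = ∑ E, ∑ A, ∑ B, ∑ C, ∑ D,
      (∑ P, christoffel G P E D y * curvature G A B C P y)
        * a E * u A * v B * w C * z D := by
  simp only [curvatureOn, christoffelOn_apply, Finset.mul_sum, Finset.sum_mul]
  simp only [← Fintype.sum_prod_type']
  exact Finset.sum_nbij' (fun (A, B, C, P, E, D) => (E, A, B, C, D, P))
    (fun (E, A, B, C, D, P) => (A, B, C, P, E, D)) (by simp) (by simp) (by simp) (by simp)
    (fun _ _ => by ring)

lemma covDerivCurvatureOn_eq (a u v w z : Fin n → ℝ) :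
    covDerivCurvatureOn G y a u v w z = curvatureDerivOn G y a u v w z
      - curvatureOn G y (christoffelOn G y a u) v w z
      - curvatureOn G y u (christoffelOn G y a v) w z
      - curvatureOn G y u v (christoffelOn G y a w) z
      - curvatureOn G y u v w (christoffelOn G y a z) := by
  rw [curvatureDerivOn_eq_sum, curvatureOn_christoffelOn₁, curvatureOn_christoffelOn₂,
    curvatureOn_christoffelOn₃, curvatureOn_christoffelOn₄]
  simp only [covDerivCurvatureOn, covDerivCurvature, Finset.sum_add_distrib, sub_mul, add_mul,
    Finset.sum_sub_distrib]
  ring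

end Components

section Symmetries

variable {G y} {W : Set (Coord n)}

lemma christoffelOn_comm (hG : IsMetricOn G W) (hy : y ∈ W) (u v : Fin n → ℝ) :
    christoffelOn G y u v = christoffelOn G y v u := by
  funext A
  rw [christoffelOn_apply, christoffelOn_apply, Finset.sum_comm]
  refine Finset.sum_congr rfl fun B _ => Finset.sum_congr rfl fun C _ => ?_
  rw [christoffel_symm hG hy]; ring

lemma christoffelDerivOn_comm (hG : IsMetricOn G W) (hy : y ∈ W) (a u v : Fin n → ℝ) :
    christoffelDerivOn G y a u v = christoffelDerivOn G y a v u := by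
  funext A
  unfold christoffelDerivOn
  rw [Finset.sum_comm]
  refine Finset.sum_congr rfl fun B _ => Finset.sum_congr rfl fun C _ => ?_
  simp only [fun D => partialDeriv_christoffel_symm hG hy D A C B]
  ring

lemma curvatureOn_swap (u v w z : Fin n → ℝ) :
    curvatureOn G y u v w z = - curvatureOn G y v u w z := by
  unfold curvatureOn
  rw [Finset.sum_comm]
  simp only [← Finset.sum_neg_distrib]
  simp only [← Fintype.sum_prod_type']
  refine Finset.sum_congr rfl fun _ _ => ?_
  rw [curvature_swap_left]; ring

lemma curvatureOn_reverse (hG : IsMetricOn G W) (hy : y ∈ W) (u v w z : Fin n → ℝ) :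
    curvatureOn G y u v w z = curvatureOn G y z w v u := by
  unfold curvatureOn
  simp only [← Fintype.sum_prod_type']
  refine Finset.sum_nbij' (fun (A, B, C, D) => (D, C, B, A))
    (fun (A, B, C, D) => (D, C, B, A)) (by simp) (by simp) (by simp) (by simp) (fun _ _ => ?_)
  rw [curvature_reverse hG hy]; ring

lemma curvatureOn_rotate (u v w z : Fin n → ℝ) :
    curvatureOn G y v w u z
      = ∑ A, ∑ B, ∑ C, ∑ D, curvature G B C A D y * u A * v B * w C * z D := by
  unfold curvatureOn
  simp only [← Fintype.sum_prod_type']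
  exact Finset.sum_nbij' (fun (B, C, A, D) => (A, B, C, D)) (fun (A, B, C, D) => (B, C, A, D))
    (by simp) (by simp) (by simp) (by simp) (fun _ _ => by ring)

lemma curvatureOn_rotate_rotate (u v w z : Fin n → ℝ) :
    curvatureOn G y w u v z
      = ∑ A, ∑ B, ∑ C, ∑ D, curvature G C A B D y * u A * v B * w C * z D := by
  unfold curvatureOn
  simp only [← Fintype.sum_prod_type']
  exact Finset.sum_nbij' (fun (C, A, B, D) => (A, B, C, D)) (fun (A, B, C, D) => (C, A, B, D))
    (by simp) (by simp) (by simp) (by simp) (fun _ _ => by ring)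

lemma curvatureOn_bianchi (hG : IsMetricOn G W) (hy : y ∈ W) (u v w z : Fin n → ℝ) :
    curvatureOn G y u v w z + curvatureOn G y v w u z + curvatureOn G y w u v z = 0 := by
  rw [curvatureOn_rotate, curvatureOn_rotate_rotate]
  simp only [curvatureOn, ← Finset.sum_add_distrib, ← add_mul, curvature_bianchi hG hy, zero_mul,
    Finset.sum_const_zero]

lemma covDerivCurvatureOn_reverse (hG : IsMetricOn G W) (hy : y ∈ W) (a u v w z : Fin n → ℝ) :
    covDerivCurvatureOn G y a u v w z = covDerivCurvatureOn G y a z w v u := by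
  unfold covDerivCurvatureOn
  simp only [← Fintype.sum_prod_type']
  refine Finset.sum_nbij' (fun (E, A, B, C, D) => (E, D, C, B, A))
    (fun (E, A, B, C, D) => (E, D, C, B, A)) (by simp) (by simp) (by simp) (by simp)
    (fun _ _ => ?_)
  rw [covDerivCurvature_reverse hG hy]; ring

end Symmetries

end Contractions
/-! ### Covariant derivatives along a curve -/

section Curve

variable {n : ℕ} {G : Coord n → Matrix (Fin n) (Fin n) ℝ} {W : Set (Coord n)}
  {J : Set ℝ} {t : ℝ} {c : ℝ → Coord n} {c' : Fin n → ℝ}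

/-- The vector field `s ↦ V s` along the curve `c` has covariant derivative `V'` at time `t`, the
velocity of `c` there being `c'`. Curves parametrised by time and coordinate lines of a submanifold
are both treated this way. -/
def HasCovDerivWithinAt (G : Coord n → Matrix (Fin n) (Fin n) ℝ) (c : ℝ → Coord n)
    (c' : Fin n → ℝ) (V : ℝ → Fin n → ℝ) (V' : Fin n → ℝ) (J : Set ℝ) (t : ℝ) : Prop :=
  ∀ A, HasDerivWithinAt (fun s => V s A) ((V' - christoffelOn G (c t) c' (V t)) A) J t

lemma hasDerivWithinAt_comp_curve {w : Coord n → ℝ} (hw : DifferentiableAt ℝ w (c t))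
    (hc' : ∀ A, HasDerivWithinAt (fun s => c s A) (c' A) J t) :
    HasDerivWithinAt (fun s => w (c s)) (∑ D, partialDeriv D w (c t) * c' D) J t := by
  have hcurve : HasDerivWithinAt c (WithLp.toLp 2 c') J t :=
    (PiLp.continuousLinearEquiv 2 ℝ (fun _ : Fin n => ℝ)).symm.hasFDerivAt
      |>.comp_hasDerivWithinAt t (hasDerivWithinAt_pi.2 hc')
  exact (hw.hasFDerivAt.comp_hasDerivWithinAt t hcurve).congr_deriv
    (fderiv_eq_sum_partialDeriv _)

lemma hasDerivWithinAt_inner (hG : IsMetricOn G W) (hc : c t ∈ W)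
    (hc' : ∀ A, HasDerivWithinAt (fun s => c s A) (c' A) J t)
    {X Y : ℝ → Fin n → ℝ} {X' Y' : Fin n → ℝ}
    (hX : ∀ A, HasDerivWithinAt (fun s => X s A) (X' A) J t)
    (hY : ∀ A, HasDerivWithinAt (fun s => Y s A) (Y' A) J t) :
    HasDerivWithinAt (fun s => inner G (c s) (X s) (Y s))
      (∑ A, ∑ B, (∑ D, partialDeriv D (fun z => G z A B) (c t) * c' D) * X t A * Y t B
        + inner G (c t) X' (Y t) + inner G (c t) (X t) Y') J t := by
  have hmetric := fun A B => hasDerivWithinAt_comp_curve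
    (differentiableAt_of_contDiffOn hG.isOpen (hG.smooth A B) hc) hc'
  refine (HasDerivWithinAt.fun_sum fun A _ => HasDerivWithinAt.fun_sum fun B _ =>
    ((hmetric A B).fun_mul (hX A)).fun_mul (hY B)).congr_deriv ?_
  simp only [inner, ← Finset.sum_add_distrib]
  exact Finset.sum_congr rfl fun _ _ => Finset.sum_congr rfl fun _ _ => by ring

lemma hasDerivWithinAt_christoffelOn (hG : IsMetricOn G W) (hc : c t ∈ W)
    (hc' : ∀ A, HasDerivWithinAt (fun s => c s A) (c' A) J t)
    {X Y : ℝ → Fin n → ℝ} {X' Y' : Fin n → ℝ}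
    (hX : ∀ A, HasDerivWithinAt (fun s => X s A) (X' A) J t)
    (hY : ∀ A, HasDerivWithinAt (fun s => Y s A) (Y' A) J t) (A : Fin n) :
    HasDerivWithinAt (fun s => christoffelOn G (c s) (X s) (Y s) A)
      ((christoffelDerivOn G (c t) c' (X t) (Y t) + christoffelOn G (c t) X' (Y t)
        + christoffelOn G (c t) (X t) Y') A) J t := by
  have hchristoffel := fun B C => hasDerivWithinAt_comp_curve
    (differentiableAt_of_contDiffOn hG.isOpen (contDiffOn_christoffel hG A B C) hc) hc'
  simp only [christoffelOn_apply]
  refine (HasDerivWithinAt.fun_sum fun B _ => HasDerivWithinAt.fun_sum fun C _ =>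
    ((hchristoffel B C).fun_mul (hX B)).fun_mul (hY C)).congr_deriv ?_
  simp only [Pi.add_apply, christoffelDerivOn, christoffelOn_apply, ← Finset.sum_add_distrib]
  exact Finset.sum_congr rfl fun _ _ => Finset.sum_congr rfl fun _ _ => by ring

lemma hasDerivWithinAt_curvatureOn (hG : IsMetricOn G W) (hc : c t ∈ W)
    (hc' : ∀ A, HasDerivWithinAt (fun s => c s A) (c' A) J t)
    {X Y Z V : ℝ → Fin n → ℝ} {X' Y' Z' V' : Fin n → ℝ}
    (hX : ∀ A, HasDerivWithinAt (fun s => X s A) (X' A) J t)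
    (hY : ∀ A, HasDerivWithinAt (fun s => Y s A) (Y' A) J t)
    (hZ : ∀ A, HasDerivWithinAt (fun s => Z s A) (Z' A) J t)
    (hV : ∀ A, HasDerivWithinAt (fun s => V s A) (V' A) J t) :
    HasDerivWithinAt (fun s => curvatureOn G (c s) (X s) (Y s) (Z s) (V s))
      (curvatureDerivOn G (c t) c' (X t) (Y t) (Z t) (V t)
        + curvatureOn G (c t) X' (Y t) (Z t) (V t) + curvatureOn G (c t) (X t) Y' (Z t) (V t)
        + curvatureOn G (c t) (X t) (Y t) Z' (V t) + curvatureOn G (c t) (X t) (Y t) (Z t) V')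
      J t := by
  have hcurvature := fun A B C D => hasDerivWithinAt_comp_curve
    (differentiableAt_of_contDiffOn hG.isOpen (contDiffOn_curvature hG A B C D) hc) hc'
  refine (HasDerivWithinAt.fun_sum fun A _ => HasDerivWithinAt.fun_sum fun B _ =>
    HasDerivWithinAt.fun_sum fun C _ => HasDerivWithinAt.fun_sum fun D _ =>
      ((((hcurvature A B C D).fun_mul (hX A)).fun_mul (hY B)).fun_mul (hZ C)).fun_mul
        (hV D)).congr_deriv ?_
  simp only [curvatureDerivOn, curvatureOn, ← Finset.sum_add_distrib]
  simp only [← Fintype.sum_prod_type']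
  exact Finset.sum_congr rfl fun _ _ => by ring

lemma inner_christoffelOn_left (hG : IsMetricOn G W) {y : Coord n} (hy : y ∈ W)
    (a u v : Fin n → ℝ) :
    inner G y (christoffelOn G y a u) v
      = ∑ A, ∑ B, (∑ D, christoffelLower G B D A y * a D) * u A * v B := by
  rw [inner_comm hG hy]
  simp only [inner, christoffelOn_apply, christoffelLower, Finset.mul_sum, Finset.sum_mul]
  simp only [← Fintype.sum_prod_type']
  exact Finset.sum_nbij' (fun (B, E, D, A) => (A, B, D, E)) (fun (A, B, D, E) => (B, E, D, A))
    (by simp) (by simp) (by simp) (by simp) (fun _ _ => by ring)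

lemma inner_christoffelOn_right {y : Coord n} (a u v : Fin n → ℝ) :
    inner G y u (christoffelOn G y a v)
      = ∑ A, ∑ B, (∑ D, christoffelLower G A D B y * a D) * u A * v B := by
  simp only [inner, christoffelOn_apply, christoffelLower, Finset.mul_sum, Finset.sum_mul]
  simp only [← Fintype.sum_prod_type']
  exact Finset.sum_nbij' (fun (A, E, D, B) => (A, B, D, E)) (fun (A, B, D, E) => (A, E, D, B))
    (by simp) (by simp) (by simp) (by simp) (fun _ _ => by ring)

lemma sum_partialDeriv_metric (hG : IsMetricOn G W) {y : Coord n} (hy : y ∈ W)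
    (a u v : Fin n → ℝ) :
    ∑ A, ∑ B, (∑ D, partialDeriv D (fun z => G z A B) y * a D) * u A * v B
      = inner G y (christoffelOn G y a u) v + inner G y u (christoffelOn G y a v) := by
  rw [inner_christoffelOn_left hG hy, inner_christoffelOn_right]
  simp only [partialDeriv_metric hG hy, add_mul, Finset.sum_add_distrib]

lemma HasCovDerivWithinAt.inner (hG : IsMetricOn G W) (hc : c t ∈ W)
    (hc' : ∀ A, HasDerivWithinAt (fun s => c s A) (c' A) J t)
    {X Y : ℝ → Fin n → ℝ} {X' Y' : Fin n → ℝ}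
    (hX : HasCovDerivWithinAt G c c' X X' J t) (hY : HasCovDerivWithinAt G c c' Y Y' J t) :
    HasDerivWithinAt (fun s => inner G (c s) (X s) (Y s))
      (inner G (c t) X' (Y t) + inner G (c t) (X t) Y') J t := by
  refine (hasDerivWithinAt_inner hG hc hc' hX hY).congr_deriv ?_
  rw [sum_partialDeriv_metric hG hc, inner_sub_left, inner_sub_right]
  ring

lemma HasCovDerivWithinAt.curvatureOn (hG : IsMetricOn G W) (hc : c t ∈ W)
    (hc' : ∀ A, HasDerivWithinAt (fun s => c s A) (c' A) J t)
    {X Y Z V : ℝ → Fin n → ℝ} {X' Y' Z' V' : Fin n → ℝ}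
    (hX : HasCovDerivWithinAt G c c' X X' J t) (hY : HasCovDerivWithinAt G c c' Y Y' J t)
    (hZ : HasCovDerivWithinAt G c c' Z Z' J t) (hV : HasCovDerivWithinAt G c c' V V' J t) :
    HasDerivWithinAt (fun s => curvatureOn G (c s) (X s) (Y s) (Z s) (V s))
      (covDerivCurvatureOn G (c t) c' (X t) (Y t) (Z t) (V t)
        + curvatureOn G (c t) X' (Y t) (Z t) (V t) + curvatureOn G (c t) (X t) Y' (Z t) (V t)
        + curvatureOn G (c t) (X t) (Y t) Z' (V t) + curvatureOn G (c t) (X t) (Y t) (Z t) V')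
      J t := by
  refine (hasDerivWithinAt_curvatureOn hG hc hc' hX hY hZ hV).congr_deriv ?_
  rw [covDerivCurvatureOn_eq]
  simp only [curvatureOn_eq_innerₗ, map_sub, LinearMap.sub_apply]
  ring

end Curve
/-! ### Vector fields along a map -/

/-- `f` maps the open set `U` smoothly into the open set `W` with metric `G`. -/
structure IsMapOn {m n : ℕ} (G : Coord n → Matrix (Fin n) (Fin n) ℝ) (f : Coord m → Coord n)
    (U : Set (Coord m)) (W : Set (Coord n)) : Prop where
  metric : IsMetricOn G W
  isOpen : IsOpen U
  mapsTo : MapsTo f U W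
  smooth : ContDiffOn ℝ ∞ f U

/-- A vector field whose components are smooth on `U`. -/
def SmoothField {m n : ℕ} (U : Set (Coord m)) (V : Coord m → Fin n → ℝ) : Prop :=
  ∀ A, ContDiffOn ℝ ∞ (fun x => V x A) U

section Fields

variable {m n : ℕ} {U : Set (Coord m)} {V V' : Coord m → Fin n → ℝ} {u : Coord m → ℝ}

lemma SmoothField.add (hV : SmoothField U V) (hV' : SmoothField U V') :
    SmoothField U (fun x => V x + V' x) := fun A => (hV A).add (hV' A)

lemma SmoothField.sub (hV : SmoothField U V) (hV' : SmoothField U V') :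
    SmoothField U (fun x => V x - V' x) := fun A => (hV A).sub (hV' A)

lemma SmoothField.smul (hu : ContDiffOn ℝ ∞ u U) (hV : SmoothField U V) :
    SmoothField U (fun x => u x • V x) := fun A => hu.mul (hV A)

lemma SmoothField.sum {ι : Type*} {s : Finset ι} {V : ι → Coord m → Fin n → ℝ}
    (hV : ∀ a ∈ s, SmoothField U (V a)) : SmoothField U (fun x => ∑ a ∈ s, V a x) := by
  intro A
  simp only [Finset.sum_apply]
  exact ContDiffOn.sum fun a ha => hV a ha A

lemma SmoothField.const (v : Fin n → ℝ) : SmoothField U (fun _ : Coord m => v) :=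
  fun _ => contDiffOn_const

/-- The line through `x` in the direction of the `i`-th coordinate, parametrised by arc length. -/
def coordLine (x : Coord m) (i : Fin m) (s : ℝ) : Coord m := x + s • EuclideanSpace.single i 1

@[simp]
lemma coordLine_zero (x : Coord m) (i : Fin m) : coordLine x i 0 = x := by simp [coordLine]

lemma hasDerivAt_coordLine (x : Coord m) (i : Fin m) :
    HasDerivAt (coordLine x i) (EuclideanSpace.single i 1) 0 := by
  unfold coordLine
  simpa only [id_eq, one_smul] using ((hasDerivAt_id (0 : ℝ)).smul_const
    (EuclideanSpace.single i 1 : Coord m)).const_add x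

lemma hasDerivWithinAt_comp_coordLine {x : Coord m} (hu : DifferentiableAt ℝ u x) (i : Fin m) :
    HasDerivWithinAt (fun s => u (coordLine x i s)) (partialDeriv i u x) univ 0 :=
  (HasFDerivAt.comp_hasDerivAt 0 (by simpa using hu.hasFDerivAt)
    (hasDerivAt_coordLine x i)).hasDerivWithinAt

lemma partialDeriv_eq_of_hasDerivWithinAt {x : Coord m} (hu : DifferentiableAt ℝ u x)
    {i : Fin m} {d : ℝ} (h : HasDerivWithinAt (fun s => u (coordLine x i s)) d univ 0) :
    partialDeriv i u x = d :=
  ((hasDerivWithinAt_comp_coordLine hu i).hasDerivAt univ_mem).unique (h.hasDerivAt univ_mem)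

/-- The componentwise derivative `∂ᵢ V^A` of a vector field. -/
def fieldDeriv (i : Fin m) (V : Coord m → Fin n → ℝ) (x : Coord m) : Fin n → ℝ :=
  fun A => partialDeriv i (fun z => V z A) x

variable {G : Coord n → Matrix (Fin n) (Fin n) ℝ} {f : Coord m → Coord n} {W : Set (Coord n)}
  {x : Coord m} {i j k l : Fin m}

lemma covDeriv_eq : covDeriv G f i V x
    = fieldDeriv i V x + christoffelOn G (f x) (tangent f i x) (V x) := by
  funext A
  rw [Pi.add_apply, christoffelOn_apply]
  rfl

lemma IsMapOn.contDiffOn_apply (hf : IsMapOn G f U W) (A : Fin n) :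
    ContDiffOn ℝ ∞ (fun x => f x A) U :=
  (contDiffOn_piLp _).1 hf.smooth A

lemma IsMapOn.contDiffOn_comp (hf : IsMapOn G f U W) {w : Coord n → ℝ}
    (hw : ContDiffOn ℝ ∞ w W) : ContDiffOn ℝ ∞ (fun x => w (f x)) U :=
  hw.comp hf.smooth hf.mapsTo

lemma smoothField_tangent (hf : IsMapOn G f U W) (i : Fin m) : SmoothField U (tangent f i) :=
  fun A => contDiffOn_partialDeriv hf.isOpen (hf.contDiffOn_apply A) i

lemma SmoothField.fieldDeriv (hU : IsOpen U) (hV : SmoothField U V) (i : Fin m) :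
    SmoothField U (fieldDeriv i V) :=
  fun A => contDiffOn_partialDeriv hU (hV A) i

lemma SmoothField.christoffelOn (hf : IsMapOn G f U W) (hV : SmoothField U V)
    (hV' : SmoothField U V') : SmoothField U (fun x => christoffelOn G (f x) (V x) (V' x)) := by
  intro A
  simp only [christoffelOn_apply]
  exact ContDiffOn.sum fun B _ => ContDiffOn.sum fun C _ =>
    ((hf.contDiffOn_comp (contDiffOn_christoffel hf.metric A B C)).mul (hV B)).mul (hV' C)

lemma SmoothField.covDeriv (hf : IsMapOn G f U W) (hV : SmoothField U V) (i : Fin m) :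
    SmoothField U (covDeriv G f i V) := by
  simpa only [← covDeriv_eq] using
    (hV.fieldDeriv hf.isOpen i).add ((smoothField_tangent hf i).christoffelOn hf hV)

lemma contDiffOn_inner (hf : IsMapOn G f U W) (hV : SmoothField U V) (hV' : SmoothField U V') :
    ContDiffOn ℝ ∞ (fun x => inner G (f x) (V x) (V' x)) U :=
  ContDiffOn.sum fun A _ => ContDiffOn.sum fun B _ =>
    ((hf.contDiffOn_comp (hf.metric.smooth A B)).mul (hV A)).mul (hV' B)

lemma contDiffOn_curvatureOn (hf : IsMapOn G f U W) {X Y Z V : Coord m → Fin n → ℝ}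
    (hX : SmoothField U X) (hY : SmoothField U Y) (hZ : SmoothField U Z) (hV : SmoothField U V) :
    ContDiffOn ℝ ∞ (fun x => curvatureOn G (f x) (X x) (Y x) (Z x) (V x)) U :=
  ContDiffOn.sum fun A _ => ContDiffOn.sum fun B _ => ContDiffOn.sum fun C _ =>
    ContDiffOn.sum fun D _ =>
    ((((hf.contDiffOn_comp (contDiffOn_curvature hf.metric A B C D)).mul (hX A)).mul
      (hY B)).mul (hZ C)).mul (hV D)

lemma SmoothField.curvatureVec (hf : IsMapOn G f U W) {X Y Z : Coord m → Fin n → ℝ}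
    (hX : SmoothField U X) (hY : SmoothField U Y) (hZ : SmoothField U Z) :
    SmoothField U (fun x => curvatureVec G (f x) (X x) (Y x) (Z x)) := by
  intro E
  simp only [curvatureVec_apply]
  exact ContDiffOn.sum fun A _ => ContDiffOn.sum fun B _ => ContDiffOn.sum fun C _ =>
    (((hf.contDiffOn_comp (contDiffOn_curvatureUp hf.metric E A B C)).mul (hX A)).mul
      (hY B)).mul (hZ C)

lemma SmoothField.differentiableAt (hU : IsOpen U) (hV : SmoothField U V) (hx : x ∈ U)
    (A : Fin n) : DifferentiableAt ℝ (fun z => V z A) x :=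
  differentiableAt_of_contDiffOn hU (hV A) hx

lemma fieldDeriv_add (hU : IsOpen U) (hx : x ∈ U) (hV : SmoothField U V)
    (hV' : SmoothField U V') :
    fieldDeriv i (fun x => V x + V' x) x = fieldDeriv i V x + fieldDeriv i V' x :=
  funext fun A => partialDeriv_add (hV.differentiableAt hU hx A) (hV'.differentiableAt hU hx A)

lemma fieldDeriv_sub (hU : IsOpen U) (hx : x ∈ U) (hV : SmoothField U V)
    (hV' : SmoothField U V') :
    fieldDeriv i (fun x => V x - V' x) x = fieldDeriv i V x - fieldDeriv i V' x :=
  funext fun A => partialDeriv_sub (hV.differentiableAt hU hx A) (hV'.differentiableAt hU hx A)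

lemma covDeriv_congr (hU : IsOpen U) (hx : x ∈ U) (h : EqOn V V' U) :
    covDeriv G f i V x = covDeriv G f i V' x := by
  rw [covDeriv_eq, covDeriv_eq, h hx]
  congr 1
  exact funext fun A => partialDeriv_congr hU hx fun z hz => by rw [h hz]

lemma covDeriv_add (hU : IsOpen U) (hx : x ∈ U) (hV : SmoothField U V)
    (hV' : SmoothField U V') :
    covDeriv G f i (fun x => V x + V' x) x = covDeriv G f i V x + covDeriv G f i V' x := by
  simp only [covDeriv_eq, fieldDeriv_add hU hx hV hV', map_add]
  abel

lemma covDeriv_sub (hU : IsOpen U) (hx : x ∈ U) (hV : SmoothField U V)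
    (hV' : SmoothField U V') :
    covDeriv G f i (fun x => V x - V' x) x = covDeriv G f i V x - covDeriv G f i V' x := by
  simp only [covDeriv_eq, fieldDeriv_sub hU hx hV hV', map_sub]
  abel

lemma covDeriv_smul (hU : IsOpen U) (hx : x ∈ U) (hu : ContDiffOn ℝ ∞ u U)
    (hV : SmoothField U V) :
    covDeriv G f i (fun x => u x • V x) x
      = partialDeriv i u x • V x + u x • covDeriv G f i V x := by
  rw [covDeriv_eq, covDeriv_eq, map_smul, smul_add, ← add_assoc]
  congr 1
  exact funext fun A => partialDeriv_mul (differentiableAt_of_contDiffOn hU hu hx)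
    (hV.differentiableAt hU hx A)

lemma covDeriv_sum {ι : Type*} {s : Finset ι} {V : ι → Coord m → Fin n → ℝ} (hU : IsOpen U)
    (hx : x ∈ U) (hV : ∀ a ∈ s, SmoothField U (V a)) :
    covDeriv G f i (fun x => ∑ a ∈ s, V a x) x = ∑ a ∈ s, covDeriv G f i (V a) x := by
  simp only [covDeriv_eq]
  rw [map_sum, Finset.sum_add_distrib]
  congr 1
  funext A
  simp only [fieldDeriv, Finset.sum_apply]
  exact partialDeriv_sum fun a ha => (hV a ha).differentiableAt hU hx A

lemma covDeriv_sum_smul {ι : Type*} {s : Finset ι} {u : ι → Coord m → ℝ}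
    {V : ι → Coord m → Fin n → ℝ} (hU : IsOpen U) (hx : x ∈ U)
    (hu : ∀ a ∈ s, ContDiffOn ℝ ∞ (u a) U) (hV : ∀ a ∈ s, SmoothField U (V a)) :
    covDeriv G f i (fun x => ∑ a ∈ s, u a x • V a x) x
      = ∑ a ∈ s, partialDeriv i (u a) x • V a x + ∑ a ∈ s, u a x • covDeriv G f i (V a) x := by
  rw [covDeriv_sum hU hx fun a ha => .smul (hu a ha) (hV a ha), ← Finset.sum_add_distrib]
  exact Finset.sum_congr rfl fun a ha => covDeriv_smul hU hx (hu a ha) (hV a ha)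

lemma hasDerivWithinAt_map_coordLine (hf : IsMapOn G f U W) (hx : x ∈ U) (i : Fin m)
    (A : Fin n) :
    HasDerivWithinAt (fun s => f (coordLine x i s) A) (tangent f i x A) univ 0 :=
  hasDerivWithinAt_comp_coordLine
    (differentiableAt_of_contDiffOn hf.isOpen (hf.contDiffOn_apply A) hx) i

lemma hasCovDerivWithinAt_coordLine (hU : IsOpen U) (hx : x ∈ U) (hV : SmoothField U V)
    (i : Fin m) :
    HasCovDerivWithinAt G (fun s => f (coordLine x i s)) (tangent f i x)
      (fun s => V (coordLine x i s)) (covDeriv G f i V x) univ 0 := by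
  intro A
  simp only [coordLine_zero, covDeriv_eq, add_sub_cancel_right]
  exact hasDerivWithinAt_comp_coordLine (hV.differentiableAt hU hx A) i

lemma partialDeriv_inner (hf : IsMapOn G f U W) (hx : x ∈ U) (hV : SmoothField U V)
    (hV' : SmoothField U V') (i : Fin m) :
    partialDeriv i (fun x => inner G (f x) (V x) (V' x)) x
      = inner G (f x) (covDeriv G f i V x) (V' x)
        + inner G (f x) (V x) (covDeriv G f i V' x) := by
  refine partialDeriv_eq_of_hasDerivWithinAt
    (differentiableAt_of_contDiffOn hf.isOpen (contDiffOn_inner hf hV hV') hx) ?_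
  simpa only [coordLine_zero] using HasCovDerivWithinAt.inner hf.metric
    (by simpa only [coordLine_zero] using hf.mapsTo hx) (hasDerivWithinAt_map_coordLine hf hx i)
    (hasCovDerivWithinAt_coordLine hf.isOpen hx hV i)
    (hasCovDerivWithinAt_coordLine hf.isOpen hx hV' i)

lemma partialDeriv_curvatureOn (hf : IsMapOn G f U W) (hx : x ∈ U)
    {X Y Z V : Coord m → Fin n → ℝ}
    (hX : SmoothField U X) (hY : SmoothField U Y) (hZ : SmoothField U Z) (hV : SmoothField U V)
    (i : Fin m) :
    partialDeriv i (fun x => curvatureOn G (f x) (X x) (Y x) (Z x) (V x)) x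
      = covDerivCurvatureOn G (f x) (tangent f i x) (X x) (Y x) (Z x) (V x)
        + curvatureOn G (f x) (covDeriv G f i X x) (Y x) (Z x) (V x)
        + curvatureOn G (f x) (X x) (covDeriv G f i Y x) (Z x) (V x)
        + curvatureOn G (f x) (X x) (Y x) (covDeriv G f i Z x) (V x)
        + curvatureOn G (f x) (X x) (Y x) (Z x) (covDeriv G f i V x) := by
  refine partialDeriv_eq_of_hasDerivWithinAt
    (differentiableAt_of_contDiffOn hf.isOpen (contDiffOn_curvatureOn hf hX hY hZ hV) hx) ?_
  simpa only [coordLine_zero] using HasCovDerivWithinAt.curvatureOn hf.metric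
    (by simpa only [coordLine_zero] using hf.mapsTo hx) (hasDerivWithinAt_map_coordLine hf hx i)
    (hasCovDerivWithinAt_coordLine hf.isOpen hx hX i)
    (hasCovDerivWithinAt_coordLine hf.isOpen hx hY i)
    (hasCovDerivWithinAt_coordLine hf.isOpen hx hZ i)
    (hasCovDerivWithinAt_coordLine hf.isOpen hx hV i)

lemma inner_covDeriv_curvatureVec (hf : IsMapOn G f U W) (hx : x ∈ U)
    {X Y Z : Coord m → Fin n → ℝ} (hX : SmoothField U X) (hY : SmoothField U Y)
    (hZ : SmoothField U Z) (i : Fin m) (v : Fin n → ℝ) :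
    inner G (f x) (covDeriv G f i (fun x => curvatureVec G (f x) (X x) (Y x) (Z x)) x) v
      = covDerivCurvatureOn G (f x) (tangent f i x) (X x) (Y x) (Z x) v
        + curvatureOn G (f x) (covDeriv G f i X x) (Y x) (Z x) v
        + curvatureOn G (f x) (X x) (covDeriv G f i Y x) (Z x) v
        + curvatureOn G (f x) (X x) (Y x) (covDeriv G f i Z x) v := by
  have hv : SmoothField U (fun _ : Coord m => v) := .const v
  have hinner := partialDeriv_inner hf hx (hX.curvatureVec hf hY hZ) hv i
  have hcurvature := partialDeriv_curvatureOn hf hx hX hY hZ hv i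
  simp only [inner_curvatureVec] at hinner
  linarith

lemma fieldDeriv_christoffelOn (hf : IsMapOn G f U W) (hx : x ∈ U)
    (hV : SmoothField U V) (hV' : SmoothField U V') (i : Fin m) :
    fieldDeriv i (fun x => christoffelOn G (f x) (V x) (V' x)) x
      = christoffelDerivOn G (f x) (tangent f i x) (V x) (V' x)
        + christoffelOn G (f x) (fieldDeriv i V x) (V' x)
        + christoffelOn G (f x) (V x) (fieldDeriv i V' x) := by
  funext A
  refine partialDeriv_eq_of_hasDerivWithinAt
    ((hV.christoffelOn hf hV').differentiableAt hf.isOpen hx A) ?_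
  have hderiv := hasDerivWithinAt_christoffelOn hf.metric
    (by simpa only [coordLine_zero] using hf.mapsTo hx) (hasDerivWithinAt_map_coordLine hf hx i)
    (fun A => hasDerivWithinAt_comp_coordLine (hV.differentiableAt hf.isOpen hx A) i)
    (fun A => hasDerivWithinAt_comp_coordLine (hV'.differentiableAt hf.isOpen hx A) i) A
  simp only [coordLine_zero] at hderiv
  exact hderiv

lemma fieldDeriv_comm (hU : IsOpen U) (hx : x ∈ U) (hV : SmoothField U V) (i j : Fin m) :
    fieldDeriv i (fieldDeriv j V) x = fieldDeriv j (fieldDeriv i V) x :=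
  funext fun A => partialDeriv_comm_of_contDiffOn hU (hV A) hx

lemma fieldDeriv_tangent_comm (hf : IsMapOn G f U W) (hx : x ∈ U) (i j : Fin m) :
    fieldDeriv i (tangent f j) x = fieldDeriv j (tangent f i) x :=
  funext fun A => partialDeriv_comm_of_contDiffOn hf.isOpen (hf.contDiffOn_apply A) hx

lemma covDeriv_tangent_comm (hf : IsMapOn G f U W) (hx : x ∈ U) (i j : Fin m) :
    covDeriv G f i (tangent f j) x = covDeriv G f j (tangent f i) x := by
  rw [covDeriv_eq, covDeriv_eq, fieldDeriv_tangent_comm hf hx,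
    christoffelOn_comm hf.metric (hf.mapsTo hx)]

lemma covDeriv_covDeriv_eq (hf : IsMapOn G f U W) (hx : x ∈ U) (hV : SmoothField U V)
    (l k : Fin m) :
    covDeriv G f l (covDeriv G f k V) x
      = fieldDeriv l (fieldDeriv k V) x
        + (christoffelDerivOn G (f x) (tangent f l x) (tangent f k x) (V x)
          + christoffelOn G (f x) (fieldDeriv l (tangent f k) x) (V x)
          + christoffelOn G (f x) (tangent f k x) (fieldDeriv l V x))
        + (christoffelOn G (f x) (tangent f l x) (fieldDeriv k V x)
          + christoffelOn G (f x) (tangent f l x)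
            (christoffelOn G (f x) (tangent f k x) (V x))) := by
  rw [covDeriv_congr hf.isOpen hx fun z _ => covDeriv_eq, covDeriv_eq,
    ← fieldDeriv_christoffelOn hf hx (smoothField_tangent hf k) hV, map_add,
    fieldDeriv_add hf.isOpen hx (hV.fieldDeriv hf.isOpen k)
      ((smoothField_tangent hf k).christoffelOn hf hV)]

lemma covDeriv_comm (hf : IsMapOn G f U W) (hx : x ∈ U) (hV : SmoothField U V) (l k : Fin m) :
    covDeriv G f l (covDeriv G f k V) x - covDeriv G f k (covDeriv G f l V) x
      = - curvatureVec G (f x) (tangent f l x) (tangent f k x) (V x) := by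
  rw [covDeriv_covDeriv_eq hf hx hV, covDeriv_covDeriv_eq hf hx hV, curvatureVec_eq,
    fieldDeriv_comm hf.isOpen hx hV k l, fieldDeriv_tangent_comm hf hx k l]
  abel

end Fields

/-! ### Immersions -/

/-- `f` is a smooth map on `U` whose induced metric is nondegenerate. -/
structure IsImmersionOn {m n : ℕ} (G : Coord n → Matrix (Fin n) (Fin n) ℝ)
    (f : Coord m → Coord n) (U : Set (Coord m)) (W : Set (Coord n)) : Prop
    extends IsMapOn G f U W where
  det_ne : ∀ x ∈ U, (inducedMetric G f x).det ≠ 0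

section Immersion

variable {m n : ℕ} {G : Coord n → Matrix (Fin n) (Fin n) ℝ} {f : Coord m → Coord n}
  {U : Set (Coord m)} {W : Set (Coord n)} {x : Coord m} {i j k l : Fin m}

lemma contDiffOn_inducedMetric (hf : IsMapOn G f U W) (i j : Fin m) :
    ContDiffOn ℝ ∞ (fun x => inducedMetric G f x i j) U :=
  contDiffOn_inner hf (smoothField_tangent hf i) (smoothField_tangent hf j)

lemma contDiffOn_inducedInv (hf : IsImmersionOn G f U W) (i j : Fin m) :
    ContDiffOn ℝ ∞ (inducedInv G f i j) U :=
  contDiffOn_matrix_inv_apply (contDiffOn_inducedMetric hf.toIsMapOn) hf.det_ne i j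

lemma inducedMetric_isSymm (hf : IsMapOn G f U W) (hx : x ∈ U) :
    (inducedMetric G f x).IsSymm := by
  ext i j
  exact inner_comm hf.metric (hf.mapsTo hx) _ _

lemma inducedInv_symm (hf : IsMapOn G f U W) (hx : x ∈ U) (i j : Fin m) :
    inducedInv G f i j x = inducedInv G f j i x :=
  (inducedMetric_isSymm hf hx).inv.apply j i

lemma sum_inducedInv_mul (hf : IsImmersionOn G f U W) (hx : x ∈ U) (i j : Fin m) :
    ∑ k, inducedInv G f i k x * inner G (f x) (tangent f k x) (tangent f j x)
      = if i = j then 1 else 0 := by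
  have inv_mul := congrFun₂ (Matrix.nonsing_inv_mul _ (hf.det_ne x hx).isUnit) i j
  rwa [Matrix.mul_apply, Matrix.one_apply] at inv_mul

lemma normalPart_eq (v : Fin n → ℝ) :
    normalPart G f x v = v - ∑ k, tangentialCoeff G f x v k • tangent f k x := by
  funext A
  simp [normalPart]

lemma covDeriv_tangent_eq (i j : Fin m) (x : Coord m) :
    covDeriv G f i (tangent f j) x
      = secondFF G f i j x + ∑ k, inducedConn G f k i j x • tangent f k x := by
  rw [secondFF, normalPart_eq]
  simp [inducedConn]

lemma secondFF_eq (i j : Fin m) : secondFF G f i j = fun x =>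
    covDeriv G f i (tangent f j) x - ∑ k, inducedConn G f k i j x • tangent f k x := by
  funext x
  rw [covDeriv_tangent_eq, add_sub_cancel_right]

lemma sum_tangentialCoeff_mul (hf : IsImmersionOn G f U W) (hx : x ∈ U) (v : Fin n → ℝ)
    (l : Fin m) :
    ∑ k, tangentialCoeff G f x v k * inner G (f x) (tangent f k x) (tangent f l x)
      = inner G (f x) v (tangent f l x) := by
  have contract (q : Fin m) : ∑ k, inducedInv G f k q x * inner G (f x) v (tangent f q x)
      * inner G (f x) (tangent f k x) (tangent f l x)
      = inner G (f x) v (tangent f q x) * if q = l then 1 else 0 := by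
    rw [← sum_inducedInv_mul hf hx, Finset.mul_sum]
    refine Finset.sum_congr rfl fun k _ => ?_
    rw [inducedInv_symm hf.toIsMapOn hx]
    ring
  simp only [tangentialCoeff, Finset.sum_mul]
  rw [Finset.sum_comm]
  simp [contract]

lemma inner_normalPart_tangent (hf : IsImmersionOn G f U W) (hx : x ∈ U) (v : Fin n → ℝ)
    (l : Fin m) : inner G (f x) (normalPart G f x v) (tangent f l x) = 0 := by
  rw [normalPart_eq, inner_sub_left, inner_sum_left]
  simp only [inner_smul_left]
  rw [sum_tangentialCoeff_mul hf hx, sub_self]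

/-- `ν` is normal to the immersion at `f x`. -/
def IsNormal (G : Coord n → Matrix (Fin n) (Fin n) ℝ) (f : Coord m → Coord n) (x : Coord m)
    (ν : Fin n → ℝ) : Prop :=
  ∀ l, inner G (f x) (tangent f l x) ν = 0

lemma inner_sum_tangent {ν : Fin n → ℝ} (hν : IsNormal G f x ν) (a : Fin m → ℝ) :
    inner G (f x) (∑ k, a k • tangent f k x) ν = 0 := by
  rw [inner_sum_left]
  exact Finset.sum_eq_zero fun k _ => by rw [inner_smul_left, hν k, mul_zero]

lemma inner_normalPart {ν : Fin n → ℝ} (hν : IsNormal G f x ν) (v : Fin n → ℝ) :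
    inner G (f x) (normalPart G f x v) ν = inner G (f x) v ν := by
  rw [normalPart_eq, inner_sub_left, inner_sum_tangent hν, sub_zero]

/-! ### The second fundamental form -/

lemma isNormal_secondFF (hf : IsImmersionOn G f U W) (hx : x ∈ U) (i j : Fin m) :
    IsNormal G f x (secondFF G f i j x) := fun l => by
  rw [inner_comm hf.metric (hf.mapsTo hx)]
  exact inner_normalPart_tangent hf hx _ l

lemma secondFF_symm (hf : IsMapOn G f U W) (hx : x ∈ U) (i j : Fin m) :
    secondFF G f i j x = secondFF G f j i x := by
  rw [secondFF, covDeriv_tangent_comm hf hx, ← secondFF]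

lemma inducedConn_symm (hf : IsMapOn G f U W) (hx : x ∈ U) (k i j : Fin m) :
    inducedConn G f k i j x = inducedConn G f k j i x := by
  rw [inducedConn, covDeriv_tangent_comm hf hx, ← inducedConn]

lemma contDiffOn_tangentialCoeff (hf : IsImmersionOn G f U W) {V : Coord m → Fin n → ℝ}
    (hV : SmoothField U V) (k : Fin m) :
    ContDiffOn ℝ ∞ (fun x => tangentialCoeff G f x (V x) k) U :=
  ContDiffOn.sum fun l _ => (contDiffOn_inducedInv hf k l).mul
    (contDiffOn_inner hf.toIsMapOn hV (smoothField_tangent hf.toIsMapOn l))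

lemma contDiffOn_inducedConn (hf : IsImmersionOn G f U W) (k i j : Fin m) :
    ContDiffOn ℝ ∞ (inducedConn G f k i j) U :=
  contDiffOn_tangentialCoeff hf
    ((smoothField_tangent hf.toIsMapOn j).covDeriv hf.toIsMapOn i) k

lemma smoothField_secondFF (hf : IsImmersionOn G f U W) (i j : Fin m) :
    SmoothField U (secondFF G f i j) := by
  rw [secondFF_eq]
  exact ((smoothField_tangent hf.toIsMapOn j).covDeriv hf.toIsMapOn i).sub
    (SmoothField.sum fun k _ => SmoothField.smul (contDiffOn_inducedConn hf k i j)
      (smoothField_tangent hf.toIsMapOn k))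

lemma inner_covDeriv_tangent {ν : Fin n → ℝ} (hν : IsNormal G f x ν) (i j : Fin m) :
    inner G (f x) (covDeriv G f i (tangent f j) x) ν = inner G (f x) (secondFF G f i j x) ν := by
  rw [covDeriv_tangent_eq, inner_add_left, inner_sum_tangent hν, add_zero]

lemma inner_covDeriv_of_isNormal (hf : IsMapOn G f U W) (hx : x ∈ U)
    {V : Coord m → Fin n → ℝ} (hV : SmoothField U V) (hn : ∀ z ∈ U, IsNormal G f z (V z))
    (k l : Fin m) :
    inner G (f x) (covDeriv G f k V x) (tangent f l x)
      = - inner G (f x) (V x) (secondFF G f k l x) := by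
  have inner_const : partialDeriv k (fun z => inner G (f z) (tangent f l z) (V z)) x = 0 := by
    rw [partialDeriv_congr (v := fun _ => 0) hf.isOpen hx fun z hz => hn z hz l,
      partialDeriv_const]
  rw [partialDeriv_inner hf hx (smoothField_tangent hf l) hV k,
    inner_covDeriv_tangent (hn x hx)] at inner_const
  rw [inner_comm hf.metric (hf.mapsTo hx), inner_comm hf.metric (hf.mapsTo hx) (V x)]
  linarith

lemma partialDeriv_inducedMetric (hf : IsMapOn G f U W) (hx : x ∈ U) (k i j : Fin m) :
    partialDeriv k (fun z => inducedMetric G f z i j) x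
      = inner G (f x) (covDeriv G f k (tangent f i) x) (tangent f j x)
        + inner G (f x) (covDeriv G f k (tangent f j) x) (tangent f i x) := by
  rw [inner_comm hf.metric (hf.mapsTo hx) _ (tangent f i x)]
  exact partialDeriv_inner hf hx (smoothField_tangent hf i) (smoothField_tangent hf j) k

lemma partialDeriv_inducedInv (hf : IsImmersionOn G f U W) (hx : x ∈ U) (k i j : Fin m) :
    partialDeriv k (inducedInv G f i j) x
      = - ∑ q, inducedConn G f i k q x * inducedInv G f q j x
        - ∑ q, inducedConn G f j k q x * inducedInv G f i q x := by
  have hm := hf.toIsMapOn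
  have metric_deriv (a b : Fin m) := hasDerivWithinAt_comp_coordLine
    (differentiableAt_of_contDiffOn hm.isOpen (contDiffOn_inducedMetric hm a b) hx) k
  have inv_deriv := hasDerivWithinAt_matrix_inv_apply (M' := Matrix.of fun a b =>
    partialDeriv k (fun z => inducedMetric G f z a b) x) metric_deriv
    (by rw [coordLine_zero]; exact hf.det_ne x hx) i j
  rw [partialDeriv_eq_of_hasDerivWithinAt
    (differentiableAt_of_contDiffOn hm.isOpen (contDiffOn_inducedInv hf i j) hx) inv_deriv]
  simp only [coordLine_zero, Matrix.mul_apply, Matrix.of_apply,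
    partialDeriv_inducedMetric hm hx, mul_add, Finset.sum_add_distrib, add_mul]
  simp only [inducedConn, tangentialCoeff, inducedInv, Finset.sum_mul]
  rw [add_comm, neg_add', sub_right_inj]
  refine Finset.sum_comm.trans <|
    Finset.sum_congr rfl fun q _ => Finset.sum_congr rfl fun l _ => ?_
  rw [show (inducedMetric G f x)⁻¹ l j = (inducedMetric G f x)⁻¹ j l from
    inducedInv_symm hm hx l j]
  ring

/-! ### Derivatives of tensors with values in the ambient space -/

/-- The derivative `∇_{∂ₖ}` of a two-tensor with values in the vector fields along `f`, formed with
the induced connection and the ambient connection. -/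
def tensorDeriv (G : Coord n → Matrix (Fin n) (Fin n) ℝ) (f : Coord m → Coord n)
    (T : Fin m → Fin m → Coord m → Fin n → ℝ) (k i j : Fin m) (x : Coord m) : Fin n → ℝ :=
  covDeriv G f k (T i j) x - ∑ q, inducedConn G f q k i x • T q j x
    - ∑ q, inducedConn G f q k j x • T i q x

/-- The second derivative `∇_{∂ₗ} ∇_{∂ₖ}` of a two-tensor with values in the vector fields along
`f`, a tensor in all four indices. -/
def tensorDeriv2 (G : Coord n → Matrix (Fin n) (Fin n) ℝ) (f : Coord m → Coord n)
    (T : Fin m → Fin m → Coord m → Fin n → ℝ) (l k i j : Fin m) (x : Coord m) : Fin n → ℝ :=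
  tensorDeriv G f (tensorDeriv G f T k) l i j x
    - ∑ q, inducedConn G f q l k x • tensorDeriv G f T q i j x

/-- The curvature of the induced connection,
`∇ₖ ∇ᵢ ∂ⱼ - ∇ᵢ ∇ₖ ∂ⱼ = R^q_{kij} ∂_q`. -/
def inducedRiemann (G : Coord n → Matrix (Fin n) (Fin n) ℝ) (f : Coord m → Coord n)
    (q k i j : Fin m) (x : Coord m) : ℝ :=
  partialDeriv k (inducedConn G f q i j) x - partialDeriv i (inducedConn G f q k j) x
    + ∑ p, inducedConn G f q k p x * inducedConn G f p i j x
    - ∑ p, inducedConn G f q i p x * inducedConn G f p k j x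

lemma contDiffOn_inducedRiemann (hf : IsImmersionOn G f U W) (q k i j : Fin m) :
    ContDiffOn ℝ ∞ (inducedRiemann G f q k i j) U := by
  have hΓ := contDiffOn_inducedConn hf
  have hderiv (q i j k) := contDiffOn_partialDeriv hf.isOpen (hΓ q i j) k
  exact (((hderiv _ _ _ _).sub (hderiv _ _ _ _)).add
    (ContDiffOn.sum fun p _ => (hΓ _ _ _).mul (hΓ _ _ _))).sub
    (ContDiffOn.sum fun p _ => (hΓ _ _ _).mul (hΓ _ _ _))

lemma sum_smul_sum_smul {E ι : Type*} [AddCommGroup E] [Module ℝ E] [Fintype ι]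
    (a : ι → ℝ) (b : ι → ι → ℝ) (v : ι → E) :
    ∑ p, a p • ∑ q, b q p • v q = ∑ q, (∑ p, b q p * a p) • v q := by
  simp only [Finset.smul_sum, Finset.sum_smul, smul_smul]
  rw [Finset.sum_comm]
  simp only [mul_comm]

section Tensor

variable {T : Fin m → Fin m → Coord m → Fin n → ℝ}

lemma tensorDeriv2_apply (l k i j : Fin m) (x : Coord m) :
    tensorDeriv2 G f T l k i j x
      = covDeriv G f l (tensorDeriv G f T k i j) x
        - ∑ q, inducedConn G f q l i x • tensorDeriv G f T k q j x
        - ∑ q, inducedConn G f q l j x • tensorDeriv G f T k i q x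
        - ∑ q, inducedConn G f q l k x • tensorDeriv G f T q i j x :=
  rfl

lemma smoothField_tensorDeriv (hf : IsImmersionOn G f U W) (hT : ∀ i j, SmoothField U (T i j))
    (k i j : Fin m) : SmoothField U (tensorDeriv G f T k i j) :=
  (((hT i j).covDeriv hf.toIsMapOn k).sub
    (SmoothField.sum fun q _ => SmoothField.smul (contDiffOn_inducedConn hf q k i) (hT q j))).sub
    (SmoothField.sum fun q _ => SmoothField.smul (contDiffOn_inducedConn hf q k j) (hT i q))

lemma tensorDeriv_symm (hU : IsOpen U) (hx : x ∈ U) (hT : ∀ z ∈ U, ∀ i j, T i j z = T j i z)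
    (k i j : Fin m) : tensorDeriv G f T k i j x = tensorDeriv G f T k j i x := by
  unfold tensorDeriv
  rw [covDeriv_congr hU hx fun z hz => hT z hz i j]
  simp only [fun q => hT x hx q j, fun q => hT x hx i q]
  abel

lemma tensorDeriv2_symm (hU : IsOpen U) (hx : x ∈ U) (hT : ∀ z ∈ U, ∀ i j, T i j z = T j i z)
    (l k i j : Fin m) : tensorDeriv2 G f T l k i j x = tensorDeriv2 G f T l k j i x := by
  have deriv_symm (z) (hz : z ∈ U) (q i j : Fin m) :
    tensorDeriv G f T q i j z = tensorDeriv G f T q j i z := tensorDeriv_symm hU hz hT q i j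
  unfold tensorDeriv2
  rw [tensorDeriv_symm hU hx fun z hz => deriv_symm z hz k]
  simp only [fun q => deriv_symm x hx q i j]

lemma covDeriv_tensorDeriv (hf : IsImmersionOn G f U W) (hx : x ∈ U)
    (hT : ∀ i j, SmoothField U (T i j)) (l k i j : Fin m) :
    covDeriv G f l (tensorDeriv G f T k i j) x
      = covDeriv G f l (covDeriv G f k (T i j)) x
        - (∑ q, partialDeriv l (inducedConn G f q k i) x • T q j x
          + ∑ q, inducedConn G f q k i x • covDeriv G f l (T q j) x)
        - (∑ q, partialDeriv l (inducedConn G f q k j) x • T i q x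
          + ∑ q, inducedConn G f q k j x • covDeriv G f l (T i q) x) := by
  have hU := hf.isOpen
  have hΓ (i' : Fin m) := fun q (_ : q ∈ Finset.univ) => contDiffOn_inducedConn hf q k i'
  have hsum (i' : Fin m) (V : Fin m → Coord m → Fin n → ℝ) (hV : ∀ q, SmoothField U (V q)) :
      SmoothField U (fun x => ∑ q, inducedConn G f q k i' x • V q x) :=
    SmoothField.sum fun q hq => SmoothField.smul (hΓ i' q hq) (hV q)
  have hleft := hsum i _ fun q => hT q j
  have hright := hsum j _ fun q => hT i q
  have hcov := (hT i j).covDeriv hf.toIsMapOn k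
  rw [← covDeriv_sum_smul hU hx (hΓ i) fun q _ => hT q j,
    ← covDeriv_sum_smul hU hx (hΓ j) fun q _ => hT i q,
    ← covDeriv_sub hU hx hcov hleft, ← covDeriv_sub hU hx (hcov.sub hleft) hright]
  rfl

lemma tensorDeriv2_eq (hf : IsImmersionOn G f U W) (hx : x ∈ U)
    (hT : ∀ i j, SmoothField U (T i j)) (l k i j : Fin m) :
    tensorDeriv2 G f T l k i j x
      = covDeriv G f l (covDeriv G f k (T i j)) x
        - ∑ q, (partialDeriv l (inducedConn G f q k i) x
          - ∑ p, inducedConn G f q k p x * inducedConn G f p l i x) • T q j x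
        - ∑ q, (partialDeriv l (inducedConn G f q k j) x
          - ∑ p, inducedConn G f q k p x * inducedConn G f p l j x) • T i q x
        - (∑ q, inducedConn G f q k i x • covDeriv G f l (T q j) x
          + ∑ q, inducedConn G f q l i x • covDeriv G f k (T q j) x)
        - (∑ q, inducedConn G f q k j x • covDeriv G f l (T i q) x
          + ∑ q, inducedConn G f q l j x • covDeriv G f k (T i q) x)
        + (∑ q, ∑ p, (inducedConn G f q l i x * inducedConn G f p k j x) • T q p x
          + ∑ q, ∑ p, (inducedConn G f q k i x * inducedConn G f p l j x) • T q p x)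
        - ∑ q, inducedConn G f q l k x • tensorDeriv G f T q i j x := by
  have mixed : ∑ q, inducedConn G f q l j x • ∑ p, inducedConn G f p k i x • T p q x
      = ∑ q, ∑ p, (inducedConn G f q k i x * inducedConn G f p l j x) • T q p x := by
    simp only [Finset.smul_sum, smul_smul]
    rw [Finset.sum_comm]
    simp only [mul_comm]
  rw [tensorDeriv2_apply, covDeriv_tensorDeriv hf hx hT]
  simp only [tensorDeriv, smul_sub, sub_smul, Finset.sum_sub_distrib]
  rw [sum_smul_sum_smul, sum_smul_sum_smul, mixed]
  simp only [Finset.smul_sum, smul_smul]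
  abel

lemma tensorDeriv2_sub (hf : IsImmersionOn G f U W) (hx : x ∈ U)
    (hT : ∀ i j, SmoothField U (T i j)) (l k i j : Fin m) :
    tensorDeriv2 G f T l k i j x - tensorDeriv2 G f T k l i j x
      = - curvatureVec G (f x) (tangent f l x) (tangent f k x) (T i j x)
        - ∑ q, inducedRiemann G f q l k i x • T q j x
        - ∑ q, inducedRiemann G f q l k j x • T i q x := by
  rw [← covDeriv_comm hf.toIsMapOn hx (hT i j) l k, tensorDeriv2_eq hf hx hT l k,
    tensorDeriv2_eq hf hx hT k l]
  unfold inducedRiemann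
  simp only [sub_smul, add_smul, Finset.sum_add_distrib, Finset.sum_sub_distrib,
    fun q => inducedConn_symm hf.toIsMapOn hx q l k]
  abel

end Tensor

lemma covDeriv_secondFF (hf : IsImmersionOn G f U W) (hx : x ∈ U) (k i j : Fin m) :
    covDeriv G f k (secondFF G f i j) x
      = covDeriv G f k (covDeriv G f i (tangent f j)) x
        - ∑ q, partialDeriv k (inducedConn G f q i j) x • tangent f q x
        - ∑ p, inducedConn G f p i j x • secondFF G f k p x
        - ∑ q, (∑ p, inducedConn G f q k p x * inducedConn G f p i j x) • tangent f q x := by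
  have hm := hf.toIsMapOn
  have hE := smoothField_tangent hm
  have hΓ := fun q (_ : q ∈ Finset.univ) => contDiffOn_inducedConn hf q i j
  rw [secondFF_eq i j, covDeriv_sub hf.isOpen hx ((hE j).covDeriv hm i)
    (SmoothField.sum fun q hq => SmoothField.smul (hΓ q hq) (hE q)),
    covDeriv_sum_smul hf.isOpen hx hΓ fun q _ => hE q, ← sum_smul_sum_smul]
  simp only [covDeriv_tangent_eq k, smul_add, Finset.sum_add_distrib]
  abel

-- The tangential part of this identity is the Gauss equation, the normal part that of Codazzi.
lemma tensorDeriv_secondFF_sub (hf : IsImmersionOn G f U W) (hx : x ∈ U) (k i j : Fin m) :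
    tensorDeriv G f (secondFF G f) k i j x - tensorDeriv G f (secondFF G f) i k j x
      = - curvatureVec G (f x) (tangent f k x) (tangent f i x) (tangent f j x)
        - ∑ q, inducedRiemann G f q k i j x • tangent f q x := by
  have hm := hf.toIsMapOn
  rw [← covDeriv_comm hm hx (smoothField_tangent hm j) k i]
  unfold tensorDeriv inducedRiemann
  rw [covDeriv_secondFF hf hx, covDeriv_secondFF hf hx]
  simp only [sub_smul, add_smul, Finset.sum_add_distrib, Finset.sum_sub_distrib,
    fun q => inducedConn_symm hm hx q k i, fun p => secondFF_symm hm hx k p,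
    fun p => secondFF_symm hm hx i p]
  abel

end Immersion

section Equations

variable {m n : ℕ} {G : Coord n → Matrix (Fin n) (Fin n) ℝ} {f : Coord m → Coord n}
  {U : Set (Coord m)} {W : Set (Coord n)} {x : Coord m} {i j k l : Fin m}

lemma inner_tensorDeriv_secondFF_sub (hf : IsImmersionOn G f U W) (hx : x ∈ U) {ν : Fin n → ℝ}
    (hν : IsNormal G f x ν) (k i j : Fin m) :
    inner G (f x) (tensorDeriv G f (secondFF G f) k i j x) ν
        - inner G (f x) (tensorDeriv G f (secondFF G f) i k j x) ν
      = - curvatureOn G (f x) (tangent f k x) (tangent f i x) (tangent f j x) ν := by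
  rw [← inner_sub_left, tensorDeriv_secondFF_sub hf hx, inner_sub_left, inner_sum_tangent hν,
    inner_neg_left, inner_curvatureVec, sub_zero]

lemma inner_tensorDeriv_secondFF_tangent (hf : IsImmersionOn G f U W) (hx : x ∈ U)
    (k i j l : Fin m) :
    inner G (f x) (tensorDeriv G f (secondFF G f) k i j x) (tangent f l x)
      = - inner G (f x) (secondFF G f i j x) (secondFF G f k l x) := by
  have normal (i j : Fin m) : inner G (f x) (secondFF G f i j x) (tangent f l x) = 0 := by
    rw [inner_comm hf.metric (hf.mapsTo hx)]
    exact isNormal_secondFF hf hx i j l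
  rw [tensorDeriv, inner_sub_left, inner_sub_left, inner_sum_left, inner_sum_left,
    inner_covDeriv_of_isNormal hf.toIsMapOn hx (smoothField_secondFF hf i j)
      fun _ hz => isNormal_secondFF hf hz i j]
  simp only [inner_smul_left, normal, mul_zero, Finset.sum_const_zero, sub_zero]

lemma sum_inducedRiemann_mul (hf : IsImmersionOn G f U W) (hx : x ∈ U) (k i j l : Fin m) :
    ∑ q, inducedRiemann G f q k i j x * inner G (f x) (tangent f q x) (tangent f l x)
      = - curvatureOn G (f x) (tangent f k x) (tangent f i x) (tangent f j x) (tangent f l x)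
        + inner G (f x) (secondFF G f i j x) (secondFF G f k l x)
        - inner G (f x) (secondFF G f k j x) (secondFF G f i l x) := by
  have tangential := congrArg (fun v => inner G (f x) v (tangent f l x))
    (tensorDeriv_secondFF_sub hf hx k i j)
  simp only [inner_sub_left, inner_neg_left, inner_sum_left, inner_smul_left,
    inner_curvatureVec, inner_tensorDeriv_secondFF_tangent hf hx] at tangential
  linarith

lemma covDeriv_tensorDeriv_secondFF_swap (hf : IsImmersionOn G f U W) (hx : x ∈ U)
    (l k i j : Fin m) :
    covDeriv G f l (tensorDeriv G f (secondFF G f) i k j) x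
      = covDeriv G f l (tensorDeriv G f (secondFF G f) k i j) x
        + (covDeriv G f l (fun x => curvatureVec G (f x) (tangent f k x) (tangent f i x)
            (tangent f j x)) x
          + (∑ q, partialDeriv l (inducedRiemann G f q k i j) x • tangent f q x
            + ∑ q, inducedRiemann G f q k i j x • covDeriv G f l (tangent f q) x)) := by
  have hE := smoothField_tangent hf.toIsMapOn
  have hR := fun q (_ : q ∈ Finset.univ) => contDiffOn_inducedRiemann hf q k i j
  have hK := SmoothField.curvatureVec hf.toIsMapOn (hE k) (hE i) (hE j)
  have hRE := SmoothField.sum fun q hq => SmoothField.smul (hR q hq) (hE q)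
  rw [← covDeriv_sum_smul hf.isOpen hx hR fun q _ => hE q, ← covDeriv_add hf.isOpen hx hK hRE,
    ← covDeriv_add hf.isOpen hx (smoothField_tensorDeriv hf (smoothField_secondFF hf) k i j)
      (hK.add hRE)]
  refine covDeriv_congr hf.isOpen hx fun z hz => ?_
  rw [← sub_sub_cancel (tensorDeriv G f (secondFF G f) k i j z)
    (tensorDeriv G f (secondFF G f) i k j z), tensorDeriv_secondFF_sub hf hz k i j]
  abel

lemma inner_sum_smul_left (a : Fin m → ℝ) (v : Fin m → Fin n → ℝ) (y : Coord n)
    (ν : Fin n → ℝ) :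
    inner G y (∑ q, a q • v q) ν = ∑ q, a q * inner G y (v q) ν := by
  simp only [inner_sum_left, inner_smul_left]

lemma sum_mul_inner_tensorDeriv_secondFF_swap (hf : IsImmersionOn G f U W) (hx : x ∈ U)
    {ν : Fin n → ℝ} (hν : IsNormal G f x ν) (a : Fin m → ℝ) (k i j : Fin m → Fin m) :
    ∑ q, a q * inner G (f x) (tensorDeriv G f (secondFF G f) (k q) (i q) (j q) x) ν
      = ∑ q, a q * inner G (f x) (tensorDeriv G f (secondFF G f) (i q) (k q) (j q) x) ν
        - ∑ q, a q * curvatureOn G (f x) (tangent f (k q) x) (tangent f (i q) x)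
            (tangent f (j q) x) ν := by
  rw [← Finset.sum_sub_distrib]
  refine Finset.sum_congr rfl fun q _ => ?_
  linear_combination a q * inner_tensorDeriv_secondFF_sub hf hx hν (k q) (i q) (j q)

lemma inner_tensorDeriv2_secondFF_sub (hf : IsImmersionOn G f U W) (hx : x ∈ U) {ν : Fin n → ℝ}
    (hν : IsNormal G f x ν) (l k i j : Fin m) :
    inner G (f x) (tensorDeriv2 G f (secondFF G f) l k i j x) ν
        - inner G (f x) (tensorDeriv2 G f (secondFF G f) l i k j x) ν
      = - (covDerivCurvatureOn G (f x) (tangent f l x) (tangent f k x) (tangent f i x)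
            (tangent f j x) ν
          + curvatureOn G (f x) (secondFF G f l k x) (tangent f i x) (tangent f j x) ν
          + curvatureOn G (f x) (tangent f k x) (secondFF G f l i x) (tangent f j x) ν
          + curvatureOn G (f x) (tangent f k x) (tangent f i x) (secondFF G f l j x) ν)
        - ∑ q, inducedRiemann G f q k i j x * inner G (f x) (secondFF G f l q x) ν := by
  have hE := smoothField_tangent hf.toIsMapOn
  have swap := sum_mul_inner_tensorDeriv_secondFF_swap hf hx hν
  have inner_curvature_deriv :=
    inner_covDeriv_curvatureVec hf.toIsMapOn hx (hE k) (hE i) (hE j) l ν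
  simp only [covDeriv_tangent_eq l, curvatureOn_eq_innerₗ, map_add, map_sum, map_smul,
    LinearMap.add_apply, LinearMap.sum_apply, LinearMap.smul_apply, smul_eq_mul]
    at inner_curvature_deriv
  simp only [← curvatureOn_eq_innerₗ] at inner_curvature_deriv
  simp only [tensorDeriv2_apply, inner_sub_left, inner_sum_smul_left,
    covDeriv_tensorDeriv_secondFF_swap hf hx l k, inner_add_left, inner_curvature_deriv,
    inner_covDeriv_tangent hν, hν _, mul_zero, Finset.sum_const_zero]
  linear_combination
    - swap (fun q => inducedConn G f q l k x) (fun q => q) (fun _ => i) (fun _ => j)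
    - swap (fun q => inducedConn G f q l i x) (fun _ => k) (fun q => q) (fun _ => j)
    - swap (fun q => inducedConn G f q l j x) (fun _ => k) (fun _ => i) (fun q => q)

/-! ### Comparison with the intrinsic derivatives -/

lemma tangentialCoeff_covDeriv_secondFF (hf : IsImmersionOn G f U W) (hx : x ∈ U)
    (k i j p : Fin m) :
    tangentialCoeff G f x (covDeriv G f k (secondFF G f i j) x) p
      = - ∑ q, inducedInv G f p q x
        * inner G (f x) (secondFF G f i j x) (secondFF G f k q x) := by
  simp only [tangentialCoeff, inner_covDeriv_of_isNormal hf.toIsMapOn hx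
    (smoothField_secondFF hf i j) fun _ hz => isNormal_secondFF hf hz i j, mul_neg,
    Finset.sum_neg_distrib]

lemma covDerivSFF_eq (hf : IsImmersionOn G f U W) (hx : x ∈ U) (k i j : Fin m) :
    covDerivSFF G f k i j x = tensorDeriv G f (secondFF G f) k i j x
      + ∑ p, (∑ q, inducedInv G f p q x
        * inner G (f x) (secondFF G f i j x) (secondFF G f k q x)) • tangent f p x := by
  have vector_form :
      covDerivSFF G f k i j x = normalPart G f x (covDeriv G f k (secondFF G f i j) x)
      - ∑ q, inducedConn G f q k i x • secondFF G f q j x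
      - ∑ q, inducedConn G f q k j x • secondFF G f i q x := by
    funext B
    simp [covDerivSFF]
  rw [vector_form, normalPart_eq, tensorDeriv]
  simp only [tangentialCoeff_covDeriv_secondFF hf hx, neg_smul, Finset.sum_neg_distrib]
  abel

lemma inner_covDerivSFF (hf : IsImmersionOn G f U W) (hx : x ∈ U) {ν : Fin n → ℝ}
    (hν : IsNormal G f x ν) (k i j : Fin m) :
    inner G (f x) (covDerivSFF G f k i j x) ν
      = inner G (f x) (tensorDeriv G f (secondFF G f) k i j x) ν := by
  rw [covDerivSFF_eq hf hx, inner_add_left, inner_sum_tangent hν, add_zero]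

lemma inner_covDeriv_covDerivSFF (hf : IsImmersionOn G f U W) (hx : x ∈ U) {ν : Fin n → ℝ}
    (hν : IsNormal G f x ν) (l k i j : Fin m) :
    inner G (f x) (covDeriv G f l (covDerivSFF G f k i j) x) ν
      = inner G (f x) (covDeriv G f l (tensorDeriv G f (secondFF G f) k i j) x) ν
        + ∑ p, (∑ q, inducedInv G f p q x
          * inner G (f x) (secondFF G f i j x) (secondFF G f k q x))
          * inner G (f x) (secondFF G f l p x) ν := by
  have hA := smoothField_secondFF hf
  have hE := smoothField_tangent hf.toIsMapOn
  have hcoeff (p : Fin m) : ContDiffOn ℝ ∞ (fun x => ∑ q, inducedInv G f p q x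
      * inner G (f x) (secondFF G f i j x) (secondFF G f k q x)) U :=
    ContDiffOn.sum fun q _ => (contDiffOn_inducedInv hf p q).mul
      (contDiffOn_inner hf.toIsMapOn (hA i j) (hA k q))
  rw [covDeriv_congr hf.isOpen hx fun z hz => covDerivSFF_eq hf hz k i j,
    covDeriv_add hf.isOpen hx (smoothField_tensorDeriv hf hA k i j)
      (SmoothField.sum fun p _ => SmoothField.smul (hcoeff p) (hE p)),
    covDeriv_sum_smul hf.isOpen hx (fun p _ => hcoeff p) fun p _ => hE p]
  simp only [inner_add_left, inner_sum_tangent hν, inner_sum_smul_left,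
    inner_covDeriv_tangent hν, zero_add]

lemma inner_covDeriv2SFF (hf : IsImmersionOn G f U W) (hx : x ∈ U) {ν : Fin n → ℝ}
    (hν : IsNormal G f x ν) (l k i j : Fin m) :
    inner G (f x) (covDeriv2SFF G f l k i j x) ν
      = inner G (f x) (tensorDeriv2 G f (secondFF G f) l k i j x) ν
        + ∑ p, (∑ q, inducedInv G f p q x
          * inner G (f x) (secondFF G f i j x) (secondFF G f k q x))
          * inner G (f x) (secondFF G f l p x) ν := by
  have vector_form : covDeriv2SFF G f l k i j x
      = normalPart G f x (covDeriv G f l (covDerivSFF G f k i j) x)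
      - ∑ q, inducedConn G f q l k x • covDerivSFF G f q i j x
      - ∑ q, inducedConn G f q l i x • covDerivSFF G f k q j x
      - ∑ q, inducedConn G f q l j x • covDerivSFF G f k i q x := by
    funext B
    simp [covDeriv2SFF]
  rw [vector_form, tensorDeriv2_apply]
  simp only [inner_sub_left, inner_sum_smul_left, inner_normalPart hν, inner_covDerivSFF hf hx hν,
    inner_covDeriv_covDerivSFF hf hx hν]
  ring

/-! ### Traces -/

lemma sum_partialDeriv_inducedInv_smul {E : Type*} [AddCommGroup E] [Module ℝ E]
    (hf : IsImmersionOn G f U W) (hx : x ∈ U) (v : Fin m → Fin m → E) (a : Fin m) :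
    ∑ k, ∑ l, partialDeriv a (inducedInv G f k l) x • v k l
      = - ∑ k, ∑ l, inducedInv G f k l x • (∑ q, inducedConn G f q a k x • v q l
          + ∑ q, inducedConn G f q a l x • v k q) := by
  have swap_left : ∑ k, ∑ l, ∑ q, (inducedConn G f k a q x * inducedInv G f q l x) • v k l
      = ∑ k, ∑ l, ∑ q, (inducedInv G f k l x * inducedConn G f q a k x) • v q l := by
    rw [Finset.sum_comm, Finset.sum_congr rfl fun l _ => Finset.sum_comm, Finset.sum_comm]
    simp only [mul_comm]
  have swap_right : ∑ k, ∑ l, ∑ q, (inducedConn G f l a q x * inducedInv G f k q x) • v k l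
      = ∑ k, ∑ l, ∑ q, (inducedInv G f k l x * inducedConn G f q a l x) • v k q := by
    rw [Finset.sum_congr rfl fun k _ => Finset.sum_comm]
    simp only [mul_comm]
  simp only [partialDeriv_inducedInv hf hx, sub_smul, neg_smul, Finset.sum_smul,
    Finset.sum_sub_distrib, Finset.sum_neg_distrib, smul_add, Finset.smul_sum, smul_smul,
    Finset.sum_add_distrib, swap_left, swap_right]
  abel

lemma covDeriv_trace (hf : IsImmersionOn G f U W) (hx : x ∈ U)
    {T : Fin m → Fin m → Coord m → Fin n → ℝ} (hT : ∀ i j, SmoothField U (T i j)) (a : Fin m) :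
    covDeriv G f a (fun x => ∑ k, ∑ l, inducedInv G f k l x • T k l x) x
      = ∑ k, ∑ l, inducedInv G f k l x • tensorDeriv G f T a k l x := by
  have hI := contDiffOn_inducedInv hf
  rw [covDeriv_sum hf.isOpen hx fun k _ => SmoothField.sum fun l _ =>
    SmoothField.smul (hI k l) (hT k l)]
  simp only [fun k => covDeriv_sum_smul (i := a) (G := G) (f := f) (s := Finset.univ) hf.isOpen hx
    (fun l _ => hI k l) (fun l _ => hT k l), Finset.sum_add_distrib,
    sum_partialDeriv_inducedInv_smul hf hx, tensorDeriv, smul_add, smul_sub,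
    Finset.sum_sub_distrib]
  abel

lemma partialDeriv_trace (hf : IsImmersionOn G f U W) (hx : x ∈ U)
    {S : Fin m → Fin m → Coord m → ℝ} (hS : ∀ k l, DifferentiableAt ℝ (S k l) x) (a : Fin m) :
    partialDeriv a (fun x => ∑ k, ∑ l, inducedInv G f k l x * S k l x) x
      = ∑ k, ∑ l, inducedInv G f k l x * (partialDeriv a (S k l) x
        - ∑ q, inducedConn G f q a k x * S q l x - ∑ q, inducedConn G f q a l x * S k q x) := by
  have hI (k l) := differentiableAt_of_contDiffOn hf.isOpen (contDiffOn_inducedInv hf k l) hx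
  have inv_deriv := sum_partialDeriv_inducedInv_smul hf hx (fun k l => S k l x) a
  simp only [smul_eq_mul] at inv_deriv
  rw [partialDeriv_sum fun k _ => .fun_sum fun l _ => (hI k l).fun_mul (hS k l)]
  simp only [fun k => partialDeriv_sum (i := a) (s := Finset.univ)
    fun l _ => (hI k l).fun_mul (hS k l), partialDeriv_mul (hI _ _) (hS _ _),
    Finset.sum_add_distrib, inv_deriv, mul_add, mul_sub, Finset.sum_sub_distrib]
  ring

lemma meanCurvature_eq : meanCurvature G f
    = fun x => ∑ k, ∑ l, inducedInv G f k l x • secondFF G f k l x := by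
  funext x A
  simp [meanCurvature]

lemma smoothField_meanCurvature (hf : IsImmersionOn G f U W) :
    SmoothField U (meanCurvature G f) := by
  rw [meanCurvature_eq]
  exact SmoothField.sum fun k _ => SmoothField.sum fun l _ =>
    SmoothField.smul (contDiffOn_inducedInv hf k l) (smoothField_secondFF hf k l)

lemma isNormal_meanCurvature (hf : IsImmersionOn G f U W) (hx : x ∈ U) :
    IsNormal G f x (meanCurvature G f x) := by
  intro l
  simp [meanCurvature_eq, inner_sum_right, inner_smul_right,
    fun i j => isNormal_secondFF hf hx i j l]

lemma covDeriv_meanCurvature (hf : IsImmersionOn G f U W) (hx : x ∈ U) (i : Fin m) :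
    covDeriv G f i (meanCurvature G f) x
      = ∑ k, ∑ l, inducedInv G f k l x • tensorDeriv G f (secondFF G f) i k l x := by
  rw [meanCurvature_eq, covDeriv_trace hf hx (smoothField_secondFF hf)]

lemma covDeriv_covDeriv_meanCurvature (hf : IsImmersionOn G f U W) (hx : x ∈ U) (j i : Fin m) :
    covDeriv G f j (covDeriv G f i (meanCurvature G f)) x
        - ∑ q, inducedConn G f q j i x • covDeriv G f q (meanCurvature G f) x
      = ∑ k, ∑ l, inducedInv G f k l x • tensorDeriv2 G f (secondFF G f) j i k l x := by
  rw [covDeriv_congr hf.isOpen hx fun z hz => covDeriv_meanCurvature hf hz i,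
    covDeriv_trace hf hx (smoothField_tensorDeriv hf (smoothField_secondFF hf) i)]
  simp only [covDeriv_meanCurvature hf hx, tensorDeriv2, smul_sub, Finset.sum_sub_distrib,
    Finset.smul_sum, smul_smul]
  congr 1
  rw [Finset.sum_comm, Finset.sum_congr rfl fun k _ => Finset.sum_comm]
  simp only [mul_comm]

/-- The scalar product `g^{ik} g^{jl} ⟨T_{ij}, T'_{kl}⟩` of two-tensors with values in the vector
fields along `f`. -/
def tensorInner (G : Coord n → Matrix (Fin n) (Fin n) ℝ) (f : Coord m → Coord n)
    (T T' : Fin m → Fin m → Coord m → Fin n → ℝ) (x : Coord m) : ℝ :=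
  ∑ i, ∑ j, ∑ k, ∑ l, inducedInv G f i k x * inducedInv G f j l x
    * inner G (f x) (T i j x) (T' k l x)

section TensorInner

variable {T T' : Fin m → Fin m → Coord m → Fin n → ℝ}

lemma tensorInner_eq_trace_trace : tensorInner G f T T' = fun x =>
    ∑ i, ∑ k, inducedInv G f i k x *
      ∑ j, ∑ l, inducedInv G f j l x * inner G (f x) (T i j x) (T' k l x) := by
  funext x
  simp only [tensorInner, Finset.mul_sum, mul_assoc]
  exact Finset.sum_congr rfl fun i _ => Finset.sum_comm

lemma tensorInner_comm (hf : IsMapOn G f U W) (hx : x ∈ U) :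
    tensorInner G f T T' x = tensorInner G f T' T x := by
  simp only [tensorInner_eq_trace_trace]
  rw [Finset.sum_comm]
  refine Finset.sum_congr rfl fun k _ => Finset.sum_congr rfl fun i _ => ?_
  rw [Finset.sum_comm]
  simp only [inducedInv_symm hf hx i k, fun j l => inducedInv_symm hf hx j l,
    inner_comm hf.metric (hf.mapsTo hx) (T _ _ x)]

lemma tensorInner_tensorDeriv2 (k l : Fin m) :
    tensorInner G f (tensorDeriv2 G f T k l) T' x
      = tensorInner G f (tensorDeriv G f (tensorDeriv G f T l) k) T' x
        - ∑ q, inducedConn G f q k l x * tensorInner G f (tensorDeriv G f T q) T' x := by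
  simp only [tensorInner, tensorDeriv2, inner_sub_left, inner_sum_left, inner_smul_left, mul_sub,
    Finset.sum_sub_distrib, Finset.mul_sum]
  refine congrArg _ <| Eq.symm <|
    Finset.sum_comm.trans <| Finset.sum_congr rfl fun _ _ =>
    Finset.sum_comm.trans <| Finset.sum_congr rfl fun _ _ =>
    Finset.sum_comm.trans <| Finset.sum_congr rfl fun _ _ =>
    Finset.sum_comm.trans <| Finset.sum_congr rfl fun _ _ =>
    Finset.sum_congr rfl fun _ _ => mul_left_comm _ _ _

lemma contDiffOn_tensorInner (hf : IsImmersionOn G f U W) (hT : ∀ i j, SmoothField U (T i j))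
    (hT' : ∀ i j, SmoothField U (T' i j)) : ContDiffOn ℝ ∞ (tensorInner G f T T') U :=
  ContDiffOn.sum fun i _ => ContDiffOn.sum fun j _ => ContDiffOn.sum fun k _ =>
    ContDiffOn.sum fun l _ => ((contDiffOn_inducedInv hf i k).mul
      (contDiffOn_inducedInv hf j l)).mul (contDiffOn_inner hf.toIsMapOn (hT i j) (hT' k l))

lemma partialDeriv_tensorInner (hf : IsImmersionOn G f U W) (hx : x ∈ U)
    (hT : ∀ i j, SmoothField U (T i j)) (hT' : ∀ i j, SmoothField U (T' i j)) (a : Fin m) :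
    partialDeriv a (tensorInner G f T T') x
      = tensorInner G f (tensorDeriv G f T a) T' x
        + tensorInner G f T (tensorDeriv G f T' a) x := by
  have hm := hf.toIsMapOn
  have hinner (i j k l) :=
    differentiableAt_of_contDiffOn hm.isOpen (contDiffOn_inner hm (hT i j) (hT' k l)) hx
  have htrace (i k) : DifferentiableAt ℝ (fun x => ∑ j, ∑ l, inducedInv G f j l x
      * inner G (f x) (T i j x) (T' k l x)) x :=
    .fun_sum fun j _ => .fun_sum fun l _ =>
      (differentiableAt_of_contDiffOn hm.isOpen (contDiffOn_inducedInv hf j l) hx).fun_mul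
        (hinner i j k l)
  have pull (c : Fin m → ℝ) (S : Fin m → Fin m → Fin m → ℝ) :
      ∑ q, c q * ∑ j, ∑ l, inducedInv G f j l x * S q j l
        = ∑ j, ∑ l, inducedInv G f j l x * ∑ q, c q * S q j l := by
    simp only [Finset.mul_sum, mul_left_comm (inducedInv G f _ _ x)]
    rw [Finset.sum_comm, Finset.sum_congr rfl fun j _ => Finset.sum_comm]
  rw [tensorInner_eq_trace_trace, partialDeriv_trace hf hx htrace]
  simp only [tensorInner_eq_trace_trace, ← Finset.sum_add_distrib, ← mul_add]
  refine Finset.sum_congr rfl fun i _ => Finset.sum_congr rfl fun k _ => congrArg _ ?_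
  simp only [pull, partialDeriv_trace hf hx (hinner i · k ·), ← Finset.sum_sub_distrib, ← mul_sub]
  refine Finset.sum_congr rfl fun j _ => Finset.sum_congr rfl fun l _ => congrArg _ ?_
  simp only [partialDeriv_inner hm hx (hT _ _) (hT' _ _), tensorDeriv, inner_sub_left,
    inner_sub_right, inner_sum_left, inner_sum_right, inner_smul_left, inner_smul_right]
  ring

lemma laplaceBeltrami_tensorInner_self (hf : IsImmersionOn G f U W) (hx : x ∈ U)
    (hT : ∀ i j, SmoothField U (T i j)) :
    laplaceBeltrami G f (tensorInner G f T T) x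
      = 2 * ∑ k, ∑ l, inducedInv G f k l x * (tensorInner G f (tensorDeriv2 G f T k l) T x
        + tensorInner G f (tensorDeriv G f T l) (tensorDeriv G f T k) x) := by
  have hDT (l) := fun i j => smoothField_tensorDeriv hf hT l i j
  have first_deriv (l) : EqOn (partialDeriv l (tensorInner G f T T))
      (fun z => 2 * tensorInner G f (tensorDeriv G f T l) T z) U := fun z hz => by
    dsimp only
    rw [partialDeriv_tensorInner hf hz hT hT, tensorInner_comm hf.toIsMapOn hz (T := T), two_mul]
  have second_deriv (k l) : partialDeriv k (partialDeriv l (tensorInner G f T T)) x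
      = 2 * (tensorInner G f (tensorDeriv G f (tensorDeriv G f T l) k) T x
        + tensorInner G f (tensorDeriv G f T l) (tensorDeriv G f T k) x) := by
    rw [partialDeriv_congr hf.isOpen hx (first_deriv l), partialDeriv_mul
      (differentiableAt_const _) (differentiableAt_of_contDiffOn hf.isOpen
        (contDiffOn_tensorInner hf (hDT l) hT) hx), partialDeriv_const,
      partialDeriv_tensorInner hf hx (hDT l) hT, zero_mul, zero_add]
  simp only [laplaceBeltrami, second_deriv, fun q => first_deriv q hx,
    tensorInner_tensorDeriv2,
    Finset.mul_sum]
  refine Finset.sum_congr rfl fun k _ => Finset.sum_congr rfl fun l _ => ?_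
  simp only [mul_left_comm _ (2 : ℝ), ← Finset.mul_sum]
  ring

end TensorInner

end Equations

/-! ### The equation of Simons at a point where the coordinate vectors are orthonormal -/

section Simons

variable {m n r : ℕ} {G : Coord n → Matrix (Fin n) (Fin n) ℝ} {f : Coord m → Coord n}
  {U : Set (Coord m)} {W : Set (Coord n)} {x : Coord m}

lemma inner_tangent_of_eq_one (hg : inducedMetric G f x = 1) (i j : Fin m) :
    inner G (f x) (tangent f i x) (tangent f j x) = if i = j then 1 else 0 := by
  have := congrFun (congrFun hg i) j
  rwa [Matrix.one_apply] at this

lemma inducedInv_of_eq_one (hg : inducedMetric G f x = 1) (i j : Fin m) :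
    inducedInv G f i j x = if i = j then 1 else 0 := by
  rw [inducedInv, hg, inv_one, Matrix.one_apply]

lemma inducedRiemann_of_eq_one (hf : IsImmersionOn G f U W) (hx : x ∈ U)
    (hg : inducedMetric G f x = 1) (q k i j : Fin m) :
    inducedRiemann G f q k i j x
      = - curvatureOn G (f x) (tangent f k x) (tangent f i x) (tangent f j x) (tangent f q x)
        + inner G (f x) (secondFF G f i j x) (secondFF G f k q x)
        - inner G (f x) (secondFF G f k j x) (secondFF G f i q x) := by
  rw [← sum_inducedRiemann_mul hf hx]
  simp [inner_tangent_of_eq_one hg]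

lemma meanCurvature_of_eq_one (hg : inducedMetric G f x = 1) :
    meanCurvature G f x = ∑ k, secondFF G f k k x := by
  rw [meanCurvature_eq]
  simp [inducedInv_of_eq_one hg]

lemma IsNormalFrame.isNormal (hf : IsMapOn G f U W) (hx : x ∈ U) {ν : Fin r → Fin n → ℝ}
    (hν : IsNormalFrame G f x ν) (α : Fin r) : IsNormal G f x (ν α) := fun l => by
  rw [inner_comm hf.metric (hf.mapsTo hx)]
  exact hν.normal α l

lemma inner_sum_smul_of_orthonormal {ι : Type*} [Fintype ι] [DecidableEq ι] {y : Coord n}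
    {b : ι → Fin n → ℝ} (hb : ∀ c d, inner G y (b c) (b d) = if c = d then 1 else 0) (a : ι → ℝ)
    (d : ι) : inner G y (∑ c, a c • b c) (b d) = a d := by
  simp [inner_sum_left, inner_smul_left, hb]

lemma sum_inner_smul_of_orthonormal {ι : Type*} [Fintype ι] [DecidableEq ι] {y : Coord n}
    {b : ι → Fin n → ℝ} (hb : ∀ c d, inner G y (b c) (b d) = if c = d then 1 else 0)
    (hcard : Fintype.card ι = n) (v : Fin n → ℝ) : ∑ c, inner G y v (b c) • b c = v := by
  have coeff := inner_sum_smul_of_orthonormal hb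
  have hli : LinearIndependent ℝ b := by
    rw [Fintype.linearIndependent_iff]
    intro a ha d
    rw [← coeff a d, ha, inner_eq_innerₗ]
    simp
  have hspan : v ∈ Submodule.span ℝ (range b) := by
    rw [hli.span_eq_top_of_card_eq_finrank' (by simp [hcard])]
    trivial
  obtain ⟨a, rfl⟩ := (Submodule.mem_span_range_iff_exists_fun ℝ).1 hspan
  simp only [coeff]

lemma IsNormalFrame.sum_inner_smul (hmn : m + r = n) (hf : IsMapOn G f U W) (hx : x ∈ U)
    (hg : inducedMetric G f x = 1) {ν : Fin r → Fin n → ℝ} (hν : IsNormalFrame G f x ν)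
    {v : Fin n → ℝ} (hv : IsNormal G f x v) :
    v = ∑ α, MCF.inner G (f x) v (ν α) • ν α := by
  let adaptedFrame : Fin m ⊕ Fin r → Fin n → ℝ := Sum.elim (fun i => tangent f i x) ν
  have orthonormal (c d) :
      MCF.inner G (f x) (adaptedFrame c) (adaptedFrame d) = if c = d then 1 else 0 := by
    rcases c with i | α <;> rcases d with j | β
    · simpa [adaptedFrame] using inner_tangent_of_eq_one hg i j
    · simpa [adaptedFrame] using hν.isNormal hf hx β i
    · simpa [adaptedFrame] using hν.normal α j
    · simpa [adaptedFrame] using hν.orthonormal α β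
  have tangential (i) : MCF.inner G (f x) v (tangent f i x) = 0 := by
    rw [inner_comm hf.metric (hf.mapsTo hx)]
    exact hv i
  have expansion := sum_inner_smul_of_orthonormal orthonormal (by simp [hmn]) v
  simpa [Fintype.sum_sum_type, adaptedFrame, tangential] using expansion.symm

lemma IsNormalFrame.inner_eq_sum (hmn : m + r = n) (hf : IsMapOn G f U W) (hx : x ∈ U)
    (hg : inducedMetric G f x = 1) {ν : Fin r → Fin n → ℝ} (hν : IsNormalFrame G f x ν)
    {v : Fin n → ℝ} (hv : IsNormal G f x v) (w : Fin n → ℝ) :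
    MCF.inner G (f x) v w = ∑ α, MCF.inner G (f x) v (ν α) * MCF.inner G (f x) (ν α) w := by
  conv_lhs => rw [hν.sum_inner_smul hmn hf hx hg hv]
  rw [inner_sum_left]
  simp only [inner_smul_left]

lemma hCoeff_symm (hf : IsMapOn G f U W) (hx : x ∈ U) (ν : Fin r → Fin n → ℝ) (α : Fin r)
    (i j : Fin m) : hCoeff G f x ν α i j = hCoeff G f x ν α j i := by
  rw [hCoeff, secondFF_symm hf hx, ← hCoeff.eq_1]

lemma IsNormalFrame.secondFF_eq (hmn : m + r = n) (hf : IsImmersionOn G f U W) (hx : x ∈ U)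
    (hg : inducedMetric G f x = 1) {ν : Fin r → Fin n → ℝ} (hν : IsNormalFrame G f x ν)
    (i j : Fin m) : secondFF G f i j x = ∑ β, hCoeff G f x ν β i j • ν β :=
  hν.sum_inner_smul hmn hf.toIsMapOn hx hg (isNormal_secondFF hf hx i j)

lemma IsNormalFrame.inner_secondFF (hmn : m + r = n) (hf : IsImmersionOn G f U W) (hx : x ∈ U)
    (hg : inducedMetric G f x = 1) {ν : Fin r → Fin n → ℝ} (hν : IsNormalFrame G f x ν)
    (i j k l : Fin m) : MCF.inner G (f x) (secondFF G f i j x) (secondFF G f k l x)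
      = ∑ γ, hCoeff G f x ν γ i j * hCoeff G f x ν γ k l := by
  rw [hν.inner_eq_sum hmn hf.toIsMapOn hx hg (isNormal_secondFF hf hx i j)]
  refine Finset.sum_congr rfl fun γ _ => ?_
  rw [inner_comm hf.metric (hf.mapsTo hx) (ν γ)]
  rfl

lemma inner_tensorDeriv2_secondFF_trace (hf : IsImmersionOn G f U W) (hx : x ∈ U)
    {ν : Fin n → ℝ} (hν : IsNormal G f x ν) (i j k : Fin m) :
    inner G (f x) (tensorDeriv2 G f (secondFF G f) j i k k x) ν
      = inner G (f x) (tensorDeriv2 G f (secondFF G f) k k i j x) ν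
        + covDerivCurvatureOn G (f x) (tangent f k x) ν (tangent f i x) (tangent f j x)
            (tangent f k x)
        + covDerivCurvatureOn G (f x) (tangent f j x) ν (tangent f k x) (tangent f i x)
            (tangent f k x)
        + curvatureOn G (f x) (secondFF G f k k x) (tangent f j x) (tangent f i x) ν
        + 2 * curvatureOn G (f x) ν (secondFF G f i k x) (tangent f j x) (tangent f k x)
        + 2 * curvatureOn G (f x) ν (secondFF G f j k x) (tangent f i x) (tangent f k x)
        + curvatureOn G (f x) ν (tangent f k x) (secondFF G f i j x) (tangent f k x)
        + 2 * ∑ q, inducedRiemann G f q k j i x * inner G (f x) (secondFF G f k q x) ν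
        + ∑ q, inducedRiemann G f q k j k x * inner G (f x) (secondFF G f q i x) ν
        + ∑ q, inducedRiemann G f q k i k x * inner G (f x) (secondFF G f j q x) ν := by
  have hm := hf.toIsMapOn
  have hG := hf.metric
  have hy := hf.mapsTo hx
  have symm := tensorDeriv2_symm (G := G) (f := f) (T := secondFF G f) hf.isOpen hx
    fun z hz i j => secondFF_symm hm hz i j
  have swap_inner := inner_tensorDeriv2_secondFF_sub hf hx hν k k j i
  have swap_outer := congrArg (fun v => inner G (f x) v ν)
    (tensorDeriv2_sub hf hx (smoothField_secondFF hf) k j k i)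
  have swap_last := inner_tensorDeriv2_secondFF_sub hf hx hν j k i k
  have bianchi := curvatureOn_bianchi hG hy (tangent f k x) (secondFF G f j k x)
    (tangent f i x) ν
  have antisymm := curvatureOn_swap (G := G) (y := f x) (tangent f i x) (tangent f k x)
    (secondFF G f j k x) ν
  simp only [inner_sub_left, inner_neg_left, inner_sum_left, inner_smul_left,
    inner_curvatureVec] at swap_outer
  rw [← symm k k i j, secondFF_symm hm hx k j, secondFF_symm hm hx k i] at swap_inner
  rw [symm j k k i, secondFF_symm hm hx k i] at swap_outer
  rw [secondFF_symm hm hx j i] at swap_last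
  rw [covDerivCurvatureOn_reverse hG hy _ ν, covDerivCurvatureOn_reverse hG hy _ ν,
    curvatureOn_reverse hG hy ν, curvatureOn_reverse hG hy ν, curvatureOn_reverse hG hy ν]
  linarith

/-- The terms cubic in `A` of the evolution equation of `h_{αij}`, for any family `h_α` of
matrices. -/
def cubicTerms {ι κ : Type*} [Fintype ι] [Fintype κ] (h : ι → κ → κ → ℝ) (α : ι) (i j : κ) : ℝ :=
  - ∑ q, h α i q * ∑ γ, (h γ q j * ∑ k, h γ k k - ∑ k, h γ q k * h γ j k)
    - ∑ q, ∑ k, h α q k * ∑ γ, (h γ q j * h γ i k - h γ q k * h γ i j)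
    - ∑ β, ∑ k, h β i k * ∑ l, (h β l j * h α l k - h β l k * h α l j)
    - ∑ β, ∑ k, h α j k * h β i k * ∑ k, h β k k

variable (G f x) in
/-- The terms of the evolution equation of `h_{αij}` involving the curvature of the ambient
metric. -/
def curvatureTerms (ν : Fin r → Fin n → ℝ) (α : Fin r) (i j : Fin m) : ℝ :=
  let K := curvatureOn G (f x)
  let DK := covDerivCurvatureOn G (f x)
  let E : Fin m → Fin n → ℝ := fun a => tangent f a x
  let h := hCoeff G f x ν
  ∑ k, DK (E k) (ν α) (E i) (E j) (E k)
    + ∑ k, DK (E j) (ν α) (E k) (E i) (E k)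
    - 2 * ∑ l, ∑ k, K (E l) (E i) (E j) (E k) * h α l k
    + 2 * ∑ β, ∑ k, K (ν α) (ν β) (E j) (E k) * h β i k
    + 2 * ∑ β, ∑ k, K (ν α) (ν β) (E i) (E k) * h β j k
    - ∑ l, ∑ k, K (E l) (E k) (E i) (E k) * h α l j
    - ∑ l, ∑ k, K (E l) (E k) (E j) (E k) * h α l i
    + ∑ β, ∑ k, K (ν α) (E k) (ν β) (E k) * h β i j

lemma hEvolution_eq (ν dν : Fin r → Fin n → ℝ) (α : Fin r) (i j : Fin m) :
    hEvolution G f x ν dν α i j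
      = inner G (f x) (laplacianSFF G f i j x) (ν α) + curvatureTerms G f x ν α i j
        + cubicTerms (hCoeff G f x ν) α i j
        + ∑ β, hCoeff G f x ν β i j * inner G (f x) (ν β) (dν α) := by
  simp only [hEvolution, curvatureTerms, cubicTerms]
  ring

lemma cubicTerms_of_symm {ι κ : Type*} [Fintype ι] [Fintype κ] {h : ι → κ → κ → ℝ}
    (hs : ∀ α i j, h α i j = h α j i) (α : ι) (i j : κ) : cubicTerms h α i j
      = - ∑ k, ∑ q, (∑ γ, h γ i j * h γ k q) * h α k q
      + 2 * ∑ k, ∑ q, (∑ γ, h γ j i * h γ k q - ∑ γ, h γ k i * h γ j q) * h α k q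
      + ∑ k, ∑ q, (∑ γ, h γ j k * h γ k q - ∑ γ, h γ k k * h γ j q) * h α q i
      + ∑ k, ∑ q, (∑ γ, h γ i k * h γ k q - ∑ γ, h γ k k * h γ i q) * h α j q := by
  have trace_term_left : ∑ β, ∑ k, ∑ l, h α j k * h β i k * h β l l
      = ∑ k, ∑ q, ∑ γ, h γ k k * h γ i q * h α j q := by
    rw [Finset.sum_comm_cycle]
    refine Finset.sum_congr rfl fun k _ => ?_
    rw [Finset.sum_comm]
    simp only [mul_comm, mul_left_comm]
  have trace_term_right : ∑ q, ∑ γ, ∑ k, h α i q * (h γ q j * h γ k k)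
      = ∑ k, ∑ q, ∑ γ, h γ k k * h γ j q * h α q i := by
    rw [Finset.sum_comm_cycle]
    simp only [hs, mul_comm]
  have square_term_left : ∑ β, ∑ k, ∑ l, h β i k * (h β l k * h α l j)
      = ∑ k, ∑ q, ∑ γ, h γ i k * h γ k q * h α j q := by
    rw [← Finset.sum_comm_cycle]
    simp only [hs, mul_comm, mul_left_comm]
  have square_term_right : ∑ q, ∑ γ, ∑ k, h α i q * (h γ q k * h γ j k)
      = ∑ k, ∑ q, ∑ γ, h γ j k * h γ k q * h α q i := by
    rw [Finset.sum_comm_cycle]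
    simp only [hs, mul_comm]
  have sandwich_term : ∑ q, ∑ k, ∑ γ, h α q k * (h γ q j * h γ i k)
      = ∑ k, ∑ q, ∑ γ, h γ k i * h γ j q * h α k q := by
    rw [Finset.sum_comm]
    simp only [hs, mul_comm]
  have sandwich_term_comm : ∑ β, ∑ k, ∑ l, h β i k * (h β l j * h α l k)
      = ∑ k, ∑ q, ∑ γ, h γ k i * h γ j q * h α k q := by
    rw [← Finset.sum_comm_cycle]
    simp only [hs, mul_comm, mul_left_comm]
  have inner_term : ∑ q, ∑ k, ∑ γ, h α q k * (h γ q k * h γ i j)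
      = ∑ k, ∑ q, ∑ γ, h γ i j * h γ k q * h α k q := by
    simp only [mul_comm]
  simp only [cubicTerms, Finset.mul_sum, mul_sub, Finset.sum_sub_distrib, sub_mul, Finset.sum_mul]
  simp only [← Finset.mul_sum (a := (2 : ℝ)), fun γ => hs γ j i]
  rw [trace_term_left, trace_term_right, square_term_left, square_term_right, sandwich_term,
    sandwich_term_comm, inner_term]
  ring

lemma inner_laplacianSFF_of_eq_one (hf : IsImmersionOn G f U W) (hx : x ∈ U)
    (hg : inducedMetric G f x = 1) {ν : Fin n → ℝ} (hν : IsNormal G f x ν) (i j : Fin m) :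
    inner G (f x) (laplacianSFF G f i j x) ν
      = ∑ k, inner G (f x) (tensorDeriv2 G f (secondFF G f) k k i j x) ν
        + ∑ k, ∑ q, inner G (f x) (secondFF G f i j x) (secondFF G f k q x)
          * inner G (f x) (secondFF G f k q x) ν := by
  have laplacian_eq : laplacianSFF G f i j x
      = ∑ k, ∑ l, inducedInv G f k l x • covDeriv2SFF G f l k i j x := by
    funext B
    simp [laplacianSFF]
  rw [laplacian_eq]
  simp only [inducedInv_of_eq_one hg, ite_smul, one_smul, zero_smul, Finset.sum_ite_eq,
    Finset.mem_univ, if_true, inner_sum_left, inner_covDeriv2SFF hf hx hν, ite_mul, one_mul,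
    zero_mul, Finset.sum_add_distrib]

lemma inner_hessian_meanCurvature_of_eq_one (hf : IsImmersionOn G f U W) (hx : x ∈ U)
    (hg : inducedMetric G f x = 1) (ν : Fin n → ℝ) (i j : Fin m) :
    inner G (f x) (covDeriv G f j (covDeriv G f i (meanCurvature G f)) x
        - ∑ q, inducedConn G f q j i x • covDeriv G f q (meanCurvature G f) x) ν
      = ∑ k, inner G (f x) (tensorDeriv2 G f (secondFF G f) j i k k x) ν := by
  rw [covDeriv_covDeriv_meanCurvature hf hx]
  simp [inducedInv_of_eq_one hg, inner_sum_left]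

lemma curvatureOn_meanCurvature_of_eq_one (hg : inducedMetric G f x = 1) (v w z : Fin n → ℝ) :
    curvatureOn G (f x) (meanCurvature G f x) v w z
      = ∑ k, curvatureOn G (f x) (secondFF G f k k x) v w z := by
  simp only [meanCurvature_of_eq_one hg, curvatureOn_eq_innerₗ, map_sum, LinearMap.sum_apply]

lemma IsNormalFrame.curvatureOn_secondFF₂ (hmn : m + r = n) (hf : IsImmersionOn G f U W)
    (hx : x ∈ U) (hg : inducedMetric G f x = 1) {ν : Fin r → Fin n → ℝ}
    (hν : IsNormalFrame G f x ν) (i j : Fin m) (u w z : Fin n → ℝ) :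
    curvatureOn G (f x) u (secondFF G f i j x) w z
      = ∑ β, curvatureOn G (f x) u (ν β) w z * hCoeff G f x ν β i j := by
  simp only [hν.secondFF_eq hmn hf hx hg i j, curvatureOn_eq_innerₗ, map_sum, map_smul,
    LinearMap.sum_apply, LinearMap.smul_apply, smul_eq_mul, mul_comm]

lemma IsNormalFrame.curvatureOn_secondFF₃ (hmn : m + r = n) (hf : IsImmersionOn G f U W)
    (hx : x ∈ U) (hg : inducedMetric G f x = 1) {ν : Fin r → Fin n → ℝ}
    (hν : IsNormalFrame G f x ν) (i j : Fin m) (u v z : Fin n → ℝ) :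
    curvatureOn G (f x) u v (secondFF G f i j x) z
      = ∑ β, curvatureOn G (f x) u v (ν β) z * hCoeff G f x ν β i j := by
  simp only [hν.secondFF_eq hmn hf hx hg i j, curvatureOn_eq_innerₗ, map_sum, map_smul,
    LinearMap.sum_apply, LinearMap.smul_apply, smul_eq_mul, mul_comm]

lemma sum_curvatureOn_ricci (hG : IsMetricOn G W) (hy : f x ∈ W) (a : Fin m → ℝ) (i : Fin m) :
    ∑ k, ∑ q, curvatureOn G (f x) (tangent f k x) (tangent f i x) (tangent f k x)
        (tangent f q x) * a q
      = ∑ l, ∑ k, curvatureOn G (f x) (tangent f l x) (tangent f k x) (tangent f i x)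
        (tangent f k x) * a l := by
  rw [Finset.sum_comm]
  simp only [curvatureOn_reverse hG hy (tangent f _ x) (tangent f i x)]

lemma IsNormalFrame.curvatureTerms_eq (hmn : m + r = n) (hf : IsImmersionOn G f U W) (hx : x ∈ U)
    (hg : inducedMetric G f x = 1) {ν : Fin r → Fin n → ℝ} (hν : IsNormalFrame G f x ν)
    (α : Fin r) (i j : Fin m) :
    curvatureTerms G f x ν α i j
      = ∑ k, covDerivCurvatureOn G (f x) (tangent f k x) (ν α) (tangent f i x) (tangent f j x)
          (tangent f k x)
        + ∑ k, covDerivCurvatureOn G (f x) (tangent f j x) (ν α) (tangent f k x) (tangent f i x)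
          (tangent f k x)
        - 2 * ∑ k, ∑ q, curvatureOn G (f x) (tangent f k x) (tangent f j x) (tangent f i x)
          (tangent f q x) * hCoeff G f x ν α k q
        + 2 * ∑ k, curvatureOn G (f x) (ν α) (secondFF G f i k x) (tangent f j x) (tangent f k x)
        + 2 * ∑ k, curvatureOn G (f x) (ν α) (secondFF G f j k x) (tangent f i x) (tangent f k x)
        - ∑ k, ∑ q, curvatureOn G (f x) (tangent f k x) (tangent f i x) (tangent f k x)
          (tangent f q x) * hCoeff G f x ν α j q
        - ∑ k, ∑ q, curvatureOn G (f x) (tangent f k x) (tangent f j x) (tangent f k x)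
          (tangent f q x) * hCoeff G f x ν α q i
        + ∑ k, curvatureOn G (f x) (ν α) (tangent f k x) (secondFF G f i j x)
          (tangent f k x) := by
  have hG := hf.metric
  have hy := hf.mapsTo hx
  have sum_curvature_mul : ∑ k, ∑ q, curvatureOn G (f x) (tangent f k x) (tangent f j x)
        (tangent f i x) (tangent f q x) * hCoeff G f x ν α k q
      = ∑ l, ∑ k, curvatureOn G (f x) (tangent f l x) (tangent f i x) (tangent f j x)
        (tangent f k x) * hCoeff G f x ν α l k := by
    rw [Finset.sum_comm]
    simp only [curvatureOn_reverse hG hy (tangent f _ x) (tangent f j x),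
      hCoeff_symm hf.toIsMapOn hx ν α]
  rw [sum_curvature_mul, sum_curvatureOn_ricci hG hy, sum_curvatureOn_ricci hG hy]
  simp only [curvatureTerms, hν.curvatureOn_secondFF₂ hmn hf hx hg,
    hν.curvatureOn_secondFF₃ hmn hf hx hg, hCoeff_symm hf.toIsMapOn hx ν α j]
  simp only [Finset.sum_comm (γ := Fin m) (α := Fin r)]

lemma simons_identity (hmn : m + r = n) (hf : IsImmersionOn G f U W) (hx : x ∈ U)
    (hg : inducedMetric G f x = 1) {ν : Fin r → Fin n → ℝ} (hν : IsNormalFrame G f x ν)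
    (α : Fin r) (i j : Fin m) :
    inner G (f x) (covDeriv G f j (covDeriv G f i (meanCurvature G f)) x
        - ∑ q, inducedConn G f q j i x • covDeriv G f q (meanCurvature G f) x) (ν α)
      - curvatureOn G (f x) (meanCurvature G f x) (tangent f j x) (tangent f i x) (ν α)
    = inner G (f x) (laplacianSFF G f i j x) (ν α) + curvatureTerms G f x ν α i j
      + cubicTerms (hCoeff G f x ν) α i j := by
  have hα := hν.isNormal hf.toIsMapOn hx α
  rw [inner_hessian_meanCurvature_of_eq_one hf hx hg, curvatureOn_meanCurvature_of_eq_one hg,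
    inner_laplacianSFF_of_eq_one hf hx hg hα, hν.curvatureTerms_eq hmn hf hx hg,
    cubicTerms_of_symm (hCoeff_symm hf.toIsMapOn hx ν)]
  simp only [inner_tensorDeriv2_secondFF_trace hf hx hα, inducedRiemann_of_eq_one hf hx hg,
    ← hCoeff.eq_1, hν.inner_secondFF hmn hf hx hg, sub_mul, add_mul, neg_mul,
    Finset.sum_add_distrib, Finset.sum_sub_distrib, Finset.sum_neg_distrib,
    ← Finset.mul_sum (a := (2 : ℝ))]
  linarith

end Simons

section Quartic

open scoped Matrix

variable {ι κ : Type*} [Fintype ι] [Fintype κ]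

lemma of_cubicTerms (h : ι → Matrix κ κ ℝ) (hs : ∀ α, (h α).IsSymm) (α : ι) :
    Matrix.of (cubicTerms h α)
      = ∑ γ, (h α * h γ * h γ + h γ * h γ * h α - (2 : ℝ) • (h γ * h α * h γ)
        + Matrix.trace (h α * h γ) • h γ - Matrix.trace (h γ) • (h α * h γ + h γ * h α)) := by
  have transposed : Matrix.of (cubicTerms h α)
      = - (h α * ∑ γ, (Matrix.trace (h γ) • h γ - h γ * (h γ)ᵀ))
        - ∑ γ, (h γ * ((h α)ᵀ * h γ) - Matrix.trace (h α * (h γ)ᵀ) • h γ)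
        - ∑ γ, h γ * ((h α)ᵀ * h γ - (h γ)ᵀ * h α)
        - ∑ γ, Matrix.trace (h γ) • (h γ * (h α)ᵀ) := by
    ext i j
    have sum_outermost (a : κ → κ → ι → ℝ) :
        ∑ q, ∑ k, ∑ γ, a q k γ = ∑ γ, ∑ q, ∑ k, a q k γ := Finset.sum_comm_cycle
    have sandwich_term (γ : ι) : (h γ * ((h α)ᵀ * h γ)) i j
        = ∑ q, ∑ k, h α q k * (h γ q j * h γ i k) := by
      simp only [Matrix.mul_apply, Matrix.transpose_apply, Finset.mul_sum]
      rw [Finset.sum_comm]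
      simp only [mul_comm, mul_left_comm]
    simp only [cubicTerms, Matrix.of_apply, Matrix.sub_apply, Matrix.neg_apply, Matrix.sum_apply,
      Matrix.smul_apply, sandwich_term, smul_eq_mul]
    simp only [Matrix.mul_apply, Matrix.sum_apply, Matrix.sub_apply, Matrix.smul_apply,
      smul_eq_mul, Matrix.transpose_apply, Matrix.trace, Matrix.diag_apply,
      Finset.mul_sum, mul_sub, Finset.sum_sub_distrib, sum_outermost, mul_comm, mul_left_comm]
  simp only [transposed, fun γ => (hs γ).eq, Finset.mul_sum, mul_sub, Finset.sum_sub_distrib,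
    Finset.sum_add_distrib, two_smul, smul_add, Matrix.mul_assoc, Matrix.mul_smul]
  abel

lemma sum_mul_eq_trace (A B : Matrix κ κ ℝ) :
    ∑ i, ∑ j, A i j * B i j = Matrix.trace (A * Bᵀ) := rfl

lemma sum_cubicTerms_mul (h : ι → Matrix κ κ ℝ) (hs : ∀ α, (h α).IsSymm) (α : ι) :
    ∑ i, ∑ j, cubicTerms h α i j * h α i j
      = ∑ γ, (2 * Matrix.trace (h α * h α * h γ * h γ) - 2 * Matrix.trace (h α * h γ * h α * h γ)
        + Matrix.trace (h α * h γ) ^ 2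
        - 2 * (Matrix.trace (h γ) * Matrix.trace (h γ * h α * h α))) := by
  have trace_form := sum_mul_eq_trace (Matrix.of (cubicTerms h α)) (h α)
  simp only [Matrix.of_apply] at trace_form
  rw [trace_form, of_cubicTerms h hs, (hs α).eq, Matrix.sum_mul, Matrix.trace_sum]
  refine Finset.sum_congr rfl fun γ _ => ?_
  have trace_αγγα : Matrix.trace (h α * h γ * h γ * h α)
      = Matrix.trace (h α * h α * h γ * h γ) := by
    rw [Matrix.trace_mul_comm]
    simp only [Matrix.mul_assoc]
  have trace_γγαα : Matrix.trace (h γ * h γ * h α * h α)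
      = Matrix.trace (h α * h α * h γ * h γ) := by
    rw [Matrix.mul_assoc, Matrix.trace_mul_comm]
    simp only [Matrix.mul_assoc]
  have trace_γαγα : Matrix.trace (h γ * h α * h γ * h α)
      = Matrix.trace (h α * h γ * h α * h γ) := by
    rw [Matrix.trace_mul_comm]
    simp only [Matrix.mul_assoc]
  have trace_αγα : Matrix.trace (h α * h γ * h α) = Matrix.trace (h γ * h α * h α) := by
    rw [Matrix.mul_assoc, Matrix.trace_mul_comm]
  simp only [Matrix.add_mul, Matrix.sub_mul, Matrix.smul_mul, Matrix.trace_add,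
    Matrix.trace_sub, Matrix.trace_smul, smul_eq_mul, trace_αγγα, trace_γγαα,
    trace_γαγα, trace_αγα, Matrix.trace_mul_comm (h γ) (h α)]
  ring

lemma sum_sq_commutator (A B : Matrix κ κ ℝ) (hA : A.IsSymm) (hB : B.IsSymm) :
    ∑ i, ∑ q, (∑ k, (A i k * B q k - A q k * B i k)) ^ 2
      = 2 * Matrix.trace (A * A * B * B) - 2 * Matrix.trace (A * B * A * B) := by
  have entry (i q) : ∑ k, (A i k * B q k - A q k * B i k) = (A * B - B * A) i q := by
    nth_rw 2 [← hA.eq]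
    nth_rw 1 [← hB.eq]
    simp only [Matrix.sub_apply, Matrix.mul_apply, Matrix.transpose_apply,
      Finset.sum_sub_distrib, mul_comm]
  simp only [entry, pow_two, sum_mul_eq_trace]
  rw [Matrix.transpose_sub, Matrix.transpose_mul, Matrix.transpose_mul, hA.eq, hB.eq]
  have trace_abba : Matrix.trace (A * (B * (B * A))) = Matrix.trace (A * (A * (B * B))) := by
    rw [← Matrix.mul_assoc, ← Matrix.mul_assoc, Matrix.trace_mul_comm]
    simp only [Matrix.mul_assoc]
  have trace_baab : Matrix.trace (B * (A * (A * B))) = Matrix.trace (A * (A * (B * B))) := by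
    rw [Matrix.trace_mul_comm]
    simp only [Matrix.mul_assoc]
  have trace_baba : Matrix.trace (B * (A * (B * A))) = Matrix.trace (A * (B * (A * B))) := by
    rw [Matrix.trace_mul_comm]
    simp only [Matrix.mul_assoc]
  simp only [Matrix.mul_sub, Matrix.sub_mul, Matrix.trace_sub, Matrix.mul_assoc,
    trace_abba, trace_baab, trace_baba]
  ring

lemma sum_sq_sum_mul (h : ι → Matrix κ κ ℝ) (hs : ∀ α, (h α).IsSymm) :
    ∑ i, ∑ j, ∑ q, ∑ k, (∑ α, h α i j * h α q k) ^ 2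
      = ∑ α, ∑ γ, Matrix.trace (h α * h γ) ^ 2 := by
  have trace_eq (α γ : ι) : Matrix.trace (h α * h γ) = ∑ i, ∑ j, h α i j * h γ i j := by
    rw [sum_mul_eq_trace, (hs γ).eq]
  simp only [trace_eq, pow_two, Finset.mul_sum,
    Finset.sum_comm (s := (Finset.univ : Finset κ)) (t := (Finset.univ : Finset ι)),
    mul_comm, mul_left_comm]
  exact Finset.sum_congr rfl fun α _ => Finset.sum_congr rfl fun γ _ =>
    Finset.sum_congr rfl fun i _ => Finset.sum_comm_cycle.symm

lemma sum_trace_mul (h : ι → Matrix κ κ ℝ) (hs : ∀ α, (h α).IsSymm) :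
    ∑ i, ∑ j, ∑ k, (∑ β, h β i k * ∑ l, h β l l) * (∑ α, h α i j * h α k j)
      = ∑ α, ∑ γ, Matrix.trace (h γ) * Matrix.trace (h γ * h α * h α) := by
  have trace_eq (α γ : ι) : Matrix.trace (h γ * h α * h α)
      = ∑ i, ∑ j, ∑ k, h γ i k * (h α i j * h α k j) := by
    trans Matrix.trace (h γ * (h α * (h α)ᵀ)ᵀ)
    · rw [Matrix.transpose_mul, Matrix.transpose_transpose, (hs α).eq, Matrix.mul_assoc]
    · rw [← sum_mul_eq_trace]
      simp only [Matrix.mul_apply, Matrix.transpose_apply, Finset.mul_sum]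
      exact Finset.sum_congr rfl fun _ _ => Finset.sum_comm
  simp only [trace_eq]
  simp only [Matrix.trace, Matrix.diag_apply, Finset.sum_mul, Finset.mul_sum,
    Finset.sum_comm (s := (Finset.univ : Finset κ)) (t := (Finset.univ : Finset ι))]
  simp only [mul_comm, mul_left_comm]

lemma quartic_terms (h : ι → Matrix κ κ ℝ) (hs : ∀ α, (h α).IsSymm) :
    4 * ∑ i, ∑ j, ∑ k, (∑ β, h β i k * ∑ l, h β l l) * (∑ α, h α i j * h α k j)
      + 2 * ∑ α, ∑ i, ∑ j, cubicTerms h α i j * h α i j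
    = 2 * ∑ α, ∑ γ, ∑ i, ∑ q, (∑ k, (h α i k * h γ q k - h α q k * h γ i k)) ^ 2
      + 2 * ∑ i, ∑ j, ∑ q, ∑ k, (∑ α, h α i j * h α q k) ^ 2 := by
  simp only [sum_trace_mul h hs, sum_cubicTerms_mul h hs, sum_sq_sum_mul h hs,
    fun α γ => sum_sq_commutator (h α) (h γ) (hs α) (hs γ)]
  simp only [Finset.sum_add_distrib, Finset.sum_sub_distrib, ← Finset.mul_sum]
  ring

end Quartic

/-! ### The Laplacian of the squared norm of the second fundamental form -/

section NormSq

variable {m n r : ℕ} {G : Coord n → Matrix (Fin n) (Fin n) ℝ} {f : Coord m → Coord n}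
  {U : Set (Coord m)} {W : Set (Coord n)} {x : Coord m}

lemma tensorInner_of_eq_one (hg : inducedMetric G f x = 1)
    (T T' : Fin m → Fin m → Coord m → Fin n → ℝ) :
    tensorInner G f T T' x = ∑ i, ∑ j, inner G (f x) (T i j x) (T' i j x) := by
  simp [tensorInner, inducedInv_of_eq_one hg, ite_mul]

lemma laplaceBeltrami_normSqSFF (hf : IsImmersionOn G f U W) (hx : x ∈ U)
    (hg : inducedMetric G f x = 1) :
    laplaceBeltrami G f (normSqSFF G f) x
      = 2 * ∑ k, (∑ i, ∑ j, inner G (f x) (tensorDeriv2 G f (secondFF G f) k k i j x)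
            (secondFF G f i j x)
        + ∑ i, ∑ j, inner G (f x) (tensorDeriv G f (secondFF G f) k i j x)
            (tensorDeriv G f (secondFF G f) k i j x)) := by
  rw [show normSqSFF G f = tensorInner G f (secondFF G f) (secondFF G f) from rfl,
    laplaceBeltrami_tensorInner_self hf hx (smoothField_secondFF hf)]
  simp only [inducedInv_of_eq_one hg, tensorInner_of_eq_one hg, ite_mul, one_mul, zero_mul,
    Finset.sum_ite_eq, Finset.mem_univ, if_true]

lemma inner_covDerivSFF_self_of_eq_one (hf : IsImmersionOn G f U W) (hx : x ∈ U)
    (hg : inducedMetric G f x = 1) (k i j : Fin m) :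
    inner G (f x) (covDerivSFF G f k i j x) (covDerivSFF G f k i j x)
      = inner G (f x) (tensorDeriv G f (secondFF G f) k i j x)
          (tensorDeriv G f (secondFF G f) k i j x)
        - ∑ p, inner G (f x) (secondFF G f i j x) (secondFF G f k p x) ^ 2 := by
  simp only [covDerivSFF_eq hf hx, inducedInv_of_eq_one hg, ite_mul, one_mul, zero_mul,
    Finset.sum_ite_eq, Finset.mem_univ, if_true, inner_add_left, inner_add_right, inner_sum_left,
    inner_sum_right, inner_smul_left, inner_smul_right, inner_tensorDeriv_secondFF_tangent hf hx,
    inner_comm hf.metric (hf.mapsTo hx) (tangent f _ x) (tensorDeriv G f _ _ _ _ x),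
    inner_tangent_of_eq_one hg, mul_ite, mul_one, mul_zero, Finset.sum_ite_eq', mul_neg,
    Finset.sum_neg_distrib, neg_add_cancel, Finset.sum_const_zero, add_zero, pow_two]
  ring

lemma normSqCovDerivSFF_of_eq_one (hf : IsImmersionOn G f U W) (hx : x ∈ U)
    (hg : inducedMetric G f x = 1) :
    normSqCovDerivSFF G f x = ∑ k, ∑ i, ∑ j,
      (inner G (f x) (tensorDeriv G f (secondFF G f) k i j x)
          (tensorDeriv G f (secondFF G f) k i j x)
        - ∑ p, inner G (f x) (secondFF G f i j x) (secondFF G f k p x) ^ 2) := by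
  simp only [normSqCovDerivSFF, inducedInv_of_eq_one hg, ite_mul, one_mul, zero_mul,
    mul_ite, mul_one, mul_zero, Finset.sum_ite_eq, Finset.mem_univ, if_true,
    inner_covDerivSFF_self_of_eq_one hf hx hg]

lemma IsNormalFrame.sum_inner_laplacianSFF_mul_hCoeff (hmn : m + r = n)
    (hf : IsImmersionOn G f U W) (hx : x ∈ U) (hg : inducedMetric G f x = 1)
    {ν : Fin r → Fin n → ℝ} (hν : IsNormalFrame G f x ν) (i j : Fin m) :
    ∑ α, inner G (f x) (laplacianSFF G f i j x) (ν α) * hCoeff G f x ν α i j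
      = inner G (f x) (laplacianSFF G f i j x) (secondFF G f i j x) := by
  have hcomm := inner_comm hf.metric (hf.mapsTo hx)
  rw [hcomm, hν.inner_eq_sum hmn hf.toIsMapOn hx hg (isNormal_secondFF hf hx i j)]
  simp only [hCoeff, hcomm (laplacianSFF G f i j x), mul_comm]

/- The Laplacian for the normal connection and the one for the ambient connection differ on `A` by
the same quadratic terms as `|∇A|²` does from its ambient analogue, with the opposite sign. -/
lemma laplaceBeltrami_sub_normSqCovDerivSFF (hmn : m + r = n) (hf : IsImmersionOn G f U W)
    (hx : x ∈ U) (hg : inducedMetric G f x = 1) {ν : Fin r → Fin n → ℝ}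
    (hν : IsNormalFrame G f x ν) :
    laplaceBeltrami G f (normSqSFF G f) x - 2 * normSqCovDerivSFF G f x
      = 2 * ∑ α, ∑ i, ∑ j, inner G (f x) (laplacianSFF G f i j x) (ν α)
        * hCoeff G f x ν α i j := by
  have hcomm := inner_comm hf.metric (hf.mapsTo hx)
  have inner_laplacianSFF (i j) : inner G (f x) (laplacianSFF G f i j x) (secondFF G f i j x)
      = ∑ k, (inner G (f x) (tensorDeriv2 G f (secondFF G f) k k i j x) (secondFF G f i j x)
        + ∑ p, inner G (f x) (secondFF G f i j x) (secondFF G f k p x) ^ 2) := by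
    rw [inner_laplacianSFF_of_eq_one hf hx hg (isNormal_secondFF hf hx i j),
      Finset.sum_add_distrib]
    simp only [hcomm (secondFF G f _ _ x) (secondFF G f i j x), pow_two]
  rw [← Finset.sum_comm_cycle]
  simp only [hν.sum_inner_laplacianSFF_mul_hCoeff hmn hf hx hg, inner_laplacianSFF]
  rw [Finset.sum_comm_cycle, laplaceBeltrami_normSqSFF hf hx hg,
    normSqCovDerivSFF_of_eq_one hf hx hg]
  simp only [Finset.sum_add_distrib, Finset.sum_sub_distrib]
  ring

lemma sum_mul_hCoeff_swap (hf : IsMapOn G f U W) (hx : x ∈ U) (ν : Fin r → Fin n → ℝ)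
    (a : Fin r → Fin m → Fin m → ℝ) :
    ∑ α, ∑ i, ∑ j, a α j i * hCoeff G f x ν α i j
      = ∑ α, ∑ i, ∑ j, a α i j * hCoeff G f x ν α i j := by
  refine Finset.sum_congr rfl fun α _ => ?_
  rw [Finset.sum_comm]
  simp only [hCoeff_symm hf hx ν α]

lemma normSqEvolution_eq_curvatureTerms (hf : IsMapOn G f U W) (hx : x ∈ U)
    (ν : Fin r → Fin n → ℝ) :
    normSqEvolution G f x ν
      = laplaceBeltrami G f (normSqSFF G f) x - 2 * normSqCovDerivSFF G f x
        + 2 * ∑ α, ∑ i, ∑ j, curvatureTerms G f x ν α i j * hCoeff G f x ν α i j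
        + 2 * ∑ α, ∑ γ, ∑ i, ∑ q, (∑ k, (hCoeff G f x ν α i k * hCoeff G f x ν γ q k
            - hCoeff G f x ν α q k * hCoeff G f x ν γ i k)) ^ 2
        + 2 * ∑ i, ∑ j, ∑ q, ∑ k, (∑ α, hCoeff G f x ν α i j * hCoeff G f x ν α q k) ^ 2 := by
  have normal_swap := sum_mul_hCoeff_swap hf hx ν fun α i j => ∑ β, ∑ k,
    curvatureOn G (f x) (ν α) (ν β) (tangent f j x) (tangent f k x) * hCoeff G f x ν β i k
  have ricci_swap := sum_mul_hCoeff_swap hf hx ν fun α i j => ∑ l, ∑ k,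
    curvatureOn G (f x) (tangent f l x) (tangent f k x) (tangent f i x) (tangent f k x)
      * hCoeff G f x ν α l j
  simp only [normSqEvolution, curvatureTerms, add_mul, sub_mul, mul_assoc (2 : ℝ),
    Finset.sum_add_distrib, Finset.sum_sub_distrib, ← Finset.mul_sum (a := (2 : ℝ)),
    Finset.sum_mul] at normal_swap ricci_swap ⊢
  linarith

lemma normSqEvolution_eq (hmn : m + r = n) (hf : IsImmersionOn G f U W) (hx : x ∈ U)
    (hg : inducedMetric G f x = 1) {ν : Fin r → Fin n → ℝ} (hν : IsNormalFrame G f x ν) :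
    normSqEvolution G f x ν
      = 4 * ∑ i, ∑ j, ∑ k, (∑ β, hCoeff G f x ν β i k * ∑ l, hCoeff G f x ν β l l)
          * (∑ α, hCoeff G f x ν α i j * hCoeff G f x ν α k j)
        + 2 * ∑ α, ∑ i, ∑ j, (inner G (f x) (laplacianSFF G f i j x) (ν α)
            + curvatureTerms G f x ν α i j + cubicTerms (hCoeff G f x ν) α i j)
          * hCoeff G f x ν α i j := by
  have quartic := quartic_terms (hCoeff G f x ν) fun α => Matrix.IsSymm.ext fun i j =>
    hCoeff_symm hf.toIsMapOn hx ν α j i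
  rw [normSqEvolution_eq_curvatureTerms hf.toIsMapOn hx,
    laplaceBeltrami_sub_normSqCovDerivSFF hmn hf hx hg hν]
  simp only [add_mul, Finset.sum_add_distrib] at quartic ⊢
  linarith

end NormSq

/-! ### Time derivatives -/

section SpaceTime

variable {m : ℕ} {U : Set (Coord m)} {J : Set ℝ} {x : Coord m} {t : ℝ}

lemma partialDeriv_eq_of_hasFDerivWithinAt_prod {w : Coord m × ℝ → ℝ} {L : Coord m × ℝ →L[ℝ] ℝ}
    (hw : HasFDerivWithinAt w L (U ×ˢ J) (x, t)) (hU : IsOpen U) (hx : x ∈ U) (ht : t ∈ J)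
    (i : Fin m) : partialDeriv i (fun z => w (z, t)) x = L (EuclideanSpace.single i 1, 0) := by
  have hslice : HasFDerivWithinAt (fun z => w (z, t)) (L.comp (.inl ℝ (Coord m) ℝ)) U x :=
    hw.comp x (hasFDerivAt_prodMk_left x t).hasFDerivWithinAt fun _ hz => mk_mem_prod hz ht
  simp [partialDeriv, (hslice.hasFDerivAt (hU.mem_nhds hx)).fderiv]

lemma hasDerivWithinAt_of_hasFDerivWithinAt_prod {w : Coord m × ℝ → ℝ} {L : Coord m × ℝ →L[ℝ] ℝ}
    (hw : HasFDerivWithinAt w L (U ×ˢ J) (x, t)) (hx : x ∈ U) :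
    HasDerivWithinAt (fun s => w (x, s)) (L (0, 1)) J t :=
  hw.comp_hasDerivWithinAt t ((hasDerivAt_const t x).prodMk (hasDerivAt_id t)).hasDerivWithinAt
    fun _ hs => ⟨hx, hs⟩

variable {u : ℝ → Coord m → ℝ}

lemma partialDeriv_eq_fderivWithin_prod (hU : IsOpen U)
    (hu : ContDiffOn ℝ ∞ (fun q : Coord m × ℝ => u q.2 q.1) (U ×ˢ J)) (i : Fin m) :
    EqOn (fun q => partialDeriv i (u q.2) q.1) (fun q => fderivWithin ℝ
      (fun q : Coord m × ℝ => u q.2 q.1) (U ×ˢ J) q (EuclideanSpace.single i 1, 0)) (U ×ˢ J) :=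
  fun q hq => partialDeriv_eq_of_hasFDerivWithinAt_prod
    (hu.differentiableOn (by simp) q hq).hasFDerivWithinAt hU hq.1 hq.2 i

lemma contDiffOn_partialDeriv_prod (hU : IsOpen U) (hJ : UniqueDiffOn ℝ J)
    (hu : ContDiffOn ℝ ∞ (fun q : Coord m × ℝ => u q.2 q.1) (U ×ˢ J)) (i : Fin m) :
    ContDiffOn ℝ ∞ (fun q : Coord m × ℝ => partialDeriv i (u q.2) q.1) (U ×ˢ J) :=
  ((hu.fderivWithin (hU.uniqueDiffOn.prod hJ) (by simp)).clm_apply contDiffOn_const).congr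
    (partialDeriv_eq_fderivWithin_prod hU hu i)

lemma hasDerivWithinAt_partialDeriv (hU : IsOpen U) (hJ : UniqueDiffOn ℝ J)
    (hJc : J ⊆ closure (interior J))
    (hu : ContDiffOn ℝ ∞ (fun q : Coord m × ℝ => u q.2 q.1) (U ×ˢ J)) (ht : t ∈ J)
    {v : Coord m → ℝ} (hv : ∀ x ∈ U, HasDerivWithinAt (fun s => u s x) (v x) J t) (hx : x ∈ U)
    (i : Fin m) : HasDerivWithinAt (fun s => partialDeriv i (u s) x) (partialDeriv i v x) J t := by
  have hS : UniqueDiffOn ℝ (U ×ˢ J) := hU.uniqueDiffOn.prod hJ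
  have hmem : (x, t) ∈ U ×ˢ J := ⟨hx, ht⟩
  set D := fderivWithin ℝ (fun q : Coord m × ℝ => u q.2 q.1) (U ×ˢ J)
  have hD : DifferentiableOn ℝ D (U ×ˢ J) :=
    (hu.fderivWithin (m := ∞) hS (by simp)).differentiableOn (by simp)
  have hD_apply (w : Coord m × ℝ) : HasFDerivWithinAt (fun q => D q w)
      ((ContinuousLinearMap.apply ℝ ℝ w).comp (fderivWithin ℝ D (U ×ˢ J) (x, t))) (U ×ˢ J)
      (x, t) :=
    (ContinuousLinearMap.apply ℝ ℝ w).hasFDerivAt.comp_hasFDerivWithinAt (x, t)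
      (hD _ hmem).hasFDerivWithinAt
  have velocity_eq : EqOn v (fun z => D (z, t) (0, 1)) U := fun z hz =>
    (hJ t ht).eq_deriv _ (hv z hz) (hasDerivWithinAt_of_hasFDerivWithinAt_prod
      (hu.differentiableOn (by simp) (z, t) ⟨hz, ht⟩).hasFDerivWithinAt hz)
  have hclosure : (x, t) ∈ closure (interior (U ×ˢ J)) := by
    rw [interior_prod_eq, closure_prod_eq, hU.interior_eq]
    exact ⟨subset_closure hx, hJc ht⟩
  have hsymm := (hu (x, t) hmem).isSymmSndFDerivWithinAt
    (by simpa using (WithTop.coe_le_coe.2 le_top : ((2 : ℕ∞) : WithTop ℕ∞) ≤ ∞)) hS hclosure hmem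
  have hpartial : partialDeriv i v x
      = fderivWithin ℝ D (U ×ˢ J) (x, t) (0, 1) (EuclideanSpace.single i 1, 0) := by
    rw [partialDeriv_congr hU hx velocity_eq, hsymm.eq]
    exact partialDeriv_eq_of_hasFDerivWithinAt_prod (hD_apply (0, 1)) hU hx ht i
  rw [hpartial]
  exact (hasDerivWithinAt_of_hasFDerivWithinAt_prod (hD_apply _) hx).congr
    (fun s hs => partialDeriv_eq_fderivWithin_prod hU hu i (x := (x, s)) ⟨hx, hs⟩)
    (partialDeriv_eq_fderivWithin_prod hU hu i hmem)

end SpaceTime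

section CovariantTime

variable {n : ℕ} {G : Coord n → Matrix (Fin n) (Fin n) ℝ} {J : Set ℝ} {t : ℝ} {c : ℝ → Coord n}
  {c' : Fin n → ℝ}

lemma hasCovDerivWithinAt_covDerivTime {V : ℝ → Fin n → ℝ}
    (hV : ∀ A, DifferentiableWithinAt ℝ (fun s => V s A) J t) :
    HasCovDerivWithinAt G c c' V (covDerivTime G J (c t) c' V t) J t :=
  fun A => (hV A).hasDerivWithinAt.congr_deriv (by simp [covDerivTime, christoffelOn_apply])

lemma HasCovDerivWithinAt.mono {V : ℝ → Fin n → ℝ} {V' : Fin n → ℝ} {I : Set ℝ}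
    (hV : HasCovDerivWithinAt G c c' V V' J t) (hIJ : I ⊆ J) :
    HasCovDerivWithinAt G c c' V V' I t :=
  fun A => (hV A).mono hIJ

lemma HasCovDerivWithinAt.sub {V X : ℝ → Fin n → ℝ} {V' X' : Fin n → ℝ}
    (hV : HasCovDerivWithinAt G c c' V V' J t) (hX : HasCovDerivWithinAt G c c' X X' J t) :
    HasCovDerivWithinAt G c c' (fun s => V s - X s) (V' - X') J t := by
  intro A
  refine ((hV A).fun_sub (hX A)).congr_deriv ?_
  simp only [map_sub, Pi.sub_apply]
  ring

lemma HasCovDerivWithinAt.sum_smul {ι : Type*} {s : Finset ι} {V : ι → ℝ → Fin n → ℝ}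
    {V' : ι → Fin n → ℝ} {a : ι → ℝ → ℝ} {a' : ι → ℝ}
    (ha : ∀ k ∈ s, HasDerivWithinAt (a k) (a' k) J t)
    (hV : ∀ k ∈ s, HasCovDerivWithinAt G c c' (V k) (V' k) J t) :
    HasCovDerivWithinAt G c c' (fun τ => ∑ k ∈ s, a k τ • V k τ)
      (∑ k ∈ s, a' k • V k t + ∑ k ∈ s, a k t • V' k) J t := by
  intro A
  simp only [Finset.sum_apply, Pi.smul_apply, smul_eq_mul]
  refine (HasDerivWithinAt.fun_sum fun k hk => (ha k hk).fun_mul (hV k hk A)).congr_deriv ?_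
  simp only [map_sum, map_smul, Pi.add_apply, Pi.sub_apply, Finset.sum_apply, Pi.smul_apply,
    smul_eq_mul, Finset.sum_add_distrib, mul_sub, Finset.sum_sub_distrib]
  ring

end CovariantTime

section Flow

variable {m n : ℕ} {G : Coord n → Matrix (Fin n) (Fin n) ℝ} {f : ℝ → Coord m → Coord n}
  {U : Set (Coord m)} {W : Set (Coord n)} {J : Set ℝ} {t : ℝ} {x : Coord m}

/-- A family of maps `f s`, `s ∈ J`, smooth in space and time, that is an immersion at time `t` and
moves at that time with velocity the mean curvature vector; `t` may be an end point of `J`. -/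
structure IsFlowAt (G : Coord n → Matrix (Fin n) (Fin n) ℝ) (f : ℝ → Coord m → Coord n)
    (U : Set (Coord m)) (W : Set (Coord n)) (J : Set ℝ) (t : ℝ) : Prop
    extends IsImmersionOn G (f t) U W where
  uniqueDiffOn : UniqueDiffOn ℝ J
  subset_closure : J ⊆ closure (interior J)
  mem : t ∈ J
  mapsTo_all : ∀ s ∈ J, MapsTo (f s) U W
  smooth_all : ContDiffOn ℝ ∞ (fun q : Coord m × ℝ => f q.2 q.1) (U ×ˢ J)
  flow : ∀ x ∈ U, ∀ A, HasDerivWithinAt (fun s => f s x A) (meanCurvature G (f t) x A) J t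

lemma IsFlowAt.isMapOn (hf : IsFlowAt G f U W J t) {s : ℝ} (hs : s ∈ J) :
    IsMapOn G (f s) U W where
  metric := hf.metric
  isOpen := hf.isOpen
  mapsTo := hf.mapsTo_all s hs
  smooth := hf.smooth_all.comp (f := fun x => (x, s)) (by fun_prop) fun _ hx => ⟨hx, hs⟩

lemma IsFlowAt.contDiffOn_tangent (hf : IsFlowAt G f U W J t) (i : Fin m) (A : Fin n) :
    ContDiffOn ℝ ∞ (fun q : Coord m × ℝ => tangent (f q.2) i q.1 A) (U ×ˢ J) :=
  contDiffOn_partialDeriv_prod hf.isOpen hf.uniqueDiffOn (u := fun s x => f s x A)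
    ((contDiffOn_piLp _).1 hf.smooth_all A) i

lemma IsFlowAt.hasDerivWithinAt_tangent (hf : IsFlowAt G f U W J t) (hx : x ∈ U) (i : Fin m)
    (A : Fin n) :
    HasDerivWithinAt (fun s => tangent (f s) i x A)
      (fieldDeriv i (meanCurvature G (f t)) x A) J t :=
  hasDerivWithinAt_partialDeriv hf.isOpen hf.uniqueDiffOn hf.subset_closure
    (u := fun s x => f s x A) ((contDiffOn_piLp _).1 hf.smooth_all A) hf.mem
    (fun x hx => hf.flow x hx A) hx i

lemma IsFlowAt.hasDerivWithinAt_fieldDeriv_tangent (hf : IsFlowAt G f U W J t) (hx : x ∈ U)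
    (i j : Fin m) (A : Fin n) :
    HasDerivWithinAt (fun s => fieldDeriv i (tangent (f s) j) x A)
      (fieldDeriv i (fieldDeriv j (meanCurvature G (f t))) x A) J t :=
  hasDerivWithinAt_partialDeriv hf.isOpen hf.uniqueDiffOn hf.subset_closure
    (u := fun s x => tangent (f s) j x A) (hf.contDiffOn_tangent j A) hf.mem
    (fun _ hx => hf.hasDerivWithinAt_tangent hx j A) hx i

lemma IsFlowAt.hasDerivWithinAt_inner (hf : IsFlowAt G f U W J t) (hx : x ∈ U)
    {X Y : ℝ → Fin n → ℝ} {X' Y' : Fin n → ℝ}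
    (hX : HasCovDerivWithinAt G (fun s => f s x) (meanCurvature G (f t) x) X X' J t)
    (hY : HasCovDerivWithinAt G (fun s => f s x) (meanCurvature G (f t) x) Y Y' J t) :
    HasDerivWithinAt (fun s => inner G (f s x) (X s) (Y s))
      (inner G (f t x) X' (Y t) + inner G (f t x) (X t) Y') J t :=
  HasCovDerivWithinAt.inner hf.metric (c := fun s => f s x) (hf.mapsTo hx) (hf.flow x hx) hX hY

lemma IsFlowAt.hasCovDerivWithinAt_tangent (hf : IsFlowAt G f U W J t) (hx : x ∈ U) (i : Fin m) :
    HasCovDerivWithinAt G (fun s => f s x) (meanCurvature G (f t) x)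
      (fun s => tangent (f s) i x) (covDeriv G (f t) i (meanCurvature G (f t)) x) J t := by
  intro A
  refine (hf.hasDerivWithinAt_tangent hx i A).congr_deriv ?_
  rw [covDeriv_eq, christoffelOn_comm hf.metric (hf.mapsTo hx) (tangent (f t) i x),
    add_sub_cancel_right]

lemma IsFlowAt.hasCovDerivWithinAt_covDeriv_tangent (hf : IsFlowAt G f U W J t) (hx : x ∈ U)
    (i j : Fin m) :
    HasCovDerivWithinAt G (fun s => f s x) (meanCurvature G (f t) x)
      (fun s => covDeriv G (f s) i (tangent (f s) j) x)
      (covDeriv G (f t) i (covDeriv G (f t) j (meanCurvature G (f t))) x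
        - curvatureVec G (f t x) (meanCurvature G (f t) x) (tangent (f t) i x)
          (tangent (f t) j x)) J t := by
  intro A
  have hG := hf.metric
  have hy := hf.mapsTo hx
  have htangent := hf.hasDerivWithinAt_tangent hx
  have hchristoffel := hasDerivWithinAt_christoffelOn hG (c := fun s => f s x) hy (hf.flow x hx)
    (htangent i) (htangent j) A
  simp only [covDeriv_eq (V := tangent _ j)]
  refine ((hf.hasDerivWithinAt_fieldDeriv_tangent hx i j A).fun_add hchristoffel).congr_deriv ?_
  rw [covDeriv_covDeriv_eq hf.toIsMapOn hx (smoothField_meanCurvature hf.toIsImmersionOn),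
    curvatureVec_eq, map_add, christoffelDerivOn_comm hG hy _ (tangent (f t) j x),
    christoffelOn_comm hG hy (fieldDeriv i (tangent (f t) j) x),
    christoffelOn_comm hG hy (tangent (f t) j x) (fieldDeriv i _ x),
    christoffelOn_comm hG hy (tangent (f t) j x) (meanCurvature G (f t) x)]
  simp only [Pi.add_apply, Pi.sub_apply]
  ring

lemma IsFlowAt.hasCovDerivWithinAt_covDeriv_tangent_swap (hf : IsFlowAt G f U W J t) (hx : x ∈ U)
    (i j : Fin m) :
    HasCovDerivWithinAt G (fun s => f s x) (meanCurvature G (f t) x)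
      (fun s => covDeriv G (f s) i (tangent (f s) j) x)
      (covDeriv G (f t) j (covDeriv G (f t) i (meanCurvature G (f t))) x
        - curvatureVec G (f t x) (meanCurvature G (f t) x) (tangent (f t) j x)
          (tangent (f t) i x)) J t := by
  intro A
  have h := hf.hasCovDerivWithinAt_covDeriv_tangent hx j i A
  simp only [covDeriv_tangent_comm hf.toIsMapOn hx j i] at h
  refine h.congr_of_mem (fun s hs => ?_) hf.mem
  exact congrFun (covDeriv_tangent_comm (hf.isMapOn hs) hx i j) A

lemma IsFlowAt.hasDerivWithinAt_inducedMetric (hf : IsFlowAt G f U W J t) (hx : x ∈ U)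
    (i j : Fin m) :
    HasDerivWithinAt (fun s => inducedMetric G (f s) x i j)
      (-2 * inner G (f t x) (meanCurvature G (f t) x) (secondFF G (f t) i j x)) J t := by
  have hI := hf.toIsImmersionOn
  have hcov := inner_covDeriv_of_isNormal hf.toIsMapOn hx (smoothField_meanCurvature hI)
    fun z hz => isNormal_meanCurvature hI hz
  refine (hf.hasDerivWithinAt_inner hx (hf.hasCovDerivWithinAt_tangent hx i)
    (hf.hasCovDerivWithinAt_tangent hx j)).congr_deriv ?_
  rw [hcov, inner_comm hf.metric (hf.mapsTo hx) (tangent (f t) i x), hcov,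
    secondFF_symm hf.toIsMapOn hx j i]
  ring

lemma IsFlowAt.hasDerivWithinAt_inducedInv (hf : IsFlowAt G f U W J t) (hx : x ∈ U)
    (hg : inducedMetric G (f t) x = 1) (i j : Fin m) :
    HasDerivWithinAt (fun s => inducedInv G (f s) i j x)
      (2 * inner G (f t x) (meanCurvature G (f t) x) (secondFF G (f t) i j x)) J t := by
  refine (hasDerivWithinAt_matrix_inv_apply (M' := Matrix.of fun a b => -2 * inner G (f t x)
    (meanCurvature G (f t) x) (secondFF G (f t) a b x)) (hf.hasDerivWithinAt_inducedMetric hx)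
    (hf.det_ne x hx) i j).congr_deriv ?_
  simp [hg]

lemma IsFlowAt.differentiableWithinAt_inducedConn (hf : IsFlowAt G f U W J t) (hx : x ∈ U)
    (hg : inducedMetric G (f t) x = 1) (k i j : Fin m) :
    DifferentiableWithinAt ℝ (fun s => inducedConn G (f s) k i j x) J t := by
  simp only [inducedConn, tangentialCoeff]
  exact DifferentiableWithinAt.fun_sum fun l _ =>
    (hf.hasDerivWithinAt_inducedInv hx hg k l).differentiableWithinAt.fun_mul
      (hf.hasDerivWithinAt_inner hx (hf.hasCovDerivWithinAt_covDeriv_tangent hx i j)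
        (hf.hasCovDerivWithinAt_tangent hx l)).differentiableWithinAt

lemma IsFlowAt.exists_hasCovDerivWithinAt_secondFF (hf : IsFlowAt G f U W J t) (hx : x ∈ U)
    (hg : inducedMetric G (f t) x = 1) (i j : Fin m) :
    ∃ A' : Fin n → ℝ,
      HasCovDerivWithinAt G (fun s => f s x) (meanCurvature G (f t) x)
        (fun s => secondFF G (f s) i j x) A' J t ∧
      ∀ ν, IsNormal G (f t) x ν → inner G (f t x) A' ν
        = inner G (f t x) (covDeriv G (f t) j (covDeriv G (f t) i (meanCurvature G (f t))) x
          - ∑ q, inducedConn G (f t) q j i x • covDeriv G (f t) q (meanCurvature G (f t)) x) ν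
        - curvatureOn G (f t x) (meanCurvature G (f t) x) (tangent (f t) j x)
          (tangent (f t) i x) ν := by
  have hderiv := (hf.hasCovDerivWithinAt_covDeriv_tangent_swap hx i j).sub
    (HasCovDerivWithinAt.sum_smul (s := Finset.univ)
      (fun k _ => (hf.differentiableWithinAt_inducedConn hx hg k i j).hasDerivWithinAt)
      fun k _ => hf.hasCovDerivWithinAt_tangent hx k)
  refine ⟨_, by simpa only [secondFF_eq] using hderiv, fun ν hν => ?_⟩
  simp only [inner_sub_left, inner_add_left, inner_sum_tangent hν, inner_curvatureVec,
    fun q => inducedConn_symm hf.toIsMapOn hx q i j]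
  ring

end Flow

/-! ### The evolution equations in local coordinates -/

section Evolution

variable {m n r : ℕ} {G : Coord n → Matrix (Fin n) (Fin n) ℝ} {f : ℝ → Coord m → Coord n}
  {U : Set (Coord m)} {W : Set (Coord n)} {J : Set ℝ} {t : ℝ} {x : Coord m}

lemma IsFlowAt.hasDerivWithinAt_hCoeff (hmn : m + r = n) (hf : IsFlowAt G f U W J t) (hx : x ∈ U)
    (hg : inducedMetric G (f t) x = 1) {e : Fin r → ℝ → Fin n → ℝ} {dν : Fin r → Fin n → ℝ}
    (hν : IsNormalFrame G (f t) x (fun α => e α t))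
    (he : ∀ α, HasCovDerivWithinAt G (fun s => f s x) (meanCurvature G (f t) x) (e α) (dν α) J t)
    (α : Fin r) (i j : Fin m) :
    HasDerivWithinAt (fun s => hCoeff G (f s) x (fun β => e β s) α i j)
      (hEvolution G (f t) x (fun β => e β t) dν α i j) J t := by
  have hI := hf.toIsImmersionOn
  have hm := hf.toIsMapOn
  obtain ⟨A', hA', inner_A'⟩ := hf.exists_hasCovDerivWithinAt_secondFF hx hg i j
  refine (hf.hasDerivWithinAt_inner hx hA' (he α)).congr_deriv ?_
  rw [inner_A' _ (hν.isNormal hm hx α), simons_identity hmn hI hx hg hν, hEvolution_eq,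
    hν.inner_eq_sum hmn hm hx hg (isNormal_secondFF hI hx i j)]
  rfl

lemma IsNormalFrame.inner_meanCurvature_secondFF {f : Coord m → Coord n} (hmn : m + r = n)
    (hf : IsImmersionOn G f U W) (hx : x ∈ U) (hg : inducedMetric G f x = 1)
    {ν : Fin r → Fin n → ℝ} (hν : IsNormalFrame G f x ν) (i j : Fin m) :
    inner G (f x) (meanCurvature G f x) (secondFF G f i j x)
      = ∑ β, hCoeff G f x ν β i j * ∑ l, hCoeff G f x ν β l l := by
  simp only [meanCurvature_of_eq_one hg, inner_sum_left, hν.inner_secondFF hmn hf hx hg,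
    Finset.mul_sum]
  rw [Finset.sum_comm]
  simp only [mul_comm]

lemma IsFlowAt.hasDerivWithinAt_normSqSFF_of_hasCovDerivWithinAt (hf : IsFlowAt G f U W J t)
    (hx : x ∈ U) (hg : inducedMetric G (f t) x = 1) {A' : Fin m → Fin m → Fin n → ℝ}
    (hA' : ∀ i j, HasCovDerivWithinAt G (fun s => f s x) (meanCurvature G (f t) x)
      (fun s => secondFF G (f s) i j x) (A' i j) J t) :
    HasDerivWithinAt (fun s => normSqSFF G (f s) x)
      (4 * ∑ i, ∑ j, ∑ k, inner G (f t x) (meanCurvature G (f t) x) (secondFF G (f t) i k x)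
          * inner G (f t x) (secondFF G (f t) i j x) (secondFF G (f t) k j x)
        + 2 * ∑ i, ∑ j, inner G (f t x) (A' i j) (secondFF G (f t) i j x)) J t := by
  have hinv := hf.hasDerivWithinAt_inducedInv hx hg
  refine (HasDerivWithinAt.fun_sum fun i _ => HasDerivWithinAt.fun_sum fun j _ =>
    HasDerivWithinAt.fun_sum fun k _ => HasDerivWithinAt.fun_sum fun l _ =>
      ((hinv i k).fun_mul (hinv j l)).fun_mul
        (hf.hasDerivWithinAt_inner hx (hA' i j) (hA' k l))).congr_deriv ?_
  have second_index_eq : ∑ i, ∑ j, ∑ l,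
        inner G (f t x) (meanCurvature G (f t) x) (secondFF G (f t) j l x)
          * inner G (f t x) (secondFF G (f t) i j x) (secondFF G (f t) i l x)
      = ∑ i, ∑ j, ∑ k, inner G (f t x) (meanCurvature G (f t) x) (secondFF G (f t) i k x)
          * inner G (f t x) (secondFF G (f t) i j x) (secondFF G (f t) k j x) := by
    rw [Finset.sum_comm]
    simp only [fun i j => secondFF_symm hf.toIsMapOn hx i j]
  simp only [inducedInv_of_eq_one hg, add_mul, mul_add, Finset.sum_add_distrib, ite_mul, mul_ite,
    one_mul, mul_one, zero_mul, mul_zero, Finset.sum_ite_eq, Finset.mem_univ, if_true,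
    Finset.sum_ite_irrel, Finset.sum_const_zero, mul_assoc, ← Finset.mul_sum,
    inner_comm hf.metric (hf.mapsTo hx) (secondFF G (f t) _ _ x) (A' _ _), second_index_eq]
  ring

lemma IsFlowAt.hasDerivWithinAt_normSqSFF (hmn : m + r = n) (hf : IsFlowAt G f U W J t)
    (hx : x ∈ U) (hg : inducedMetric G (f t) x = 1) {ν : Fin r → Fin n → ℝ}
    (hν : IsNormalFrame G (f t) x ν) :
    HasDerivWithinAt (fun s => normSqSFF G (f s) x) (normSqEvolution G (f t) x ν) J t := by
  have hI := hf.toIsImmersionOn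
  have hm := hf.toIsMapOn
  have hcomm := inner_comm hf.metric (hf.mapsTo hx)
  choose A' hA' inner_A' using hf.exists_hasCovDerivWithinAt_secondFF hx hg
  have inner_A'_secondFF (i j : Fin m) : inner G (f t x) (A' i j) (secondFF G (f t) i j x)
      = ∑ α, (inner G (f t x) (laplacianSFF G (f t) i j x) (ν α)
          + curvatureTerms G (f t) x ν α i j + cubicTerms (hCoeff G (f t) x ν) α i j)
        * hCoeff G (f t) x ν α i j := by
    rw [hcomm, hν.inner_eq_sum hmn hm hx hg (isNormal_secondFF hI hx i j)]
    refine Finset.sum_congr rfl fun α _ => ?_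
    rw [hcomm (ν α), inner_A' i j _ (hν.isNormal hm hx α), simons_identity hmn hI hx hg hν,
      mul_comm]
    rfl
  refine (hf.hasDerivWithinAt_normSqSFF_of_hasCovDerivWithinAt hx hg hA').congr_deriv ?_
  simp only [normSqEvolution_eq hmn hI hx hg hν, inner_A'_secondFF,
    hν.inner_secondFF hmn hI hx hg, hν.inner_meanCurvature_secondFF hmn hI hx hg]
  congr 2
  exact Finset.sum_comm_cycle

end Evolution

/-! ### Reduction to local coordinates -/

lemma det_ne_zero_of_pos {ι V : Type*} [Fintype ι] [DecidableEq ι] [AddCommGroup V] [Module ℝ V]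
    (B : V →ₗ[ℝ] V →ₗ[ℝ] ℝ) (hB : ∀ v, v ≠ 0 → 0 < B v v) {e : ι → V}
    (he : LinearIndependent ℝ e) : (Matrix.of fun i j => B (e i) (e j)).det ≠ 0 := by
  intro hdet
  obtain ⟨v, hv, hBv⟩ := Matrix.exists_vecMul_eq_zero_iff.2 hdet
  refine (hB (∑ i, v i • e i) fun h => hv (funext (Fintype.linearIndependent_iff.1 he v h))).ne' ?_
  calc B (∑ i, v i • e i) (∑ j, v j • e j)
      = ∑ i, v i * Matrix.vecMul v (Matrix.of fun i j => B (e i) (e j)) i := by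
        simp [Matrix.vecMul, dotProduct]
    _ = 0 := by simp [hBv]

lemma Ico_inter_subset_closure_interior (a b : ℝ) {N : Set ℝ} (hN : IsOpen N) :
    Ico a b ∩ N ⊆ closure (interior (Ico a b ∩ N)) := by
  rintro t ⟨ht, htN⟩
  have hab : a ≠ b := (ht.1.trans_lt ht.2).ne
  rw [interior_inter, interior_Ico, hN.interior_eq]
  refine hN.closure_inter ⟨?_, htN⟩
  rw [closure_Ioo hab]
  exact Ico_subset_Icc_self ht

lemma IsMapOn.isImmersionOn_inter_det_ne {m n : ℕ} {G : Coord n → Matrix (Fin n) (Fin n) ℝ}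
    {f : Coord m → Coord n} {U : Set (Coord m)} {W : Set (Coord n)} (hf : IsMapOn G f U W) :
    IsImmersionOn G f (U ∩ {x | (inducedMetric G f x).det ≠ 0}) W where
  metric := hf.metric
  isOpen := (contDiffOn_matrix_det (contDiffOn_inducedMetric hf)).continuousOn.isOpen_inter_preimage
    hf.isOpen isOpen_ne
  mapsTo := hf.mapsTo.mono_left inter_subset_left
  smooth := hf.smooth.mono inter_subset_left
  det_ne _ hx := hx.2

section Charts

variable {n : ℕ} {M : Type*} [TopologicalSpace M] [ChartedSpace (Coord n) M]
  {ψ : OpenPartialHomeomorph M (Coord n)}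

lemma mfderiv_symm_injective (hψ : ψ ∈ IsManifold.maximalAtlas (𝓡 n) ∞ M) {y : Coord n}
    (hy : y ∈ ψ.target) : Function.Injective (mfderiv (𝓡 n) (𝓡 n) ψ.symm y) :=
  OpenPartialHomeomorph.MDifferentiable.mfderiv_injective (e := ψ.symm)
    ⟨(contMDiffOn_symm_of_mem_maximalAtlas hψ).mdifferentiableOn (by simp),
      (contMDiffOn_of_mem_maximalAtlas hψ).mdifferentiableOn (by simp)⟩ hy

variable [IsManifold (𝓡 n) ∞ M]

lemma contMDiffOn_coordinateField (hψ : ψ ∈ IsManifold.maximalAtlas (𝓡 n) ∞ M) (v : Coord n) :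
    ContMDiffOn (𝓡 n) ((𝓡 n).prod 𝓘(ℝ, Coord n)) ∞
      (fun y => Bundle.TotalSpace.mk' (Coord n) (E := fun y : M => TangentSpace (𝓡 n) y)
        (ψ.symm y) (mfderiv (𝓡 n) (𝓡 n) ψ.symm y v)) ψ.target := by
  have tangentMap_smooth := (contMDiffOn_symm_of_mem_maximalAtlas hψ).contMDiffOn_tangentMapWithin
    (m := ∞) (by simp) ψ.open_target.uniqueMDiffOn
  have const_smooth : ContMDiffOn (𝓡 n) (𝓡 n).tangent ∞
      (fun y : Coord n => (⟨y, v⟩ : TangentBundle (𝓡 n) (Coord n))) ψ.target :=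
    contMDiffOn_vectorSpace_iff_contDiffOn.2 contDiffOn_const
  refine (tangentMap_smooth.comp const_smooth fun y hy => hy).congr fun y hy => ?_
  simp only [Function.comp, tangentMapWithin, mfderivWithin_of_isOpen ψ.open_target hy]

variable
  (g : Bundle.ContMDiffRiemannianMetric (𝓡 n) ∞ (Coord n) (fun y : M => TangentSpace (𝓡 n) y))

lemma contDiffOn_metricInChart (hψ : ψ ∈ IsManifold.maximalAtlas (𝓡 n) ∞ M) (A B : Fin n) :
    ContDiffOn ℝ ∞ (fun y => metricInChart g ψ y A B) ψ.target := by
  rw [← contMDiffOn_iff_contDiffOn]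
  intro y hy
  have section_smooth : ContMDiffWithinAt (𝓡 n) ((𝓡 n).prod 𝓘(ℝ)) ∞
      (fun y => Bundle.TotalSpace.mk' ℝ (E := Bundle.Trivial M ℝ) (ψ.symm y)
        (g.inner (ψ.symm y) (mfderiv (𝓡 n) (𝓡 n) ψ.symm y (EuclideanSpace.single A 1))
          (mfderiv (𝓡 n) (𝓡 n) ψ.symm y (EuclideanSpace.single B 1)))) ψ.target y :=
    ContMDiffWithinAt.clm_bundle_apply₂ (F₁ := Coord n) (F₂ := Coord n)
      (g.contMDiff.contMDiffAt.comp_contMDiffWithinAt y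
        (contMDiffOn_symm_of_mem_maximalAtlas hψ y hy))
      (contMDiffOn_coordinateField hψ _ y hy) (contMDiffOn_coordinateField hψ _ y hy)
  exact (Bundle.contMDiffWithinAt_totalSpace.1 section_smooth).2

lemma det_metricInChart_ne_zero (hψ : ψ ∈ IsManifold.maximalAtlas (𝓡 n) ∞ M) {y : Coord n}
    (hy : y ∈ ψ.target) : (metricInChart g ψ y).det ≠ 0 :=
  det_ne_zero_of_pos (g.inner (ψ.symm y)).toLinearMap₁₂ (g.pos (ψ.symm y))
    (EuclideanSpace.orthonormal_single.linearIndependent.map'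
      (mfderiv (𝓡 n) (𝓡 n) ψ.symm y).toLinearMap
      (LinearMap.ker_eq_bot.2 (mfderiv_symm_injective hψ hy)))

lemma isMetricOn_metricInChart (hψ : ψ ∈ IsManifold.maximalAtlas (𝓡 n) ∞ M) :
    IsMetricOn (metricInChart g ψ) ψ.target where
  isOpen := ψ.open_target
  smooth := contDiffOn_metricInChart g hψ
  symm _ _ _ _ := g.symm _ _ _
  det_ne _ hy := det_metricInChart_ne_zero g hψ hy

variable {g} {m : ℕ} {S : Type*} [TopologicalSpace S] [ChartedSpace (Coord m) S]
  {T : ℝ} {F : S → ℝ → M} {φ : OpenPartialHomeomorph S (Coord m)}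

lemma IsMeanCurvatureFlow.contMDiffOn_comp_symm (hF : IsMeanCurvatureFlow (m := m) g T F)
    (hφ : φ ∈ IsManifold.maximalAtlas (𝓡 m) ∞ S) :
    ContMDiffOn ((𝓡 m).prod 𝓘(ℝ, ℝ)) (𝓡 n) ∞
      (fun q : Coord m × ℝ => F (φ.symm q.1) q.2) (φ.target ×ˢ Ico 0 T) :=
  hF.smooth.comp (f := fun q : Coord m × ℝ => (φ.symm q.1, q.2))
    (((contMDiffOn_symm_of_mem_maximalAtlas hφ).comp contMDiff_fst.contMDiffOn
      fun _ hq => hq.1).prodMk contMDiff_snd.contMDiffOn) fun _ hq => ⟨mem_univ _, hq.2⟩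

lemma IsMeanCurvatureFlow.contDiffOn_inCharts (hF : IsMeanCurvatureFlow (m := m) g T F)
    (hφ : φ ∈ IsManifold.maximalAtlas (𝓡 m) ∞ S) (hψ : ψ ∈ IsManifold.maximalAtlas (𝓡 n) ∞ M)
    {U : Set (Coord m)} {J : Set ℝ} (hU : U ⊆ φ.target) (hJ : J ⊆ Ico 0 T)
    (hUJ : ∀ x ∈ U, ∀ s ∈ J, F (φ.symm x) s ∈ ψ.source) :
    ContDiffOn ℝ ∞ (fun q : Coord m × ℝ => inCharts φ ψ F q.2 q.1) (U ×ˢ J) := by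
  have hsmooth : ContMDiffOn ((𝓡 m).prod 𝓘(ℝ, ℝ)) (𝓡 n) ∞
      (fun q : Coord m × ℝ => ψ (F (φ.symm q.1) q.2)) (U ×ˢ J) :=
    (contMDiffOn_of_mem_maximalAtlas hψ).comp (f := fun q : Coord m × ℝ => F (φ.symm q.1) q.2)
      ((hF.contMDiffOn_comp_symm hφ).mono (prod_mono hU hJ)) fun q hq => hUJ q.1 hq.1 q.2 hq.2
  rw [← contMDiffOn_iff_contDiffOn, modelWithCornersSelf_prod, ← chartedSpaceSelf_prod]
  exact hsmooth

lemma IsMeanCurvatureFlow.exists_isOpen_mem_source (hF : IsMeanCurvatureFlow (m := m) g T F)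
    (hφ : φ ∈ IsManifold.maximalAtlas (𝓡 m) ∞ S) {p : S} (hp : p ∈ φ.source) {t : ℝ}
    (ht : t ∈ Ico 0 T) (hpt : F p t ∈ ψ.source) :
    ∃ U N, IsOpen U ∧ IsOpen N ∧ φ p ∈ U ∧ t ∈ N ∧ U ⊆ φ.target ∧
      ∀ x ∈ U, ∀ s ∈ Ico 0 T ∩ N, F (φ.symm x) s ∈ ψ.source := by
  have hnhds : (fun q : Coord m × ℝ => F (φ.symm q.1) q.2) ⁻¹' ψ.source
      ∈ 𝓝[φ.target ×ˢ Ico 0 T] (φ p, t) := by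
    refine ((hF.contMDiffOn_comp_symm hφ).continuousOn _
      ⟨φ.map_source hp, ht⟩).preimage_mem_nhdsWithin (ψ.open_source.mem_nhds ?_)
    simpa [φ.left_inv hp] using hpt
  obtain ⟨O, hO, hpO, hsource⟩ := mem_nhdsWithin.1 hnhds
  obtain ⟨U, N, hU, hN, hpU, htN, hUN⟩ := isOpen_prod_iff.1 hO _ _ hpO
  exact ⟨U ∩ φ.target, N, hU.inter φ.open_target, hN, ⟨hpU, φ.map_source hp⟩, htN,
    inter_subset_right, fun x hx s hs =>
      hsource ⟨hUN (mk_mem_prod hx.1 hs.2), mk_mem_prod hx.2 hs.1⟩⟩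

lemma IsMeanCurvatureFlow.exists_isFlowAt (hF : IsMeanCurvatureFlow (m := m) g T F)
    (hφ : φ ∈ IsManifold.maximalAtlas (𝓡 m) ∞ S) (hψ : ψ ∈ IsManifold.maximalAtlas (𝓡 n) ∞ M)
    {p : S} (hp : p ∈ φ.source) {t : ℝ} (ht : t ∈ Ico 0 T) (hpt : F p t ∈ ψ.source)
    (hdet : (inducedMetric (metricInChart g ψ) (inCharts φ ψ F t) (φ p)).det ≠ 0) :
    ∃ U, ∃ N ∈ 𝓝 t, φ p ∈ U ∧
      IsFlowAt (metricInChart g ψ) (inCharts φ ψ F) U ψ.target (Ico 0 T ∩ N) t := by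
  obtain ⟨U, N, hU, hN, hpU, htN, hUφ, hsource⟩ := hF.exists_isOpen_mem_source hφ hp ht hpt
  have hsmooth := hF.contDiffOn_inCharts hφ hψ hUφ inter_subset_left hsource
  have hmap : IsMapOn (metricInChart g ψ) (inCharts φ ψ F t) U ψ.target :=
    { metric := isMetricOn_metricInChart g hψ
      isOpen := hU
      mapsTo := fun x hx => ψ.map_source (hsource x hx t ⟨ht, htN⟩)
      smooth := hsmooth.comp (f := fun x => (x, t)) (by fun_prop) fun x hx => ⟨hx, ht, htN⟩ }
  refine ⟨_, N, hN.mem_nhds htN, mem_inter hpU hdet,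
    { toIsImmersionOn := hmap.isImmersionOn_inter_det_ne
      uniqueDiffOn := (uniqueDiffOn_Ico 0 T).inter hN
      subset_closure := Ico_inter_subset_closure_interior 0 T hN
      mem := ⟨ht, htN⟩
      mapsTo_all := fun s hs x hx => ψ.map_source (hsource x hx.1 s hs)
      smooth_all := hsmooth.mono (prod_mono inter_subset_left subset_rfl)
      flow := fun x hx A => ?_ }⟩
  have hflow := hF.flow φ hφ ψ hψ (φ.symm x) (φ.map_target (hUφ hx.1)) t ht
    (hsource x hx.1 t ⟨ht, htN⟩) A
  rw [φ.right_inv (hUφ hx.1)] at hflow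
  exact hflow.mono inter_subset_left

end Charts

end MCF

end

/-- Evolution of the second fundamental form along a mean curvature flow, at a point `(p, t)`, in
local coordinates `φ` of the source that are orthonormal at `(p, t)` and any local coordinates `ψ`
of the target. The first part is the equation of `h_{αij} = ⟨A(∂ᵢ, ∂ⱼ), e_α⟩` for an orthonormal
frame `e_α` of the normal spaces along the trajectory of `p`; the second is the equation of `|A|²`,
written in an orthonormal basis `ν` of the normal space at `(p, t)`. -/
theorem mainTheorem10 {m n r : ℕ} (hmn : m + r = n)
    {S : Type*} [TopologicalSpace S] [ChartedSpace (MCF.Coord m) S] [IsManifold (𝓡 m) ∞ S]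
    {M : Type*} [TopologicalSpace M] [ChartedSpace (MCF.Coord n) M] [IsManifold (𝓡 n) ∞ M]
    (g : Bundle.ContMDiffRiemannianMetric (𝓡 n) ∞ (MCF.Coord n)
      (fun y : M => TangentSpace (𝓡 n) y))
    (T : ℝ) (F : S → ℝ → M) (hF : MCF.IsMeanCurvatureFlow (m := m) g T F)
    (φ : OpenPartialHomeomorph S (MCF.Coord m)) (hφ : φ ∈ IsManifold.maximalAtlas (𝓡 m) ∞ S)
    (ψ : OpenPartialHomeomorph M (MCF.Coord n)) (hψ : ψ ∈ IsManifold.maximalAtlas (𝓡 n) ∞ M)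
    (p : S) (hp : p ∈ φ.source) (t : ℝ) (ht : t ∈ Ico 0 T) (hpt : F p t ∈ ψ.source)
    (horth : MCF.inducedMetric (MCF.metricInChart g ψ) (MCF.inCharts φ ψ F t) (φ p) = 1) :
    (∀ e : Fin r → ℝ → Fin n → ℝ,
      (∀ᶠ s in 𝓝[Ico 0 T] t, MCF.IsNormalFrame (MCF.metricInChart g ψ) (MCF.inCharts φ ψ F s)
        (φ p) (fun α => e α s)) →
      (∀ α A, DifferentiableWithinAt ℝ (fun s => e α s A) (Ico 0 T) t) →
      ∀ (α : Fin r) (i j : Fin m),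
        HasDerivWithinAt
          (fun s => MCF.hCoeff (MCF.metricInChart g ψ) (MCF.inCharts φ ψ F s) (φ p)
            (fun β => e β s) α i j)
          (MCF.hEvolution (MCF.metricInChart g ψ) (MCF.inCharts φ ψ F t) (φ p)
            (fun β => e β t)
            (fun β => MCF.covDerivTime (MCF.metricInChart g ψ) (Ico 0 T) (ψ (F p t))
              (MCF.meanCurvature (MCF.metricInChart g ψ) (MCF.inCharts φ ψ F t) (φ p)) (e β) t)
            α i j)
          (Ico 0 T) t) ∧
    (∀ ν : Fin r → Fin n → ℝ,
      MCF.IsNormalFrame (MCF.metricInChart g ψ) (MCF.inCharts φ ψ F t) (φ p) ν →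
        HasDerivWithinAt
          (fun s => MCF.normSqSFF (MCF.metricInChart g ψ) (MCF.inCharts φ ψ F s) (φ p))
          (MCF.normSqEvolution (MCF.metricInChart g ψ) (MCF.inCharts φ ψ F t) (φ p) ν)
          (Ico 0 T) t) := by
  obtain ⟨U, N, hN, hpU, hf⟩ := hF.exists_isFlowAt hφ hψ hp ht hpt (by simp [horth])
  have hbase : MCF.inCharts φ ψ F t (φ p) = ψ (F p t) := by rw [MCF.inCharts, φ.left_inv hp]
  refine ⟨fun e he hd α i j => ?_, fun ν hν => ?_⟩
  · refine (hasDerivWithinAt_inter hN).1 (hf.hasDerivWithinAt_hCoeff hmn hpU horth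
      (he.self_of_nhdsWithin ht) (fun β => ?_) α i j)
    rw [← hbase]
    exact (MCF.hasCovDerivWithinAt_covDerivTime (hd β)).mono inter_subset_left
  · exact (hasDerivWithinAt_inter hN).1 (hf.hasDerivWithinAt_normSqSFF hmn hpU horth hν)
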